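/- All manifolds are smooth, finite-dimensional, without boundary, Hausdorff and second countable. A Lie groupoid $\mathcal G=(\mathcal G_1\rightrightarrows\mathcal G_0)$ has smooth structure maps and submersive source $s$ and target $t$; functors and natural transformations are smooth. A functor $\varphi:\mathcal G\to\mathcal H$ is a weak equivalence if $\mathcal G_0\,{}_{\varphi}\!\times_{t}\mathcal H_1\to\mathcal H_0$, $(x,h)\mapsto s(h)$, is a surjective submersion and $\mathcal G_1\to \mathcal G_0^2\,{}_{\varphi^2}\!\times_{(s,t)}\mathcal H_1$, $g\mapsto(s(g),t(g),\varphi(g))$, is a diffeomorphism; it is surjective submersive if moreover $\varphi_0$ is a surjective submersion. For a smooth action of a Lie group $G$ on a manifold $X$, the action groupoid $G\ltimes X$ has objects $X$, arrows $G\times X$, $s(g,x)=x$, $t(g,x)=gx$. A functor $\varphi:G\ltimes X\to H\ltimes Y$ is equivariant if $\varphi(g,x)=(\widetilde\varphi(g),\varphi_0(x))$ for some Lie group homomorphism $\widetilde\varphi:G\to H$ and smooth map $\varphi_0:X\to Y$. Let $\mathcal P$ be any (possibly empty) subset of the list of properties: free; locally free (some neighbourhood of $1_G$ contains no $g\neq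 1_G$ fixing a point of $X$); transitive; effective; compact (the group is compact); discrete (the group is discrete); proper ($(s,t)$ is a proper map); is an orbifold groupoid (Morita equivalent, i.e. linked by a span of two weak equivalences, to a proper Lie groupoid whose source is a local diffeomorphism). **Proposition.** There is a bicategory $\mathbf{AnaActGpd}_{\mathcal P}$ as follows. * Objects are the action groupoids (given through their actions) with all properties in $\mathcal P$. * $1$-cells from $\mathcal G$ to $\mathcal H$ are the $\mathcal P$-anafunctors: spans $\mathcal G\xleftarrow{\varphi}\mathcal K\xrightarrow{\psi}\mathcal H$ of equivariant functors, $\mathcal K$ an action groupoid with all properties in $\mathcal P$, and $\varphi$ a surjective submersive weak equivalence. The identity of $\mathcal G$ is $\mathcal G\xleftarrow{=}\mathcal G\xrightarrow{=}\mathcal G$. * The composite of $\mathcal G\xleftarrow{\varphi}\mathcal K\xrightarrow{\psi}\mathcal H$ and $\mathcal H\xleftarrow{\chi}\mathcal L\xrightarrow{\omega}\mathcal I$ is $\mathcal G\xleftarrow{\varphi\circ\mathrm{pr}_1}\mathcal K\,{}_{\psi}\!\times_{\chi}\mathcal L\xrightarrow{\omega\circ\mathrm{pr}_2}\mathcal I$,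 where $\mathcal K\,{}_{\psi}\!\times_{\chi}\mathcal L$ is the strict pullback (fibred products of objects and of arrows), realised as an action groupoid with all properties in $\mathcal P$ and with equivariant projections. * $2$-cells from $\mathcal G\xleftarrow{\varphi}\mathcal K\xrightarrow{\psi}\mathcal H$ to $\mathcal G\xleftarrow{\varphi'}\mathcal K'\xrightarrow{\psi'}\mathcal H$ are the smooth natural transformations $\eta:\psi\circ\mathrm{pr}_1\Rightarrow\psi'\circ\mathrm{pr}_2$ of functors $\mathcal K\,{}_{\varphi}\!\times_{\varphi'}\mathcal K'\to\mathcal H$. * The identity $2$-cell of $\mathcal G\xleftarrow{\varphi}\mathcal K\xrightarrow{\psi}\mathcal H$ sends $(y,y')$ to $\psi(k)$, where $k:y\to y'$ is the unique arrow for which $\varphi(k)$ is an identity. * The vertical composite of $\eta$ and $\theta$ sends $(y,y'')$ to $\theta(y',y'')\,\eta(y,y')$, for any $y'$ with the same image in $\mathcal G_0$. * For $2$-cells $\eta:(\varphi,\psi)\Rightarrow(\varphi',\psi')$ from $\mathcal G$ to $\mathcal H$ and $\theta:(\chi,\omega)\Rightarrow(\chi',\omega')$ from $\mathcal H$ to $\mathcal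 I$, the horizontal composite sends $((y,l),(y',l'))$ to $\theta(l_1,l')\,\omega(\ell)$, for any arrow $\ell:l\to l_1$ with $\chi(\ell)=\eta(y,y')$; whiskerings are the case where $\eta$ or $\theta$ is an identity. * The associator and the unitors are the $2$-cells induced by the canonical isomorphism $(\mathcal K\times_{\mathcal H}\mathcal L)\times_{\mathcal I}\mathcal M\cong\mathcal K\times_{\mathcal H}(\mathcal L\times_{\mathcal I}\mathcal M)$ and by the projections $\mathcal G\times_{\mathcal G}\mathcal K\to\mathcal K$ and $\mathcal K\times_{\mathcal H}\mathcal H\to\mathcal K$; here a functor $f:\mathcal K\to\mathcal K'$ with $\varphi' f=\varphi$, $\psi' f=\psi$ induces the $2$-cell sending $(y,y')$ to $\psi'(k')$, where $k':f(y)\to y'$ is the unique arrow for which $\varphi'(k')$ is an identity. -/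

import Mathlib

open CategoryTheory
open scoped Manifold ContDiff Topology

universe u

noncomputable section

namespace AnaGpd

/-! ### Manifolds and fibred products -/

/-- A smooth manifold: finite-dimensional, without boundary, Hausdorff and second countable. -/
structure Mfd : Type (u + 1) where
  carrier : Type u
  E : Type
  H : Type
  [normed : NormedAddCommGroup E]
  [space : NormedSpace ℝ E]
  [finDim : FiniteDimensional ℝ E]
  [topModel : TopologicalSpace H]
  I : ModelWithCorners ℝ E H
  [boundaryless : I.Boundaryless]
  [top : TopologicalSpace carrier]
  [charted : ChartedSpace H carrier]
  [manifold : IsManifold I ∞ carrier]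
  [hausdorff : T2Space carrier]
  [countable : SecondCountableTopology carrier]

instance : CoeSort Mfd.{u} (Type u) := ⟨Mfd.carrier⟩

attribute [instance] Mfd.normed Mfd.space Mfd.finDim Mfd.topModel Mfd.boundaryless Mfd.top
  Mfd.charted Mfd.manifold Mfd.hausdorff Mfd.countable

/-- The product manifold. -/
def Mfd.prod (M N : Mfd.{u}) : Mfd.{u} where
  carrier := M × N
  E := M.E × N.E
  H := ModelProd M.H N.H
  I := M.I.prod N.I

/-- Smooth, that is infinitely differentiable, maps of manifolds. -/
def Smooth {M N : Mfd.{u}} (f : M → N) : Prop := ContMDiff M.I N.I ∞ f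

/-- Smooth submersions of manifolds. -/
def Submersion {M N : Mfd.{u}} (f : M → N) : Prop := Manifold.IsSubmersion M.I N.I ∞ f

/-- The manifold `P` with the maps `p : P → M` and `q : P → N` is the fibred product of
`f : M → B` and `g : N → B`: as a set it is `{(m, n) | f m = g n}`, and a map into it is smooth
exactly when its two components are. -/
structure IsFibredProduct {M N B P : Mfd.{u}} (f : M → B) (g : N → B) (p : P → M) (q : P → N) :
    Prop where
  smooth_fst : Smooth p
  smooth_snd : Smooth q
  comm : ∀ z, f (p z) = g (q z)
  existsUnique : ∀ m n, f m = g n → ∃! z, p z = m ∧ q z = n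
  smooth_lift : ∀ (Z : Mfd.{u}) (h : Z → P),
    Smooth (fun z => p (h z)) → Smooth (fun z => q (h z)) → Smooth h

/-- Smoothness of a map `η` defined on the set `{(m, n) | f m = g n}`: it sends every smooth
family of points of this set, parametrised by a manifold, to a smooth family. When the set is a
fibred product of manifolds, this is smoothness of `η` on that manifold, see
`smoothOnFibredProduct_iff`. -/
def SmoothOnFibredProduct {M N B A : Mfd.{u}} (f : M → B) (g : N → B)
    (η : ∀ (m : M) (n : N), f m = g n → A) : Prop :=
  ∀ (Z : Mfd.{u}) (a : Z → M) (b : Z → N), Smooth a → Smooth b →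
    ∀ h : ∀ z, f (a z) = g (b z), Smooth (fun z => η (a z) (b z) (h z))

theorem smoothOnFibredProduct_iff {M N B P A : Mfd.{u}} {f : M → B} {g : N → B} {p : P → M}
    {q : P → N} (hP : IsFibredProduct f g p q) (η : ∀ (m : M) (n : N), f m = g n → A) :
    SmoothOnFibredProduct f g η ↔ Smooth (fun z => η (p z) (q z) (hP.comm z)) := by
  refine ⟨fun h => h P p q hP.smooth_fst hP.smooth_snd hP.comm, fun h Z a b ha hb hab => ?_⟩
  choose k hk _ using fun z => hP.existsUnique (a z) (b z) (hab z)
  have hkp : (fun z => p (k z)) = a := funext fun z => (hk z).1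
  have hkq : (fun z => q (k z)) = b := funext fun z => (hk z).2
  have hks : Smooth k := hP.smooth_lift Z k (by rwa [hkp]) (by rwa [hkq])
  have := ContMDiff.comp h hks
  subst hkp hkq
  exact this

/-! ### Lie groupoids, functors and weak equivalences -/

/-- A Lie groupoid. The product `mul g h` is "`g` after `h`". -/
structure LieGroupoid : Type (u + 1) where
  Obj : Mfd.{u}
  Arr : Mfd.{u}
  src : Arr → Obj
  tgt : Arr → Obj
  unit : Obj → Arr
  inv : Arr → Arr
  mul : ∀ g h : Arr, src g = tgt h → Arr
  src_unit : ∀ x, src (unit x) = x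
  tgt_unit : ∀ x, tgt (unit x) = x
  src_inv : ∀ g, src (inv g) = tgt g
  tgt_inv : ∀ g, tgt (inv g) = src g
  src_mul : ∀ g h e, src (mul g h e) = src h
  tgt_mul : ∀ g h e, tgt (mul g h e) = tgt g
  mul_unit : ∀ g, mul g (unit (src g)) (tgt_unit _).symm = g
  unit_mul : ∀ g, mul (unit (tgt g)) g (src_unit _) = g
  mul_inv : ∀ g, mul g (inv g) (tgt_inv g).symm = unit (tgt g)
  inv_mul : ∀ g, mul (inv g) g (src_inv g) = unit (src g)
  mul_assoc : ∀ g h k e e', mul (mul g h e) k ((src_mul g h e).trans e') =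
    mul g (mul h k e') (e.trans (tgt_mul h k e').symm)
  smooth_src : Smooth src
  smooth_tgt : Smooth tgt
  submersion_src : Submersion src
  submersion_tgt : Submersion tgt
  smooth_unit : Smooth unit
  smooth_inv : Smooth inv
  smooth_mul : SmoothOnFibredProduct src tgt mul

/-- Smooth functors of Lie groupoids. -/
@[ext]
structure LieFunctor (𝒢 ℋ : LieGroupoid.{u}) : Type u where
  obj : 𝒢.Obj → ℋ.Obj
  arr : 𝒢.Arr → ℋ.Arr
  smooth_obj : Smooth obj
  smooth_arr : Smooth arr
  src_arr : ∀ g, ℋ.src (arr g) = obj (𝒢.src g)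
  tgt_arr : ∀ g, ℋ.tgt (arr g) = obj (𝒢.tgt g)
  map_unit : ∀ x, arr (𝒢.unit x) = ℋ.unit (obj x)
  map_mul : ∀ g h e, arr (𝒢.mul g h e) =
    ℋ.mul (arr g) (arr h) (by rw [src_arr, tgt_arr, e])

/-- The identity functor. -/
def LieFunctor.id (𝒢 : LieGroupoid.{u}) : LieFunctor 𝒢 𝒢 where
  obj := fun x => x
  arr := fun g => g
  smooth_obj := contMDiff_id
  smooth_arr := contMDiff_id
  src_arr _ := rfl
  tgt_arr _ := rfl
  map_unit _ := rfl
  map_mul _ _ _ := rfl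

/-- The composition `ψ ∘ φ` of functors. -/
def LieFunctor.comp {𝒢 ℋ 𝒦 : LieGroupoid.{u}} (ψ : LieFunctor ℋ 𝒦) (φ : LieFunctor 𝒢 ℋ) :
    LieFunctor 𝒢 𝒦 where
  obj := fun x => ψ.obj (φ.obj x)
  arr := fun g => ψ.arr (φ.arr g)
  smooth_obj := ContMDiff.comp ψ.smooth_obj φ.smooth_obj
  smooth_arr := ContMDiff.comp ψ.smooth_arr φ.smooth_arr
  src_arr g := by rw [ψ.src_arr, φ.src_arr]
  tgt_arr g := by rw [ψ.tgt_arr, φ.tgt_arr]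
  map_unit x := by rw [φ.map_unit, ψ.map_unit]
  map_mul g h e := by simp only [φ.map_mul, ψ.map_mul]

/-- Weak equivalences of Lie groupoids: smooth essential surjectivity, where the map
`(x, h) ↦ s h` on the fibred product of `φ` and `t` is a surjective submersion, and smooth full
faithfulness, where `g ↦ ((s g, t g), φ g)` identifies the arrow space with the fibred product of
`φ × φ` and `(s, t)`. -/
structure LieFunctor.IsWeakEquivalence {𝒢 ℋ : LieGroupoid.{u}} (φ : LieFunctor 𝒢 ℋ) : Prop where
  essSurj : ∃ (F : Mfd.{u}) (p : F → 𝒢.Obj) (q : F → ℋ.Arr), IsFibredProduct φ.obj ℋ.tgt p q ∧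
    Function.Surjective (fun z => ℋ.src (q z)) ∧ Submersion (fun z => ℋ.src (q z))
  fullyFaithful : IsFibredProduct (M := 𝒢.Obj.prod 𝒢.Obj) (N := ℋ.Arr) (B := ℋ.Obj.prod ℋ.Obj)
    (P := 𝒢.Arr) (fun x => (φ.obj x.1, φ.obj x.2)) (fun h => (ℋ.src h, ℋ.tgt h))
    (fun g => (𝒢.src g, 𝒢.tgt g)) φ.arr

/-- Surjective submersive weak equivalences. -/
structure LieFunctor.IsSubmersiveWeakEquivalence {𝒢 ℋ : LieGroupoid.{u}} (φ : LieFunctor 𝒢 ℋ) :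
    Prop where
  weakEquivalence : φ.IsWeakEquivalence
  surjective : Function.Surjective φ.obj
  submersion : Submersion φ.obj

/-- `𝒬` with the functors `p` and `q` is the strict pullback of `φ` and `ψ`: its spaces of objects
and of arrows are the fibred products of the spaces of objects and of arrows. -/
structure IsStrictPullback {𝒢 ℋ 𝒦 𝒬 : LieGroupoid.{u}} (φ : LieFunctor 𝒢 𝒦) (ψ : LieFunctor ℋ 𝒦)
    (p : LieFunctor 𝒬 𝒢) (q : LieFunctor 𝒬 ℋ) : Prop where
  obj : IsFibredProduct φ.obj ψ.obj p.obj q.obj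
  arr : IsFibredProduct φ.arr ψ.arr p.arr q.arr

/-- Proper Lie groupoids. -/
def LieGroupoid.IsProper (𝒢 : LieGroupoid.{u}) : Prop :=
  IsProperMap (fun g => (𝒢.src g, 𝒢.tgt g))

/-- Étale Lie groupoids. -/
def LieGroupoid.IsEtale (𝒢 : LieGroupoid.{u}) : Prop :=
  IsLocalDiffeomorph 𝒢.Arr.I 𝒢.Obj.I ∞ 𝒢.src

/-- Morita equivalence of Lie groupoids. -/
def MoritaEquivalent (𝒢 ℋ : LieGroupoid.{u}) : Prop :=
  ∃ (𝒦 : LieGroupoid.{u}) (φ : LieFunctor 𝒦 𝒢) (ψ : LieFunctor 𝒦 ℋ),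
    φ.IsWeakEquivalence ∧ ψ.IsWeakEquivalence

/-- Orbifold groupoids: those Morita equivalent to a proper étale Lie groupoid. -/
def LieGroupoid.IsOrbifold (𝒢 : LieGroupoid.{u}) : Prop :=
  ∃ ℋ : LieGroupoid.{u}, ℋ.IsProper ∧ ℋ.IsEtale ∧ MoritaEquivalent 𝒢 ℋ

/-! ### Action groupoids -/

/-- A smooth action of a Lie group `G` on a manifold `X`. -/
structure LieAction : Type (u + 1) where
  G : Mfd.{u}
  X : Mfd.{u}
  [group : Group G]
  [lieGroup : LieGroup G.I ∞ G]
  [action : MulAction G X]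
  [smoothAction : ContMDiffSMul G.I X.I ∞ G X]

attribute [instance] LieAction.group LieAction.lieGroup LieAction.action LieAction.smoothAction

theorem submersion_snd (M N : Mfd.{u}) : Submersion (M := M.prod N) (N := N) Prod.snd := by
  refine Manifold.IsSubmersionOfComplement.isSubmersion (F := M.E) fun x => ?_
  refine Manifold.IsSubmersionAtOfComplement.mk_of_continuousAt (M := M × N) (I := M.I.prod N.I)
    continuousAt_snd
    (ContinuousLinearEquiv.prodComm ℝ M.E N.E) ((chartAt M.H x.1).prod (chartAt N.H x.2))
    (chartAt N.H x.2) ⟨mem_chart_source _ _, mem_chart_source _ _⟩ (mem_chart_source _ _)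
    (IsManifold.mem_maximalAtlas_prod (IsManifold.chart_mem_maximalAtlas _)
      (IsManifold.chart_mem_maximalAtlas _))
    (IsManifold.chart_mem_maximalAtlas _) ?_
  intro y hy
  have hy2 : N.I.symm y.2 ∈ (chartAt N.H x.2).target := by
    simp [OpenPartialHomeomorph.extend] at hy
    exact hy.2.2
  have h2 : y.2 ∈ Set.range N.I := by simp [N.I.range_eq_univ]
  have : N.I ((chartAt N.H x.2) ((chartAt N.H x.2).symm (N.I.symm y.2))) = y.2 := by
    rw [(chartAt N.H x.2).right_inv hy2, N.I.right_inv h2]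
  exact this

theorem LieAction.submersion_smul (A : LieAction.{u}) :
    Submersion (M := A.G.prod A.X) (N := A.X) (fun p => p.1 • p.2) := by
  obtain ⟨F, i1, i2, hF⟩ := submersion_snd A.G A.X
  refine ⟨F, i1, i2, fun p => ?_⟩
  let M : Mfd.{u} := A.G.prod A.X
  let e : M ≃ₜ M :=
    { toFun := fun p => (p.1, p.1 • p.2)
      invFun := fun p => (p.1, p.1⁻¹ • p.2)
      left_inv := fun p => Prod.ext rfl (inv_smul_smul _ _)
      right_inv := fun p => Prod.ext rfl (smul_inv_smul _ _)
      continuous_toFun := by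
        have : Smooth (M := M) (N := M) (fun p => (p.1, p.1 • p.2)) :=
          ContMDiff.prodMk contMDiff_fst contMDiff_smul
        exact this.continuous
      continuous_invFun := by
        have : Smooth (M := M) (N := M) (fun p => (p.1, p.1⁻¹ • p.2)) :=
          ContMDiff.prodMk contMDiff_fst (contMDiff_smul.comp
            (ContMDiff.prodMk ((contMDiff_inv A.G.I ∞).comp contMDiff_fst) contMDiff_snd))
        exact this.continuous }
  have he : ContMDiff M.I M.I ∞ e := ContMDiff.prodMk contMDiff_fst contMDiff_smul
  have he' : ContMDiff M.I M.I ∞ e.symm := ContMDiff.prodMk contMDiff_fst (contMDiff_smul.comp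
            (ContMDiff.prodMk ((contMDiff_inv A.G.I ∞).comp contMDiff_fst) contMDiff_snd))
  have h := hF (e p)
  refine Manifold.IsSubmersionAtOfComplement.mk_of_charts (M := M) (I := M.I) h.equiv
    (e.toOpenPartialHomeomorph.trans h.domChart) h.codChart ?_ ?_ ?_
    h.codChart_mem_maximalAtlas ?_ ?_
  · simpa using h.mem_domChart_source
  · exact h.mem_codChart_source
  · refine OpenPartialHomeomorph.mem_maximalAtlas_of_contMDiffOn _ ?_ ?_
    · exact (contMDiffOn_of_mem_maximalAtlas h.domChart_mem_maximalAtlas).comp he.contMDiffOn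
        (by intro x hx; simpa using hx)
    · exact he'.comp_contMDiffOn ((contMDiffOn_symm_of_mem_maximalAtlas
        h.domChart_mem_maximalAtlas).mono (by intro x hx; simpa using hx))
  · intro x hx
    exact h.source_subset_preimage_source (by simpa using hx : e x ∈ h.domChart.source)
  · intro y hy
    have hy' : y ∈ (h.domChart.extend M.I).target := by
      simpa [OpenPartialHomeomorph.extend] using hy
    have := h.writtenInCharts hy'
    rw [← this]
    change h.codChart.extend _ (e (e.symm ((h.domChart.extend _).symm y))).2 = _
    rw [e.apply_symm_apply]
    rfl

/-- The action groupoid of a smooth action. -/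
def LieAction.gpd (A : LieAction.{u}) : LieGroupoid.{u} where
  Obj := A.X
  Arr := A.G.prod A.X
  src := fun p => p.2
  tgt := fun p => p.1 • p.2
  unit := fun x => (1, x)
  inv := fun p => (p.1⁻¹, p.1 • p.2)
  mul := fun p q _ => (p.1 * q.1, q.2)
  src_unit _ := rfl
  tgt_unit _ := one_smul _ _
  src_inv _ := rfl
  tgt_inv _ := inv_smul_smul _ _
  src_mul _ _ _ := rfl
  tgt_mul p q e := by
    have e' : p.2 = q.1 • q.2 := e
    simp only [mul_smul, e']
  mul_unit p := Prod.ext (mul_one _) rfl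
  unit_mul p := Prod.ext (one_mul _) rfl
  mul_inv p := Prod.ext (mul_inv_cancel _) rfl
  inv_mul p := Prod.ext (inv_mul_cancel _) rfl
  mul_assoc p q r _ _ := Prod.ext (_root_.mul_assoc _ _ _) rfl
  smooth_src := contMDiff_snd
  smooth_tgt := contMDiff_smul
  submersion_src := submersion_snd _ _
  submersion_tgt := A.submersion_smul
  smooth_unit := ContMDiff.prodMk contMDiff_const contMDiff_id
  smooth_inv := ContMDiff.prodMk ((contMDiff_inv A.G.I ∞).comp contMDiff_fst) contMDiff_smul
  smooth_mul := fun Z a b ha hb _ => ContMDiff.prodMk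
    (ContMDiff.mul (contMDiff_fst.comp ha) (contMDiff_fst.comp hb)) (contMDiff_snd.comp hb)

/-- The properties of action groupoids that may be prescribed. -/
inductive ActionProperty
  | free
  | locallyFree
  | transitive
  | effective
  | compact
  | discrete
  | proper
  | orbifold

/-- The action `A`, or its action groupoid, has the given property. -/
def LieAction.Has (A : LieAction.{u}) : ActionProperty → Prop
  | .free => ∀ (g : A.G) (x : A.X), g • x = x → g = 1
  | .locallyFree => ∃ U ∈ 𝓝 (1 : A.G), ∀ g ∈ U, ∀ x : A.X, g • x = x → g = 1
  | .transitive => ∀ x y : A.X, ∃ g : A.G, g • x = y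
  | .effective => ∀ g : A.G, g ≠ 1 → ∃ x : A.X, g • x ≠ x
  | .compact => CompactSpace A.G
  | .discrete => DiscreteTopology A.G
  | .proper => A.gpd.IsProper
  | .orbifold => A.gpd.IsOrbifold

/-- Action groupoids with all properties in `P`, given through the action. -/
structure ActGpd (P : Set ActionProperty) : Type (u + 1) where
  action : LieAction.{u}
  has : ∀ p ∈ P, action.Has p

variable {P : Set ActionProperty}

/-- The underlying Lie groupoid. -/
abbrev ActGpd.gpd (A : ActGpd.{u} P) : LieGroupoid.{u} := A.action.gpd

/-- A functor between action groupoids is equivariant if it is given by a Lie group homomorphism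
and a smooth map. -/
def IsEquivariant {A B : LieAction.{u}} (φ : LieFunctor A.gpd B.gpd) : Prop :=
  ∃ (θ : A.G →* B.G) (φ₀ : A.X → B.X), Smooth (M := A.G) (N := B.G) θ ∧ Smooth φ₀ ∧
    ∀ (g : A.G) (x : A.X), φ.arr ((g, x) : A.G × A.X) = ((θ g, φ₀ x) : B.G × B.X)

/-! ### Anafunctors -/

/-- A `P`-anafunctor from `A` to `B`: a span of equivariant functors between action groupoids
with the properties `P`, whose left leg is a surjective submersive weak equivalence. -/
structure PAnafunctor (A B : ActGpd.{u} P) : Type (u + 1) where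
  apex : ActGpd.{u} P
  left : LieFunctor apex.gpd A.gpd
  right : LieFunctor apex.gpd B.gpd
  left_equivariant : IsEquivariant left
  right_equivariant : IsEquivariant right
  left_weakEquivalence : left.IsSubmersiveWeakEquivalence

theorem LieFunctor.id_isSubmersiveWeakEquivalence (𝒢 : LieGroupoid.{u}) :
    (LieFunctor.id 𝒢).IsSubmersiveWeakEquivalence where
  weakEquivalence :=
    { essSurj := by
        refine ⟨𝒢.Arr, 𝒢.tgt, fun g => g, ⟨𝒢.smooth_tgt, contMDiff_id, fun _ => rfl, ?_, ?_⟩,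
          fun x => ⟨𝒢.unit x, 𝒢.src_unit x⟩, 𝒢.submersion_src⟩
        · rintro m n h
          exact ⟨n, ⟨h.symm, rfl⟩, fun z hz => hz.2⟩
        · exact fun _ _ _ h => h
      fullyFaithful := by
        refine ⟨ContMDiff.prodMk 𝒢.smooth_src 𝒢.smooth_tgt, contMDiff_id, fun _ => rfl, ?_, ?_⟩
        · rintro m n h
          exact ⟨n, ⟨h.symm, rfl⟩, fun z hz => hz.2⟩
        · exact fun _ _ _ h => h }
  surjective x := ⟨x, rfl⟩
  submersion := Manifold.IsSubmersion.id

/-- The identity anafunctor. -/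
def PAnafunctor.id (A : ActGpd.{u} P) : PAnafunctor A A where
  apex := A
  left := LieFunctor.id A.gpd
  right := LieFunctor.id A.gpd
  left_equivariant := ⟨MonoidHom.id _, fun x => x, contMDiff_id, contMDiff_id, fun _ _ => rfl⟩
  right_equivariant := ⟨MonoidHom.id _, fun x => x, contMDiff_id, contMDiff_id, fun _ _ => rfl⟩
  left_weakEquivalence := LieFunctor.id_isSubmersiveWeakEquivalence _

/-- `R` is the composite of the anafunctors `S` and `T`, formed by strict pullback: the apex of
`R` is the strict pullback of the right leg of `S` and the left leg of `T`, and the legs of `R` are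
the outer legs precomposed with the two equivariant projections. -/
structure IsComposite {A B C : ActGpd.{u} P} (S : PAnafunctor A B) (T : PAnafunctor B C)
    (R : PAnafunctor A C) (fst : LieFunctor R.apex.gpd S.apex.gpd)
    (snd : LieFunctor R.apex.gpd T.apex.gpd) : Prop where
  fst_equivariant : IsEquivariant fst
  snd_equivariant : IsEquivariant snd
  isStrictPullback : IsStrictPullback S.right T.left fst snd
  left_eq : R.left = S.left.comp fst
  right_eq : R.right = T.right.comp snd

/-- A `2`-cell from `S` to `T`: a smooth natural transformation from `S.right ∘ pr₁` to
`T.right ∘ pr₂`, both functors being defined on the fibred product of the left legs. -/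
@[ext]
structure TwoCell {A B : ActGpd.{u} P} (S T : PAnafunctor A B) : Type u where
  app : ∀ (y : S.apex.gpd.Obj) (z : T.apex.gpd.Obj), S.left.obj y = T.left.obj z → B.gpd.Arr
  src_app : ∀ y z h, B.gpd.src (app y z h) = S.right.obj y
  tgt_app : ∀ y z h, B.gpd.tgt (app y z h) = T.right.obj z
  naturality : ∀ (k : S.apex.gpd.Arr) (l : T.apex.gpd.Arr) (h : S.left.arr k = T.left.arr l),
    B.gpd.mul (T.right.arr l)
        (app (S.apex.gpd.src k) (T.apex.gpd.src l) (by rw [← S.left.src_arr, ← T.left.src_arr, h]))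
        (by rw [tgt_app, T.right.src_arr]) =
      B.gpd.mul
        (app (S.apex.gpd.tgt k) (T.apex.gpd.tgt l) (by rw [← S.left.tgt_arr, ← T.left.tgt_arr, h]))
        (S.right.arr k) (by rw [src_app, S.right.tgt_arr])
  smooth : SmoothOnFibredProduct S.left.obj T.left.obj app

/-- `k : y → y'` is an arrow of the apex that the left leg sends to an identity arrow. Since the left
leg is fully faithful, there is exactly one such arrow when `y` and `y'` have the same image. -/
structure PAnafunctor.IsVertical {A B : ActGpd.{u} P} (S : PAnafunctor A B) (k : S.apex.gpd.Arr)
    (y y' : S.apex.gpd.Obj) : Prop where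
  src_eq : S.apex.gpd.src k = y
  tgt_eq : S.apex.gpd.tgt k = y'
  left_eq : S.left.arr k = A.gpd.unit (S.left.obj y)

/-- Data exhibiting a bicategory `ℬ` on the action groupoids with properties `P` as that of anafunctors:
its `1`-cells are the `P`-anafunctors, its `2`-cells the natural transformations on fibred products
of left legs, and all its operations are those of anafunctors. -/
structure AnaBicategoryStructure (ℬ : Bicategory.{u, u + 1} (ActGpd.{u} P)) where
  /-- The `1`-cells are the `P`-anafunctors. -/
  one {A B : ActGpd.{u} P} : (A ⟶ B) ≃ PAnafunctor A B
  /-- The `2`-cells are the natural transformations on the fibred products of the left legs. -/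
  two {A B : ActGpd.{u} P} {f g : A ⟶ B} : (f ⟶ g) ≃ TwoCell (one f) (one g)
  /-- The first projection of a composite `1`-cell. -/
  fst {A B C : ActGpd.{u} P} (f : A ⟶ B) (g : B ⟶ C) :
    LieFunctor (one (f ≫ g)).apex.gpd (one f).apex.gpd
  /-- The second projection of a composite `1`-cell. -/
  snd {A B C : ActGpd.{u} P} (f : A ⟶ B) (g : B ⟶ C) :
    LieFunctor (one (f ≫ g)).apex.gpd (one g).apex.gpd
  /-- Identity `1`-cells are identity anafunctors. -/
  one_id (A : ActGpd.{u} P) : one (𝟙 A) = PAnafunctor.id A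
  /-- `1`-cells are composed by strict pullback. -/
  one_comp {A B C : ActGpd.{u} P} (f : A ⟶ B) (g : B ⟶ C) :
    IsComposite (one f) (one g) (one (f ≫ g)) (fst f g) (snd f g)
  /-- The identity `2`-cell sends `(y, y')` to the image under the right leg of the arrow `y → y'`
  lying over an identity. -/
  two_id {A B : ActGpd.{u} P} (f : A ⟶ B) (y y' : (one f).apex.gpd.Obj)
    (e : (one f).left.obj y = (one f).left.obj y') (k : (one f).apex.gpd.Arr)
    (hk : (one f).IsVertical k y y') :
    (two (𝟙 f)).app y y' e = (one f).right.arr k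
  /-- Vertical composition: `(θ * η) (y, y'') = θ (y', y'') η (y, y')`. -/
  two_comp {A B : ActGpd.{u} P} {f g h : A ⟶ B} (η : f ⟶ g) (θ : g ⟶ h)
    (y : (one f).apex.gpd.Obj) (y' : (one g).apex.gpd.Obj) (y'' : (one h).apex.gpd.Obj)
    (e : (one f).left.obj y = (one g).left.obj y')
    (e' : (one g).left.obj y' = (one h).left.obj y'') :
    (two (η ≫ θ)).app y y'' (e.trans e') =
      B.gpd.mul ((two θ).app y' y'' e') ((two η).app y y' e)
        (by rw [TwoCell.src_app, TwoCell.tgt_app])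
  /-- Whiskering of `η : f ⟶ g` with `h`: the arrow `η (y, y')` is lifted to the apex of `h` along
  the left leg and sent on by the right leg. -/
  two_whiskerRight {A B C : ActGpd.{u} P} {f g : A ⟶ B} (η : f ⟶ g) (h : B ⟶ C)
    (q : (one (f ≫ h)).apex.gpd.Obj) (q' : (one (g ≫ h)).apex.gpd.Obj)
    (e : (one (f ≫ h)).left.obj q = (one (g ≫ h)).left.obj q')
    (e' : (one f).left.obj ((fst f h).obj q) = (one g).left.obj ((fst g h).obj q'))
    (l : (one h).apex.gpd.Arr) (hl : (one h).apex.gpd.src l = (snd f h).obj q)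
    (hl' : (one h).apex.gpd.tgt l = (snd g h).obj q')
    (hη : (one h).left.arr l = (two η).app ((fst f h).obj q) ((fst g h).obj q') e') :
    (two (ℬ.whiskerRight η h)).app q q' e = (one h).right.arr l
  /-- Whiskering of `θ : g ⟶ h` with `f`, that is, horizontal composition of the identity `2`-cell
  of `f` with `θ`. -/
  two_whiskerLeft {A B C : ActGpd.{u} P} (f : A ⟶ B) {g h : B ⟶ C} (θ : g ⟶ h)
    (q : (one (f ≫ g)).apex.gpd.Obj) (q' : (one (f ≫ h)).apex.gpd.Obj)
    (e : (one (f ≫ g)).left.obj q = (one (f ≫ h)).left.obj q')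
    (k : (one f).apex.gpd.Arr)
    (hk : (one f).IsVertical k ((fst f g).obj q) ((fst f h).obj q'))
    (l : (one g).apex.gpd.Arr) (hl : (one g).apex.gpd.src l = (snd f g).obj q)
    (hkl : (one g).left.arr l = (one f).right.arr k)
    (e' : (one g).left.obj ((one g).apex.gpd.tgt l) = (one h).left.obj ((snd f h).obj q')) :
    (two (ℬ.whiskerLeft f θ)).app q q' e =
      C.gpd.mul ((two θ).app ((one g).apex.gpd.tgt l) ((snd f h).obj q') e')
        ((one g).right.arr l) (by rw [TwoCell.src_app, LieFunctor.tgt_arr])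
  /-- The associator is induced by the canonical isomorphism of iterated strict pullbacks. -/
  two_associator {A B C D : ActGpd.{u} P} (f : A ⟶ B) (g : B ⟶ C) (h : C ⟶ D)
    (q : (one ((f ≫ g) ≫ h)).apex.gpd.Obj) (q' : (one (f ≫ g ≫ h)).apex.gpd.Obj)
    (e : (one ((f ≫ g) ≫ h)).left.obj q = (one (f ≫ g ≫ h)).left.obj q')
    (k : (one f).apex.gpd.Arr) (l : (one g).apex.gpd.Arr) (m : (one h).apex.gpd.Arr)
    (hk : (one f).IsVertical k ((fst f g).obj ((fst (f ≫ g) h).obj q)) ((fst f (g ≫ h)).obj q'))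
    (hl : (one g).apex.gpd.src l = (snd f g).obj ((fst (f ≫ g) h).obj q))
    (hl' : (one g).apex.gpd.tgt l = (fst g h).obj ((snd f (g ≫ h)).obj q'))
    (hm : (one h).apex.gpd.src m = (snd (f ≫ g) h).obj q)
    (hm' : (one h).apex.gpd.tgt m = (snd g h).obj ((snd f (g ≫ h)).obj q'))
    (hkl : (one g).left.arr l = (one f).right.arr k)
    (hlm : (one h).left.arr m = (one g).right.arr l) :
    (two (ℬ.associator f g h).hom).app q q' e = (one h).right.arr m
  /-- The left unitor is induced by the projection of the strict pullback. -/
  two_leftUnitor {A B : ActGpd.{u} P} (f : A ⟶ B)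
    (q : (one (𝟙 A ≫ f)).apex.gpd.Obj) (y : (one f).apex.gpd.Obj)
    (e : (one (𝟙 A ≫ f)).left.obj q = (one f).left.obj y) (k : (one f).apex.gpd.Arr)
    (hk : (one f).IsVertical k ((snd (𝟙 A) f).obj q) y) :
    (two (ℬ.leftUnitor f).hom).app q y e = (one f).right.arr k
  /-- The right unitor is induced by the projection of the strict pullback. -/
  two_rightUnitor {A B : ActGpd.{u} P} (f : A ⟶ B)
    (q : (one (f ≫ 𝟙 B)).apex.gpd.Obj) (y : (one f).apex.gpd.Obj)
    (e : (one (f ≫ 𝟙 B)).left.obj q = (one f).left.obj y) (k : (one f).apex.gpd.Arr)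
    (hk : (one f).IsVertical k ((fst f (𝟙 B)).obj q) y) :
    (two (ℬ.rightUnitor f).hom).app q y e = (one f).right.arr k

end AnaGpd

end

/-! The heart of the matter is that the strict pullbacks exist and stay within the class of action
groupoids cut out by `P`. After that, every law is a computation with group elements.

Composition. A surjective submersive weak equivalence `χ` is a submersion on objects, hence also on
arrows, because full faithfulness makes `χ.arr` a base change of `χ.obj × χ.obj`. If `χ` is
equivariant and its domain has a point, its homomorphism of groups is then a submersion as well
(`IsEquivariant.submersion_hom`). So the fibred products of groups and of spaces are manifolds, and
the strict pullback is the action groupoid of `pullbackAction`. Its first projection is again a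
surjective submersive weak equivalence (`IsStrictPullback.fst_isSubmersiveWeakEquivalence`), and it
inherits every listed property (`pullbackAction.has`); the orbifold property is a matter of Morita
invariance (`LieFunctor.IsSubmersiveWeakEquivalence.isOrbifold`). An empty apex is treated apart,
with the trivial group acting on the empty space. `PAnafunctor.exists_isComposite` collects all
this; composites are picked from it by choice, and only their universal property is used afterwards.

The differential topology rests on one criterion: a smooth map is a submersion exactly when it has a
smooth local section through every point (`submersion_iff`). In this form composition, base change
and descent of smoothness are formal.

Cells. Between action groupoids a `2`-cell amounts to a group-valued function `TwoCell.val`. Two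
points of an apex with the same image under the left leg are joined by a unique group element over
`1`, and naturality tells how `val` changes along it. Hence composites do not depend on auxiliary
choices (`TwoCell.val_mul_val`, `TwoCell.val_mul_rG`); they are smooth, because the choices can be
made smoothly on a submersive cover (`exists_cover`); and a `2`-cell is determined by one value over
each point of the first apex (`TwoCell.ext_exists`). Identities, associators and unitors come from
maps of apices and take the value `1` on the graphs of these maps (`TwoCell.induced_val_eq_one`), so
the coherence laws reduce to evaluation at well-chosen points. The exchange law is naturality of the
second `2`-cell. -/

noncomputable section

namespace AnaGpd

variable {P : Set ActionProperty}

/-! ### Submersions and local sections -/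

/-- Through every point there is a smooth local section. -/
def HasLocalSections {M N : Mfd.{u}} (f : M → N) : Prop :=
  ∀ x, ∃ (U : Set N) (σ : N → M), IsOpen U ∧ f x ∈ U ∧ ContMDiffOn N.I M.I ∞ σ U ∧
    σ (f x) = x ∧ ∀ y ∈ U, f (σ y) = y

/-- A submersion is locally the projection from a product with a fixed vector space. -/
theorem Submersion.exists_trivialization {N B : Mfd.{u}} {g : N → B} (hg : Submersion g) :
    ∃ (F : Type) (_ : NormedAddCommGroup F) (_ : NormedSpace ℝ F) (_ : FiniteDimensional ℝ F),
      ∀ n₀ : N, ∃ (O : Set N) (W : Set (B × F)) (τ : N → F) (σ : B × F → N),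
        IsOpen O ∧ n₀ ∈ O ∧ IsOpen W ∧ ContMDiffOn N.I 𝓘(ℝ, F) ∞ τ O ∧
        ContMDiffOn (B.I.prod 𝓘(ℝ, F)) N.I ∞ σ W ∧
        (∀ n ∈ O, (g n, τ n) ∈ W ∧ σ (g n, τ n) = n) ∧
        ∀ w ∈ W, σ w ∈ O ∧ g (σ w) = w.1 ∧ τ (σ w) = w.2 := by
  -- One complement `F` serves all points. Its finite dimension is read off from the linear
  -- equivalence at a single point, so an empty `N` is set aside.
  rcases isEmpty_or_nonempty N with hN | ⟨⟨n₁⟩⟩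
  · exact ⟨PUnit, inferInstance, inferInstance, inferInstance, fun n => hN.elim n⟩
  obtain ⟨F, i1, i2, hF⟩ := hg
  have hfin : FiniteDimensional ℝ F := by
    have e := (hF n₁).equiv
    exact FiniteDimensional.of_surjective
      ((LinearMap.snd ℝ B.E F).comp (e : N.E →ₗ[ℝ] B.E × F))
      (Prod.snd_surjective.comp e.surjective)
  refine ⟨F, i1, i2, hfin, fun n₀ => ?_⟩
  have h := hF n₀
  set φ := h.domChart.extend N.I with hφ
  set ψ := h.codChart.extend B.I with hψ
  have hsrc : φ.source = h.domChart.source := OpenPartialHomeomorph.extend_source ..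
  have hsrc' : ψ.source = h.codChart.source := OpenPartialHomeomorph.extend_source ..
  have hφs : ContMDiffOn N.I 𝓘(ℝ, N.E) ∞ φ h.domChart.source :=
    h.domChart.contMDiffOn_extend h.domChart_mem_maximalAtlas
  have hψs : ContMDiffOn B.I 𝓘(ℝ, B.E) ∞ ψ h.codChart.source :=
    h.codChart.contMDiffOn_extend h.codChart_mem_maximalAtlas
  have htgt : φ.target = N.I '' h.domChart.target := by
    rw [hφ, OpenPartialHomeomorph.extend_target, N.I.image_eq]
  have hφsymm : ContMDiffOn 𝓘(ℝ, N.E) N.I ∞ φ.symm φ.target := by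
    rw [htgt]
    exact contMDiffOn_extend_symm h.domChart_mem_maximalAtlas
  have hopen : IsOpen φ.target := h.domChart.isOpen_extend_target
  -- In the charts `g` is the first projection of `B.E × F`, so `γ` is the coordinate expression of
  -- the inverse of `n ↦ (g n, τ n)`.
  let γ : B × F → N.E := fun w => h.equiv.symm (ψ w.1, w.2)
  let W₀ : Set (B × F) := h.codChart.source ×ˢ Set.univ
  have hW₀ : IsOpen W₀ := h.codChart.open_source.prod isOpen_univ
  have hγ : ContMDiffOn (B.I.prod 𝓘(ℝ, F)) 𝓘(ℝ, N.E) ∞ γ W₀ := by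
    refine h.equiv.symm.contDiff.contMDiff.comp_contMDiffOn ?_
    exact (hψs.comp contMDiffOn_fst (fun w hw => hw.1)).prodMk_space contMDiffOn_snd
  refine ⟨h.domChart.source, W₀ ∩ γ ⁻¹' φ.target, fun n => (h.equiv (φ n)).2,
    fun w => φ.symm (γ w), h.domChart.open_source, h.mem_domChart_source,
    hγ.continuousOn.isOpen_inter_preimage hW₀ hopen, ?_, ?_, ?_, ?_⟩
  · exact (contDiff_snd.comp h.equiv.contDiff).contMDiff.comp_contMDiffOn hφs
  · exact hφsymm.comp (hγ.mono Set.inter_subset_left) (fun w hw => hw.2)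
  · intro n hn
    have h1 : φ n ∈ φ.target := φ.map_source (hsrc ▸ hn)
    have h2 := h.writtenInCharts h1
    have h3 : φ.symm (φ n) = n := φ.left_inv (hsrc ▸ hn)
    have h4 : γ (g n, (h.equiv (φ n)).2) = φ n := by
      simp only [Function.comp_apply, ← hφ, h3, ← hψ] at h2
      simp only [γ, h2, Prod.mk.eta, ContinuousLinearEquiv.symm_apply_apply]
    refine ⟨⟨⟨h.source_subset_preimage_source hn, trivial⟩, ?_⟩, ?_⟩
    · rw [Set.mem_preimage, h4]; exact h1
    · change φ.symm (γ _) = n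
      rw [h4, h3]
  · rintro w ⟨hw, hw'⟩
    have h1 : φ.symm (γ w) ∈ h.domChart.source := hsrc ▸ φ.map_target hw'
    have h2 := h.writtenInCharts hw'
    refine ⟨h1, ?_, ?_⟩
    · refine ψ.injOn (hsrc' ▸ h.source_subset_preimage_source h1) (hsrc' ▸ hw.1) ?_
      refine h2.trans ?_
      simp only [γ, Function.comp_apply, ContinuousLinearEquiv.apply_symm_apply]
    · simp only [φ.right_inv hw', γ, ContinuousLinearEquiv.apply_symm_apply]

theorem Submersion.smooth {M N : Mfd.{u}} {f : M → N} (hf : Submersion f) : Smooth f :=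
  Manifold.IsSubmersion.contMDiff hf

/-- Freeze the fibre coordinate of a local trivialization at its value at `x`. -/
theorem Submersion.hasLocalSections {M N : Mfd.{u}} {f : M → N} (hf : Submersion f) :
    HasLocalSections f := by
  obtain ⟨F, _, _, _, hF⟩ := hf.exists_trivialization
  intro x
  obtain ⟨O, W, τ, σ, -, hx, hW, -, hσ, h1, h2⟩ := hF x
  have hc : Continuous fun y : N => (y, τ x) := by fun_prop
  refine ⟨(fun y => (y, τ x)) ⁻¹' W, fun y => σ (y, τ x), hW.preimage hc, (h1 x hx).1, ?_,
    (h1 x hx).2, fun y hy => (h2 _ hy).2.1⟩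
  exact hσ.comp (contMDiff_id.prodMk contMDiff_const).contMDiffOn fun y hy => hy

/-- The inverse function theorem, with a smooth inverse on an open set. -/
theorem exists_openPartialHomeomorph_of_hasFDerivAt {E E' : Type*} [NormedAddCommGroup E]
    [NormedSpace ℝ E] [CompleteSpace E] [NormedAddCommGroup E'] [NormedSpace ℝ E'] {Φ : E → E'}
    {D : Set E} (hD : IsOpen D) {x : E} (hx : x ∈ D) (hΦ : ContDiffOn ℝ ∞ Φ D) (L : E ≃L[ℝ] E')
    (hL : HasFDerivAt Φ (L : E →L[ℝ] E') x) :
    ∃ T : OpenPartialHomeomorph E E', x ∈ T.source ∧ T.source ⊆ D ∧ (∀ e, T e = Φ e) ∧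
      ContDiffOn ℝ ∞ T.symm T.target := by
  have hat : ∀ e ∈ D, ContDiffAt ℝ ∞ Φ e := fun e he => hΦ.contDiffAt (hD.mem_nhds he)
  let T₀ := (hat x hx).toOpenPartialHomeomorph Φ hL (by simp)
  have hcont : ContinuousOn (fderiv ℝ Φ) D :=
    hΦ.continuousOn_fderiv_of_isOpen hD (by simp)
  -- The inverse is known to be smooth where the derivative of `Φ` is invertible; this is an open
  -- condition, so `T₀` is restricted to it.
  let D' := D ∩ fderiv ℝ Φ ⁻¹' (Set.range ((↑) : (E ≃L[ℝ] E') → E →L[ℝ] E'))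
  have hD' : IsOpen D' := hcont.isOpen_inter_preimage hD ContinuousLinearEquiv.isOpen
  refine ⟨T₀.restrOpen D' hD', ⟨(hat x hx).mem_toOpenPartialHomeomorph_source hL (by simp), hx,
    ⟨L, hL.fderiv.symm⟩⟩, fun e he => he.2.1, fun e => rfl, ?_⟩
  intro y hy
  have hy' := (T₀.restrOpen D' hD').map_target hy
  obtain ⟨L', hL'⟩ := hy'.2.2
  refine ContDiffAt.contDiffWithinAt ?_
  refine OpenPartialHomeomorph.contDiffAt_symm _ hy (f₀' := L') ?_ (hat _ hy'.2.1)
  rw [hL']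
  exact ((hat _ hy'.2.1).differentiableAt (by simp)).hasFDerivAt

/-- A linear map with a right inverse is a projection in suitable coordinates. -/
theorem exists_equiv_prod_of_rightInverse {E E' : Type*} [NormedAddCommGroup E]
    [NormedSpace ℝ E] [FiniteDimensional ℝ E] [NormedAddCommGroup E'] [NormedSpace ℝ E']
    [FiniteDimensional ℝ E'] (D : E →L[ℝ] E') (s : E' →L[ℝ] E) (hs : ∀ v, D (s v) = v) :
    ∃ L : E ≃L[ℝ] E' × (Fin (Module.finrank ℝ E - Module.finrank ℝ E') → ℝ),
      ∀ e, (L e).1 = D e := by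
  have hsurj : Function.Surjective D := fun v => ⟨s v, hs v⟩
  have hdim := (D : E →ₗ[ℝ] E').finrank_range_add_finrank_ker
  rw [LinearMap.range_eq_top.2 hsurj, finrank_top] at hdim
  have hk : Module.finrank ℝ (LinearMap.ker (D : E →ₗ[ℝ] E')) =
      Module.finrank ℝ (Fin (Module.finrank ℝ E - Module.finrank ℝ E') → ℝ) := by
    rw [Module.finrank_fin_fun]; omega
  let κ := LinearEquiv.ofFinrankEq _ _ hk
  -- `e ↦ e - s (D e)` projects onto the kernel of `D` along the range of `s`; the equivalence
  -- sought is `e ↦ (D e, κ (pr e))`.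
  let pr : E →ₗ[ℝ] LinearMap.ker (D : E →ₗ[ℝ] E') :=
    LinearMap.codRestrict _ (LinearMap.id - (s : E' →ₗ[ℝ] E).comp (D : E →ₗ[ℝ] E'))
      (fun e => by simp [hs])
  let L : E ≃ₗ[ℝ] E' × (Fin (Module.finrank ℝ E - Module.finrank ℝ E') → ℝ) :=
    LinearEquiv.ofLinearMap ((D : E →ₗ[ℝ] E').prod (κ.toLinearMap.comp pr))
      (((s : E' →ₗ[ℝ] E).comp (LinearMap.fst ℝ _ _)) +
        ((Submodule.subtype _).comp (κ.symm.toLinearMap.comp (LinearMap.snd ℝ _ _))))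
      (by
        refine LinearMap.ext fun p => Prod.ext ?_ ?_
        · have : D (κ.symm p.2 : E) = 0 := (κ.symm p.2).2
          simp [hs, this]
        · have h0 : D (κ.symm p.2 : E) = 0 := (κ.symm p.2).2
          have : pr (s p.1 + (κ.symm p.2 : E)) = κ.symm p.2 := by
            apply Subtype.ext
            simp [pr, hs, h0]
          change κ (pr (s p.1 + (κ.symm p.2 : E))) = p.2
          rw [this, LinearEquiv.apply_symm_apply])
      (by
        refine LinearMap.ext fun e => ?_
        change s (D e) + ((κ.symm (κ (pr e)) : LinearMap.ker (D : E →ₗ[ℝ] E')) : E) = e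
        rw [LinearEquiv.symm_apply_apply]
        simp [pr])
  exact ⟨L.toContinuousLinearEquiv, fun e => rfl⟩

/-- Differentiating `f ∘ σ = id` in charts gives a right inverse of the derivative of `f`, and the
inverse function theorem straightens `f` to a linear projection. A submersion needs one complement
valid at all points, which is why it is `ℝ ^ (dim M - dim N)` and not the kernel of the derivative.
-/
theorem Smooth.submersion_of_hasLocalSections {M N : Mfd.{u}} {f : M → N} (hf : Smooth f)
    (hs : HasLocalSections f) : Submersion f := by
  refine ⟨Fin (Module.finrank ℝ M.E - Module.finrank ℝ N.E) → ℝ, inferInstance, inferInstance,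
    fun x => ?_⟩
  obtain ⟨U, σ, hU, hxU, hσ, hσx, hσf⟩ := hs x
  set φ := extChartAt M.I x with hφ
  set ψ := extChartAt N.I (f x) with hψ
  have hφs : ContMDiffOn M.I 𝓘(ℝ, M.E) ∞ φ φ.source := by
    rw [hφ, extChartAt_source]; exact contMDiffOn_extChartAt
  have hψs : ContMDiffOn N.I 𝓘(ℝ, N.E) ∞ ψ ψ.source := by
    rw [hψ, extChartAt_source]; exact contMDiffOn_extChartAt
  have hφsymm : ContMDiffOn 𝓘(ℝ, M.E) M.I ∞ φ.symm φ.target := contMDiffOn_extChartAt_symm x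
  have hψsymm : ContMDiffOn 𝓘(ℝ, N.E) N.I ∞ ψ.symm ψ.target := contMDiffOn_extChartAt_symm (f x)
  have hφt : IsOpen φ.target := isOpen_extChartAt_target x
  have hψt : IsOpen ψ.target := isOpen_extChartAt_target (f x)
  have hφo : IsOpen φ.source := isOpen_extChartAt_source x
  have hψo : IsOpen ψ.source := isOpen_extChartAt_source (f x)
  have hxφ : x ∈ φ.source := mem_extChartAt_source x
  have hxψ : f x ∈ ψ.source := mem_extChartAt_source (f x)
  let D : Set M.E := φ.target ∩ φ.symm ⁻¹' (f ⁻¹' ψ.source)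
  have hD : IsOpen D := hφsymm.continuousOn.isOpen_inter_preimage hφt (hψo.preimage hf.continuous)
  have hxD : φ x ∈ D := ⟨φ.map_source hxφ, by
    rw [Set.mem_preimage, φ.left_inv hxφ]; exact hxψ⟩
  have hfh : ContDiffOn ℝ ∞ (fun e => ψ (f (φ.symm e))) D := by
    rw [← contMDiffOn_iff_contDiffOn]
    exact hψs.comp (hf.comp_contMDiffOn (hφsymm.mono Set.inter_subset_left)) fun e he => he.2
  let D₂ : Set N.E := ψ.target ∩ ψ.symm ⁻¹' (U ∩ σ ⁻¹' φ.source)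
  have hU₂ : IsOpen (U ∩ σ ⁻¹' φ.source) := hσ.continuousOn.isOpen_inter_preimage hU hφo
  have hD₂ : IsOpen D₂ := hψsymm.continuousOn.isOpen_inter_preimage hψt hU₂
  have hxD₂ : ψ (f x) ∈ D₂ := by
    refine ⟨ψ.map_source hxψ, ?_⟩
    rw [Set.mem_preimage, ψ.left_inv hxψ]
    exact ⟨hxU, by rw [Set.mem_preimage, hσx]; exact hxφ⟩
  have hsh : ContDiffOn ℝ ∞ (fun v => φ (σ (ψ.symm v))) D₂ := by
    rw [← contMDiffOn_iff_contDiffOn]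
    refine hφs.comp (hσ.comp (hψsymm.mono Set.inter_subset_left) fun v hv => hv.2.1)
      fun v hv => hv.2.2
  have hshx : φ (σ (ψ.symm (ψ (f x)))) = φ x := by rw [ψ.left_inv hxψ, hσx]
  have hdf : HasFDerivAt (fun e => ψ (f (φ.symm e))) _ (φ x) :=
    ((hfh.contDiffAt (hD.mem_nhds hxD)).differentiableAt (by simp)).hasFDerivAt
  have hds : HasFDerivAt (fun v => φ (σ (ψ.symm v))) _ (ψ (f x)) :=
    ((hsh.contDiffAt (hD₂.mem_nhds hxD₂)).differentiableAt (by simp)).hasFDerivAt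
  have hcomp := HasFDerivAt.comp (ψ (f x)) (g := fun e => ψ (f (φ.symm e)))
    (f := fun v => φ (σ (ψ.symm v))) (by rw [hshx]; exact hdf) hds
  have hid : HasFDerivAt (fun v : N.E => v) (ContinuousLinearMap.id ℝ N.E) (ψ (f x)) :=
    hasFDerivAt_id _
  have heq : (fun v => v) =ᶠ[𝓝 (ψ (f x))]
      ((fun e => ψ (f (φ.symm e))) ∘ fun v => φ (σ (ψ.symm v))) := by
    filter_upwards [hD₂.mem_nhds hxD₂] with v hv
    simp only [Function.comp_apply]
    rw [φ.left_inv hv.2.2, hσf _ hv.2.1, ψ.right_inv hv.1]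
  have hcomp' := hid.unique (hcomp.congr_of_eventuallyEq heq)
  obtain ⟨L, hL⟩ := exists_equiv_prod_of_rightInverse _ _ fun v =>
    (DFunLike.congr_fun hcomp' v).symm
  -- `f` in coordinates, completed by the linear coordinates of `L` on the kernel; the derivative at
  -- `φ x` is `L` itself.
  let Φ : M.E → N.E × (Fin (Module.finrank ℝ M.E - Module.finrank ℝ N.E) → ℝ) :=
    fun e => (ψ (f (φ.symm e)), (L e).2)
  have hΦ : ContDiffOn ℝ ∞ Φ D := hfh.prodMk (contDiff_snd.comp L.contDiff).contDiffOn
  have hΦL : HasFDerivAt Φ (L : M.E →L[ℝ] _) (φ x) := by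
    convert! hdf.prodMk ((ContinuousLinearMap.snd ℝ _ _).comp
      L.toContinuousLinearMap).hasFDerivAt using 1
    ext e
    · exact congrFun rfl _ |>.trans (hL e)
    · rfl
  obtain ⟨T, hxT, hTD, hT, hTs⟩ :=
    exists_openPartialHomeomorph_of_hasFDerivAt hD hxD hΦ L hΦL
  let c := chartAt M.H x
  let J := M.I.toHomeomorph
  have hJ : ∀ a, J a = M.I a := fun a => rfl
  have hJs : ∀ a, J.symm a = M.I.symm a := fun a => rfl
  -- `T` straightens `f` but takes values in a product; `L.symm` brings these back to the model of
  -- `M`. Without boundary the model map `M.I` is a homeomorphism.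
  let e : OpenPartialHomeomorph M M.H :=
    ((c.trans J.toOpenPartialHomeomorph).trans T).trans
      (L.symm.toHomeomorph.trans J.symm).toOpenPartialHomeomorph
  have he : ∀ y, e y = M.I.symm (L.symm (T (φ y))) := fun y => rfl
  have hes : ∀ y, e.symm y = φ.symm (T.symm (L (M.I y))) := fun y => rfl
  have hmem : ∀ y, y ∈ e.source ↔ y ∈ c.source ∧ φ y ∈ T.source := by
    intro y
    simp only [e, OpenPartialHomeomorph.trans_source, Homeomorph.toOpenPartialHomeomorph_source,
      Set.preimage_univ, Set.inter_univ]
    rfl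
  have hmemt : ∀ y, y ∈ e.target ↔ L (M.I y) ∈ T.target ∧ T.symm (L (M.I y)) ∈ φ.target := by
    intro y
    have : φ.target = M.I.symm ⁻¹' c.target := by
      rw [hφ, extChartAt_target, M.I.range_eq_univ, Set.inter_univ]
    rw [this]
    simp only [e, OpenPartialHomeomorph.trans_target, Homeomorph.toOpenPartialHomeomorph_target,
      Set.univ_inter]
    simp
    rfl
  have hcφ : c.source = φ.source := (extChartAt_source ..).symm
  refine Manifold.IsSubmersionAtOfComplement.mk_of_continuousAt hf.continuous.continuousAt L e
    (chartAt N.H (f x)) ((hmem x).2 ⟨mem_chart_source _ _, hxT⟩) (mem_chart_source _ _) ?_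
    (IsManifold.chart_mem_maximalAtlas _) ?_
  · refine OpenPartialHomeomorph.mem_maximalAtlas_of_contMDiffOn _ ?_ ?_
    · have h1 : ContMDiffOn M.I 𝓘(ℝ, N.E × (Fin (Module.finrank ℝ M.E - Module.finrank ℝ N.E) → ℝ))
          ∞ (fun y => T (φ y)) e.source := by
        have : ContMDiffOn 𝓘(ℝ, M.E)
            𝓘(ℝ, N.E × (Fin (Module.finrank ℝ M.E - Module.finrank ℝ N.E) → ℝ)) ∞ T
            T.source := by
          rw [contMDiffOn_iff_contDiffOn]
          exact (hΦ.mono hTD).congr fun e _ => hT e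
        exact this.comp (hφs.mono fun y hy => hcφ ▸ ((hmem y).1 hy).1) fun y hy => ((hmem y).1 hy).2
      have h2 := L.symm.contDiff.contMDiff.comp_contMDiffOn (n := ∞) h1
      exact M.I.contMDiffOn_symm.comp h2 fun y _ => by rw [M.I.range_eq_univ]; trivial
    · have h1 : ContMDiffOn M.I 𝓘(ℝ, M.E) ∞ (fun y => T.symm (L (M.I y))) e.target := by
        refine (contMDiffOn_iff_contDiffOn.2 hTs).comp ?_ fun y hy => ((hmemt y).1 hy).1
        exact (L.contDiff.contMDiff.comp M.I.contMDiff).contMDiffOn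
      exact hφsymm.comp h1 fun y hy => ((hmemt y).1 hy).2
  · intro v hv
    have hv' : M.I.symm v ∈ e.target := by
      simp [OpenPartialHomeomorph.extend] at hv
      exact hv.2
    have h2 := (hmemt _).1 hv'
    rw [M.I.right_inv (by rw [M.I.range_eq_univ]; trivial)] at h2
    have h3 : Φ (T.symm (L v)) = L v := by rw [← hT, T.right_inv h2.1]
    have h4 := congrArg Prod.fst h3
    change ψ (f (e.symm (M.I.symm v))) = (L v).1
    rw [hes, M.I.right_inv (by rw [M.I.range_eq_univ]; trivial)]
    exact h4

/-- From here on submersions are handled through their local sections, for which the permanence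
properties are formal. -/
theorem submersion_iff {M N : Mfd.{u}} {f : M → N} :
    Submersion f ↔ Smooth f ∧ HasLocalSections f :=
  ⟨fun h => ⟨h.smooth, h.hasLocalSections⟩, fun h => h.1.submersion_of_hasLocalSections h.2⟩

/-! ### Submanifolds given by local parametrisations -/

section Slice

set_option linter.unusedSectionVars false

variable {W : Mfd.{u}} {S : Set W} {E H : Type} [NormedAddCommGroup E] [NormedSpace ℝ E]
  [FiniteDimensional ℝ E] [TopologicalSpace H] (I : ModelWithCorners ℝ E H) [I.Boundaryless]
  (Y : Type*) [TopologicalSpace Y] [ChartedSpace H Y] [IsManifold I ∞ Y]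

/-- A local parametrisation of the subset `S` of the manifold `W` by an open subset of `Y`, with
an inverse that extends smoothly to an open subset of `W`. -/
structure LocalParam (S : Set W) (p : W) where
  U : Set W
  V : Set Y
  toFun : W → Y
  param : Y → W
  isOpen_U : IsOpen U
  mem : p ∈ U
  isOpen_V : IsOpen V
  smooth_toFun : ContMDiffOn W.I I ∞ toFun U
  smooth_param : ContMDiffOn I W.I ∞ param V
  map_mem : ∀ w ∈ U ∩ S, toFun w ∈ V
  left_inv : ∀ w ∈ U ∩ S, param (toFun w) = w
  param_mem : ∀ v ∈ V, param v ∈ U ∩ S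
  right_inv : ∀ v ∈ V, toFun (param v) = v

variable {I Y}

open Classical in
/-- The local homeomorphism from `S` to `Y` of a local parametrisation. -/
def LocalParam.toPartialHomeo {p : S} (c : LocalParam I Y S p) : OpenPartialHomeomorph S Y where
  toFun w := c.toFun w
  invFun v := if h : v ∈ c.V then ⟨c.param v, (c.param_mem v h).2⟩ else p
  source := Subtype.val ⁻¹' c.U
  target := c.V
  map_source' w hw := c.map_mem w ⟨hw, w.2⟩
  map_target' v hv := by
    rw [dif_pos hv]
    exact (c.param_mem v hv).1
  left_inv' w hw := by
    rw [dif_pos (c.map_mem w ⟨hw, w.2⟩)]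
    exact Subtype.ext (c.left_inv w ⟨hw, w.2⟩)
  right_inv' v hv := by
    rw [dif_pos hv]
    exact c.right_inv v hv
  open_source := c.isOpen_U.preimage continuous_subtype_val
  open_target := c.isOpen_V
  continuousOn_toFun := c.smooth_toFun.continuousOn.comp continuous_subtype_val.continuousOn
    fun w hw => hw
  continuousOn_invFun := by
    rw [Topology.IsInducing.subtypeVal.continuousOn_iff]
    refine c.smooth_param.continuousOn.congr fun v hv => ?_
    simp only [Function.comp_apply]
    rw [dif_pos hv]

theorem LocalParam.toPartialHomeo_symm_coe {p : S} (c : LocalParam I Y S p) {v : Y} (hv : v ∈ c.V) :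
    (c.toPartialHomeo.symm v : W) = c.param v := by
  exact congrArg Subtype.val (dif_pos hv)

/-- The chart of `S` at `p` given by a local parametrisation. -/
def LocalParam.chart {p : S} (c : LocalParam I Y S p) : OpenPartialHomeomorph S H :=
  c.toPartialHomeo.trans (chartAt H (c.toFun p))

theorem LocalParam.mem_chart_source {p : S} (c : LocalParam I Y S p) : p ∈ c.chart.source :=
  ⟨c.mem, _root_.mem_chart_source _ _⟩

/-- The parametrisation of `S` by an open subset of the model space. -/
def LocalParam.modelParam {p : S} (c : LocalParam I Y S p) (e : E) : W :=
  c.param ((extChartAt I (c.toFun p)).symm e)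

/-- The inverse of the parametrisation of `S` by an open subset of the model space. -/
def LocalParam.modelChart {p : S} (c : LocalParam I Y S p) (w : W) : E :=
  extChartAt I (c.toFun p) (c.toFun w)

theorem LocalParam.contMDiffOn_modelParam {p : S} (c : LocalParam I Y S p) :
    ContMDiffOn 𝓘(ℝ, E) W.I ∞ c.modelParam (I.symm ⁻¹' c.chart.target) := by
  refine c.smooth_param.comp ((contMDiffOn_extChartAt_symm (c.toFun p)).mono ?_) ?_
  · intro e he
    rw [extChartAt_target, I.range_eq_univ, Set.inter_univ]
    exact he.1
  · exact fun e he => he.2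

theorem LocalParam.contMDiffOn_modelChart {p : S} (c : LocalParam I Y S p) :
    ContMDiffOn W.I 𝓘(ℝ, E) ∞ c.modelChart (c.U ∩ c.toFun ⁻¹' (chartAt H (c.toFun p)).source) :=
  contMDiffOn_extChartAt.comp (c.smooth_toFun.mono Set.inter_subset_left) fun _ hw => hw.2

theorem LocalParam.isOpen_modelChart_source {p : S} (c : LocalParam I Y S p) :
    IsOpen (c.U ∩ c.toFun ⁻¹' (chartAt H (c.toFun p)).source) :=
  c.smooth_toFun.continuousOn.isOpen_inter_preimage c.isOpen_U (chartAt H (c.toFun p)).open_source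

theorem LocalParam.coe_chart_symm {p : S} (c : LocalParam I Y S p) {e : E}
    (he : I.symm e ∈ c.chart.target) : (c.chart.symm (I.symm e) : W) = c.modelParam e :=
  c.toPartialHomeo_symm_coe he.2

/-- The submanifold structure on a subset with local parametrisations. -/
@[reducible] def sliceChartedSpace (c : ∀ p : S, LocalParam I Y S (p : W)) : ChartedSpace H S where
  atlas := Set.range fun p => (c p).chart
  chartAt p := (c p).chart
  mem_chart_source p := (c p).mem_chart_source
  chart_mem_atlas p := ⟨p, rfl⟩

variable (W S) in
/-- The submanifold structure on a subset with local parametrisations. -/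
def Mfd.slice (c : ∀ p : S, LocalParam I Y S (p : W)) : Mfd.{u} where
  carrier := S
  E := E
  H := H
  I := I
  charted := sliceChartedSpace c
  manifold := by
    let _ := sliceChartedSpace c
    refine isManifold_of_contDiffOn I ∞ S ?_
    rintro _ _ ⟨p, rfl⟩ ⟨p', rfl⟩
    rw [← contMDiffOn_iff_contDiffOn, I.range_eq_univ, Set.inter_univ]
    -- A change of charts factors through the ambient manifold: a parametrisation into `W`, followed
    -- by a chart that extends to an open subset of `W`.
    have h1 : ContMDiffOn 𝓘(ℝ, E) 𝓘(ℝ, E) ∞ ((c p').modelChart ∘ (c p).modelParam)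
        (I.symm ⁻¹' ((c p).chart.symm.trans (c p').chart).source) := by
      refine (c p').contMDiffOn_modelChart.comp
        ((c p).contMDiffOn_modelParam.mono fun e he => he.1) ?_
      intro e he
      rw [Set.mem_preimage, ← (c p).coe_chart_symm he.1]
      exact ⟨he.2.1, he.2.2⟩
    refine h1.congr fun e he => ?_
    simp only [Function.comp_apply]
    rw [← (c p).coe_chart_symm he.1]
    rfl

variable (c : ∀ p : S, LocalParam I Y S (p : W))

/-- Near `p` the inclusion is the chart at `p` followed by the parametrisation. -/
theorem Mfd.slice_smooth_coe : Smooth (M := Mfd.slice W S c) (N := W) Subtype.val := by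
  intro p
  have hp : p ∈ (c p).chart.source := (c p).mem_chart_source
  have h1 : ContMDiffOn (Mfd.slice W S c).I 𝓘(ℝ, (Mfd.slice W S c).E) ∞
      (extChartAt (Mfd.slice W S c).I p) (chartAt (Mfd.slice W S c).H p).source :=
    contMDiffOn_extChartAt
  have h2 : ContMDiffOn (Mfd.slice W S c).I W.I ∞
      ((c p).modelParam ∘ extChartAt (Mfd.slice W S c).I p) (c p).chart.source := by
    refine (c p).contMDiffOn_modelParam.comp h1 ?_
    intro q hq
    change I.symm (I ((c p).chart q)) ∈ (c p).chart.target
    rw [I.left_inv]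
    exact (c p).chart.map_source hq
  refine ContMDiffOn.contMDiffAt (h2.congr ?_) ((c p).chart.open_source.mem_nhds hp)
  intro q hq
  have h3 : I.symm (I ((c p).chart q)) ∈ (c p).chart.target := by
    rw [I.left_inv]; exact (c p).chart.map_source hq
  change (Subtype.val (p := (· ∈ S)) q) = (c p).modelParam (I ((c p).chart q))
  rw [← (c p).coe_chart_symm h3, I.left_inv, (c p).chart.left_inv hq]

/-- Every chart of `S` is the restriction of a smooth map on an open subset of `W`, so smoothness
into `W` survives reading in the chart. -/
theorem Mfd.slice_smooth_iff {Z : Mfd.{u}} (h : Z → Mfd.slice W S c) :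
    Smooth h ↔ Smooth (M := Z) (N := W) fun z => Subtype.val (p := (· ∈ S)) (h z) := by
  refine ⟨fun hh => (Mfd.slice_smooth_coe c).comp hh, fun hh z => ?_⟩
  rw [contMDiffAt_iff_target]
  refine ⟨(Topology.IsInducing.subtypeVal.continuous_iff.2 hh.continuous).continuousAt, ?_⟩
  have h1 := (c (h z)).contMDiffOn_modelChart.contMDiffAt
    ((c (h z)).isOpen_modelChart_source.mem_nhds
      ⟨(c (h z)).mem, _root_.mem_chart_source _ _⟩)
  have h2 : ContMDiffAt Z.I 𝓘(ℝ, E) ∞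
      (fun z' => (c (h z)).modelChart (Subtype.val (p := (· ∈ S)) (h z'))) z :=
    ContMDiffAt.comp (g := (c (h z)).modelChart)
      (f := fun z => Subtype.val (p := (· ∈ S)) (h z)) z h1 (hh z)
  exact h2

end Slice

theorem smooth_fst (M N : Mfd.{u}) : Smooth (M := M.prod N) (N := M) Prod.fst := contMDiff_fst

theorem smooth_snd (M N : Mfd.{u}) : Smooth (M := M.prod N) (N := N) Prod.snd := contMDiff_snd

theorem smooth_id (M : Mfd.{u}) : Smooth (M := M) (N := M) fun x => x := contMDiff_id

theorem smooth_const (M N : Mfd.{u}) (y : N) : Smooth (M := M) (N := N) fun _ => y :=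
  contMDiff_const

theorem Smooth.comp {L M N : Mfd.{u}} {g : M → N} {f : L → M} (hg : Smooth g) (hf : Smooth f) :
    Smooth fun x => g (f x) :=
  ContMDiff.comp hg hf

theorem Smooth.prodMk {L M N : Mfd.{u}} {f : L → M} {g : L → N} (hf : Smooth f) (hg : Smooth g) :
    Smooth (M := L) (N := M.prod N) fun x => (f x, g x) :=
  ContMDiff.prodMk hf hg

/-! ### Fibred products along submersions -/

/-- A finite-dimensional normed space. -/
structure FinDimSpace : Type 1 where
  carrier : Type
  [normed : NormedAddCommGroup carrier]
  [space : NormedSpace ℝ carrier]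
  [finDim : FiniteDimensional ℝ carrier]

attribute [instance] FinDimSpace.normed FinDimSpace.space FinDimSpace.finDim

/-- The parametrisations of a fibred product along a submersion. -/
theorem Submersion.exists_localParam {M N B : Mfd.{u}} {f : M → B} {g : N → B} (hf : Smooth f)
    (hg : Submersion g) : ∃ F : FinDimSpace, ∀ p : {z : M × N | f z.1 = g z.2},
      Nonempty (LocalParam (W := M.prod N) (M.I.prod 𝓘(ℝ, F.carrier)) (M × F.carrier)
        {z : M × N | f z.1 = g z.2} (p : M × N)) := by
  obtain ⟨F, i1, i2, i3, hF⟩ := hg.exists_trivialization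
  refine ⟨⟨F⟩, fun p => ?_⟩
  obtain ⟨O, W, τ, σ, hO, hp, hW, hτ, hσ, h1, h2⟩ := hF p.1.2
  have hc : ContMDiff (M.I.prod 𝓘(ℝ, F)) (B.I.prod 𝓘(ℝ, F)) ∞ fun v : M × F => (f v.1, v.2) :=
    (ContMDiff.comp hf contMDiff_fst).prodMk contMDiff_snd
  -- On the fibred product `n` is recovered from `m` and the fibre coordinate `τ n`, since `g n = f
  -- m`.
  refine ⟨
   { U := {z : M × N | z.2 ∈ O}
     V := (fun v : M × F => (f v.1, v.2)) ⁻¹' W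
     toFun := fun z : M × N => (z.1, τ z.2)
     param := fun v => ((v.1, σ (f v.1, v.2)) : M × N)
     isOpen_U := hO.preimage continuous_snd
     mem := hp
     isOpen_V := hW.preimage hc.continuous
     smooth_toFun := contMDiff_fst.contMDiffOn.prodMk
      (hτ.comp contMDiff_snd.contMDiffOn fun z hz => hz)
     smooth_param := contMDiff_fst.contMDiffOn.prodMk (hσ.comp hc.contMDiffOn fun v hv => hv)
     map_mem := ?_
     left_inv := ?_
     param_mem := fun v hv => ⟨(h2 _ hv).1, (h2 _ hv).2.1.symm⟩
     right_inv := fun v hv => Prod.ext rfl (h2 _ hv).2.2 }⟩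
  · rintro ⟨m, n⟩ ⟨hn, e⟩
    have e' : f m = g n := e
    simp only [Set.mem_preimage]
    rw [e']
    exact (h1 n hn).1
  · rintro ⟨m, n⟩ ⟨hn, e⟩
    have e' : f m = g n := e
    simp only [e']
    rw [(h1 n hn).2]

/-- The fibred product of a smooth map and a submersion. -/
def Mfd.pullback {M N B : Mfd.{u}} (f : M → B) (g : N → B) (hf : Smooth f) (hg : Submersion g) :
    Mfd.{u} :=
  Mfd.slice (M.prod N) {z : M × N | f z.1 = g z.2}
    fun p => ((hg.exists_localParam hf).choose_spec p).some

section Pullback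

variable {M N B : Mfd.{u}} {f : M → B} {g : N → B} (hf : Smooth f) (hg : Submersion g)

/-- A point of the fibred product. -/
def Mfd.pullback.mk (m : M) (n : N) (e : f m = g n) : Mfd.pullback f g hf hg :=
  (⟨(m, n), e⟩ : {z : M × N | f z.1 = g z.2})

/-- The first projection of the fibred product. -/
def Mfd.pullback.fst (z : Mfd.pullback f g hf hg) : M := (z : {z : M × N | f z.1 = g z.2}).1.1

/-- The second projection of the fibred product. -/
def Mfd.pullback.snd (z : Mfd.pullback f g hf hg) : N := (z : {z : M × N | f z.1 = g z.2}).1.2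

theorem Mfd.pullback.ext {z w : Mfd.pullback f g hf hg}
    (h1 : Mfd.pullback.fst hf hg z = Mfd.pullback.fst hf hg w)
    (h2 : Mfd.pullback.snd hf hg z = Mfd.pullback.snd hf hg w) : z = w :=
  Subtype.ext (Prod.ext h1 h2)

theorem Mfd.pullback.comm (z : Mfd.pullback f g hf hg) :
    f (Mfd.pullback.fst hf hg z) = g (Mfd.pullback.snd hf hg z) :=
  (z : {z : M × N | f z.1 = g z.2}).2

/-- `IsFibredProduct` speaks of smooth maps only; compactness, discreteness and properness of the
fibred products below are read off from the topology. -/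
theorem Mfd.pullback.isEmbedding :
    Topology.IsEmbedding (Y := M × N)
      fun z => (Mfd.pullback.fst hf hg z, Mfd.pullback.snd hf hg z) :=
  Topology.IsEmbedding.subtypeVal (p := fun z : M × N => f z.1 = g z.2)

theorem Mfd.pullback.isFibredProduct :
    IsFibredProduct f g (Mfd.pullback.fst hf hg) (Mfd.pullback.snd hf hg) where
  smooth_fst := (smooth_fst M N).comp (Mfd.slice_smooth_coe _)
  smooth_snd := (smooth_snd M N).comp (Mfd.slice_smooth_coe _)
  comm := Mfd.pullback.comm hf hg
  existsUnique m n e := ⟨Mfd.pullback.mk hf hg m n e, ⟨rfl, rfl⟩, fun _ hz =>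
    Mfd.pullback.ext hf hg hz.1 hz.2⟩
  smooth_lift _ _ h1 h2 := (Mfd.slice_smooth_iff _ _).2 (Smooth.prodMk h1 h2)

end Pullback

/-! ### Permanence of submersions -/

/-- An open submanifold. -/
def Mfd.opens (M : Mfd.{u}) (O : TopologicalSpace.Opens M) : Mfd.{u} where
  carrier := O
  E := M.E
  H := M.H
  I := M.I

theorem smooth_opens_iff {M N : Mfd.{u}} {O : TopologicalSpace.Opens M} {f : M → N} :
    Smooth (M := M.opens O) (N := N) (fun x => f (Subtype.val (p := (· ∈ O)) x)) ↔
      ContMDiffOn M.I N.I ∞ f O := by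
  constructor
  · intro h x hx
    have h' : ContMDiffAt M.I N.I ∞ (fun y : O => f y) ⟨x, hx⟩ := h ⟨x, hx⟩
    exact (contMDiffAt_subtype_iff.1 h').contMDiffWithinAt
  · intro h x
    have h' : ContMDiffAt M.I N.I ∞ (fun y : O => f y) x :=
      contMDiffAt_subtype_iff.2 (h.contMDiffAt (O.2.mem_nhds (Subtype.prop (p := (· ∈ O)) x)))
    exact h'

theorem IsFibredProduct.symm {M N B P : Mfd.{u}} {f : M → B} {g : N → B} {p : P → M} {q : P → N}
    (h : IsFibredProduct f g p q) : IsFibredProduct g f q p where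
  smooth_fst := h.smooth_snd
  smooth_snd := h.smooth_fst
  comm z := (h.comm z).symm
  existsUnique n m e := by
    obtain ⟨z, h1, h2⟩ := h.existsUnique m n e.symm
    exact ⟨z, ⟨h1.2, h1.1⟩, fun w hw => h2 w ⟨hw.2, hw.1⟩⟩
  smooth_lift Z k h1 h2 := h.smooth_lift Z k h2 h1

theorem IsFibredProduct.ext {M N B P : Mfd.{u}} {f : M → B} {g : N → B} {p : P → M} {q : P → N}
    (h : IsFibredProduct f g p q) {z w : P} (h1 : p z = p w) (h2 : q z = q w) : z = w :=
  (h.existsUnique (p w) (q w) (h.comm w)).unique ⟨h1, h2⟩ ⟨rfl, rfl⟩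

/-- The lifting property tests with whole manifolds, so it is applied to the open submanifold on
`O`. Local sections require this version. -/
theorem IsFibredProduct.contMDiffOn_lift {M N B P Z : Mfd.{u}} {f : M → B} {g : N → B} {p : P → M}
    {q : P → N} (h : IsFibredProduct f g p q) {O : Set Z} (hO : IsOpen O) {k : Z → P}
    (h1 : ContMDiffOn Z.I M.I ∞ (fun z => p (k z)) O)
    (h2 : ContMDiffOn Z.I N.I ∞ (fun z => q (k z)) O) : ContMDiffOn Z.I P.I ∞ k O := by
  have := h.smooth_lift (Z.opens ⟨O, hO⟩) (fun z => k (Subtype.val (p := (· ∈ O)) z))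
    (smooth_opens_iff (f := fun z => p (k z)) |>.2 h1)
    (smooth_opens_iff (f := fun z => q (k z)) |>.2 h2)
  exact smooth_opens_iff.1 this

namespace HasLocalSections

theorem comp {L M N : Mfd.{u}} {g : M → N} {f : L → M} (hg : HasLocalSections g)
    (hf : HasLocalSections f) : HasLocalSections fun x => g (f x) := by
  intro x
  obtain ⟨U, σ, hU, hx, hσ, hσx, hσg⟩ := hg (f x)
  obtain ⟨V, τ, hV, hxV, hτ, hτx, hτf⟩ := hf x
  refine ⟨U ∩ σ ⁻¹' V, fun y => τ (σ y), hσ.continuousOn.isOpen_inter_preimage hU hV,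
    ⟨hx, by rw [Set.mem_preimage, hσx]; exact hxV⟩, ?_, (congrArg τ hσx).trans hτx,
    fun y hy => (congrArg g (hτf _ hy.2)).trans (hσg _ hy.1)⟩
  exact hτ.comp (hσ.mono Set.inter_subset_left) fun y hy => hy.2

theorem of_comp {L M N : Mfd.{u}} {g : M → N} {f : L → M}
    (h : HasLocalSections fun x => g (f x)) (hf : Smooth f) (hs : Function.Surjective f) :
    HasLocalSections g := by
  intro y
  obtain ⟨x, rfl⟩ := hs y
  obtain ⟨U, σ, hU, hx, hσ, hσx, hσg⟩ := h x
  exact ⟨U, fun y => f (σ y), hU, hx, ContMDiff.comp_contMDiffOn hf hσ, congrArg f hσx, hσg⟩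

theorem prodMap {M N M' N' : Mfd.{u}} {f : M → N} {g : M' → N'} (hf : HasLocalSections f)
    (hg : HasLocalSections g) :
    HasLocalSections (M := M.prod M') (N := N.prod N') fun x => (f x.1, g x.2) := by
  rintro ⟨x, y⟩
  obtain ⟨U, σ, hU, hx, hσ, hσx, hσg⟩ := hf x
  obtain ⟨V, τ, hV, hxV, hτ, hτx, hτf⟩ := hg y
  refine ⟨(U ×ˢ V : Set (N × N')), fun z : N × N' => ((σ z.1, τ z.2) : M × M'), hU.prod hV,
    ⟨hx, hxV⟩, ?_, Prod.ext hσx hτx, fun z hz => Prod.ext (hσg _ hz.1) (hτf _ hz.2)⟩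
  exact (hσ.comp contMDiffOn_fst fun z hz => hz.1).prodMk
    (hτ.comp contMDiffOn_snd fun z hz => hz.2)

/-- A local section `σ` of `f` pulls back to `n ↦ (σ (g n), n)`. -/
theorem baseChange {M N B P : Mfd.{u}} {f : M → B} {g : N → B} {p : P → M} {q : P → N}
    (hf : HasLocalSections f) (hg : Smooth g) (h : IsFibredProduct f g p q) :
    HasLocalSections q := by
  intro z
  obtain ⟨U, σ, hU, hx, hσ, hσx, hσg⟩ := hf (p z)
  have key : ∀ n ∈ g ⁻¹' U, ∃ w, p w = σ (g n) ∧ q w = n := fun n hn =>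
    (h.existsUnique _ _ (hσg _ hn)).exists
  have hz : q z ∈ g ⁻¹' U := by rw [Set.mem_preimage, ← h.comm]; exact hx
  classical
  -- The value `z` outside `g ⁻¹' U` is a filler that plays no role.
  let k : N → P := fun n => if hn : n ∈ g ⁻¹' U then (key n hn).choose else z
  have hk : ∀ n (hn : n ∈ g ⁻¹' U), p (k n) = σ (g n) ∧ q (k n) = n := fun n hn => by
    simp only [k, dif_pos hn]
    exact (key n hn).choose_spec
  have hO : IsOpen (g ⁻¹' U) := hU.preimage hg.continuous
  refine ⟨g ⁻¹' U, k, hO, hz, ?_, ?_, fun n hn => (hk n hn).2⟩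
  · refine h.contMDiffOn_lift hO ?_ ?_
    · exact (hσ.comp hg.contMDiffOn fun n hn => hn).congr fun n hn => (hk n hn).1
    · exact contMDiffOn_id.congr fun n hn => (hk n hn).2
  · refine h.ext ?_ (hk _ hz).2
    rw [(hk _ hz).1, ← h.comm, hσx]

/-- Locally `f = (f ∘ π) ∘ σ` for a section `σ` of `π`. -/
theorem smooth_of_comp {L M N : Mfd.{u}} {π : L → M} (hπ : HasLocalSections π)
    (hs : Function.Surjective π) {f : M → N} (hf : Smooth fun x => f (π x)) : Smooth f := by
  intro y
  obtain ⟨x, rfl⟩ := hs y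
  obtain ⟨U, σ, hU, hx, hσ, hσx, hσg⟩ := hπ x
  have : ContMDiffOn M.I N.I ∞ (fun y => f (π (σ y))) U :=
    ContMDiff.comp_contMDiffOn (g := fun x => f (π x)) hf hσ
  exact (this.congr fun y hy => by rw [hσg y hy]).contMDiffAt (hU.mem_nhds hx)

end HasLocalSections

namespace Submersion

theorem comp {L M N : Mfd.{u}} {g : M → N} {f : L → M} (hg : Submersion g) (hf : Submersion f) :
    Submersion fun x => g (f x) :=
  submersion_iff.2 ⟨hg.smooth.comp hf.smooth, hg.hasLocalSections.comp hf.hasLocalSections⟩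

theorem prodMap {M N M' N' : Mfd.{u}} {f : M → N} {g : M' → N'} (hf : Submersion f)
    (hg : Submersion g) :
    Submersion (M := M.prod M') (N := N.prod N') fun x => (f x.1, g x.2) :=
  submersion_iff.2 ⟨(hf.smooth.comp (smooth_fst _ _)).prodMk (hg.smooth.comp (smooth_snd _ _)),
    hf.hasLocalSections.prodMap hg.hasLocalSections⟩

theorem baseChange {M N B P : Mfd.{u}} {f : M → B} {g : N → B} {p : P → M} {q : P → N}
    (hf : Submersion f) (hg : Smooth g) (h : IsFibredProduct f g p q) : Submersion q :=
  submersion_iff.2 ⟨h.smooth_snd, hf.hasLocalSections.baseChange hg h⟩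

/-- Smoothness descends along surjective submersions. -/
theorem smooth_of_comp {L M N : Mfd.{u}} {π : L → M} (hπ : Submersion π)
    (hs : Function.Surjective π) {f : M → N} (hf : Smooth fun x => f (π x)) : Smooth f :=
  hπ.hasLocalSections.smooth_of_comp hs hf

end Submersion

theorem IsFibredProduct.surjective_snd {M N B P : Mfd.{u}} {f : M → B} {g : N → B} {p : P → M}
    {q : P → N} (h : IsFibredProduct f g p q) (hf : Function.Surjective f) :
    Function.Surjective q := by
  intro n
  obtain ⟨m, hm⟩ := hf (g n)
  obtain ⟨z, hz, -⟩ := h.existsUnique m n hm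
  exact ⟨z, hz.2⟩

/-- A smooth family of points is smooth if it is so after pulling back along a submersion. -/
theorem exists_cover {Z M B : Mfd.{u}} {a : Z → B} (ha : Smooth a) {g : M → B} (hg : Submersion g)
    (hs : Function.Surjective g) :
    ∃ (Z' : Mfd.{u}) (π : Z' → Z) (m : Z' → M), Smooth π ∧ Smooth m ∧
      (∀ z, g (m z) = a (π z)) ∧
      ∀ (N : Mfd.{u}) (f : Z → N), Smooth (fun z => f (π z)) → Smooth f := by
  -- The fibred product carries a tautological smooth lift of `a` through `g`, and its projection to
  -- `Z` is a surjective submersion, along which smoothness descends.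
  have h := Mfd.pullback.isFibredProduct ha hg
  exact ⟨_, _, _, h.smooth_fst, h.smooth_snd, fun z => (h.comm z).symm, fun N f hf =>
    (hg.baseChange ha h.symm).smooth_of_comp (h.symm.surjective_snd hs) hf⟩

/-! ### Fully faithful functors and weak equivalences -/

/-- Smoothly fully faithful functors. -/
def LieFunctor.FullyFaithful {𝒢 ℋ : LieGroupoid.{u}} (φ : LieFunctor 𝒢 ℋ) : Prop :=
  IsFibredProduct (M := 𝒢.Obj.prod 𝒢.Obj) (N := ℋ.Arr) (B := ℋ.Obj.prod ℋ.Obj)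
    (P := 𝒢.Arr) (fun x => (φ.obj x.1, φ.obj x.2)) (fun h => (ℋ.src h, ℋ.tgt h))
    (fun g => (𝒢.src g, 𝒢.tgt g)) φ.arr

namespace LieFunctor.FullyFaithful

variable {𝒢 ℋ 𝒦 : LieGroupoid.{u}} {φ : LieFunctor 𝒢 ℋ}

theorem mk (h1 : ∀ (x x' : 𝒢.Obj) (h : ℋ.Arr), ℋ.src h = φ.obj x → ℋ.tgt h = φ.obj x' →
      ∃ g, 𝒢.src g = x ∧ 𝒢.tgt g = x' ∧ φ.arr g = h)
    (h2 : ∀ g g', 𝒢.src g = 𝒢.src g' → 𝒢.tgt g = 𝒢.tgt g' → φ.arr g = φ.arr g' → g = g')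
    (h3 : ∀ (Z : Mfd.{u}) (h : Z → 𝒢.Arr), Smooth (fun z => 𝒢.src (h z)) →
      Smooth (fun z => 𝒢.tgt (h z)) → Smooth (fun z => φ.arr (h z)) → Smooth h) :
    φ.FullyFaithful where
  smooth_fst := 𝒢.smooth_src.prodMk 𝒢.smooth_tgt
  smooth_snd := φ.smooth_arr
  comm g := Prod.ext (φ.src_arr g).symm (φ.tgt_arr g).symm
  existsUnique := by
    rintro ⟨x, x'⟩ h e
    obtain ⟨g, rfl, rfl, rfl⟩ := h1 x x' h (congrArg Prod.fst e).symm (congrArg Prod.snd e).symm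
    refine ⟨g, ⟨rfl, rfl⟩, fun g' hg' => h2 _ _ ?_ ?_ hg'.2⟩
    · exact congrArg Prod.fst hg'.1
    · exact congrArg Prod.snd hg'.1
  smooth_lift Z h e e' := h3 Z h ((smooth_fst _ _).comp e) ((smooth_snd _ _).comp e) e'

theorem exists_lift (hφ : φ.FullyFaithful) {x x' : 𝒢.Obj} {h : ℋ.Arr} (hs : ℋ.src h = φ.obj x)
    (ht : ℋ.tgt h = φ.obj x') : ∃ g, 𝒢.src g = x ∧ 𝒢.tgt g = x' ∧ φ.arr g = h := by
  obtain ⟨g, ⟨h1, h2⟩, -⟩ := hφ.existsUnique (x, x') h (Prod.ext hs.symm ht.symm)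
  exact ⟨g, congrArg Prod.fst h1, congrArg Prod.snd h1, h2⟩

theorem ext (hφ : φ.FullyFaithful) {g g' : 𝒢.Arr} (hs : 𝒢.src g = 𝒢.src g')
    (ht : 𝒢.tgt g = 𝒢.tgt g') (h : φ.arr g = φ.arr g') : g = g' :=
  IsFibredProduct.ext hφ (Prod.ext hs ht) h

theorem smooth_of {Z : Mfd.{u}} {h : Z → 𝒢.Arr} (hφ : φ.FullyFaithful)
    (h1 : Smooth fun z => 𝒢.src (h z)) (h2 : Smooth fun z => 𝒢.tgt (h z))
    (h3 : Smooth fun z => φ.arr (h z)) : Smooth h :=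
  hφ.smooth_lift Z h (h1.prodMk h2) h3

theorem comp {ψ : LieFunctor ℋ 𝒦} (hψ : ψ.FullyFaithful) (hφ : φ.FullyFaithful) :
    (ψ.comp φ).FullyFaithful := by
  refine mk (fun x x' h hs ht => ?_) (fun g g' hs ht h => ?_) fun Z h h1 h2 h3 => ?_
  · obtain ⟨k, h1, h2, rfl⟩ := hψ.exists_lift (x := φ.obj x) (x' := φ.obj x') hs ht
    obtain ⟨g, rfl, rfl, rfl⟩ := hφ.exists_lift h1 h2
    exact ⟨g, rfl, rfl, rfl⟩
  · refine hφ.ext hs ht (hψ.ext ?_ ?_ h)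
    · rw [φ.src_arr, φ.src_arr, hs]
    · rw [φ.tgt_arr, φ.tgt_arr, ht]
  · refine hφ.smooth_of h1 h2 (hψ.smooth_of ?_ ?_ h3)
    · simp only [φ.src_arr]; exact φ.smooth_obj.comp h1
    · simp only [φ.tgt_arr]; exact φ.smooth_obj.comp h2

end LieFunctor.FullyFaithful

theorem LieGroupoid.surjective_src (𝒢 : LieGroupoid.{u}) : Function.Surjective 𝒢.src :=
  fun x => ⟨𝒢.unit x, 𝒢.src_unit x⟩

namespace LieFunctor.IsSubmersiveWeakEquivalence

variable {𝒢 ℋ 𝒦 : LieGroupoid.{u}} {φ : LieFunctor 𝒢 ℋ}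

/-- Essential surjectivity is automatic: `(x, h) ↦ s h` is the source map after a base change of
`φ.obj`. -/
theorem of_fullyFaithful (hφ : φ.FullyFaithful) (hs : Function.Surjective φ.obj)
    (hsub : Submersion φ.obj) : φ.IsSubmersiveWeakEquivalence where
  weakEquivalence :=
    { essSurj := by
        have h := Mfd.pullback.isFibredProduct φ.smooth_obj ℋ.submersion_tgt
        exact ⟨_, _, _, h, ℋ.surjective_src.comp (h.surjective_snd hs),
          ℋ.submersion_src.comp (hsub.baseChange ℋ.smooth_tgt h)⟩
      fullyFaithful := hφ }
  surjective := hs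
  submersion := hsub

theorem fullyFaithful (hφ : φ.IsSubmersiveWeakEquivalence) : φ.FullyFaithful :=
  hφ.weakEquivalence.fullyFaithful

/-- Full faithfulness presents `φ.arr` as a base change of `φ.obj × φ.obj`. -/
theorem submersion_arr (hφ : φ.IsSubmersiveWeakEquivalence) : Submersion φ.arr :=
  (hφ.submersion.prodMap hφ.submersion).baseChange (ℋ.smooth_src.prodMk ℋ.smooth_tgt)
    hφ.fullyFaithful

theorem comp {ψ : LieFunctor ℋ 𝒦} (hψ : ψ.IsSubmersiveWeakEquivalence)
    (hφ : φ.IsSubmersiveWeakEquivalence) : (ψ.comp φ).IsSubmersiveWeakEquivalence :=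
  of_fullyFaithful (hψ.fullyFaithful.comp hφ.fullyFaithful) (hψ.surjective.comp hφ.surjective)
    (hψ.submersion.comp hφ.submersion)

/-- The space that tests essential surjectivity of the composite is the one for `ψ` pulled back
along the surjective submersion `φ.obj`. -/
theorem comp_isWeakEquivalence {ψ : LieFunctor ℋ 𝒦} (hψ : ψ.IsWeakEquivalence)
    (hφ : φ.IsSubmersiveWeakEquivalence) : (ψ.comp φ).IsWeakEquivalence where
  fullyFaithful := FullyFaithful.comp hψ.fullyFaithful hφ.fullyFaithful
  essSurj := by
    obtain ⟨F, p, q, hF, hs, hsub⟩ := hψ.essSurj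
    have h := Mfd.pullback.isFibredProduct hF.smooth_fst hφ.submersion
    have h' := hφ.submersion.baseChange hF.smooth_fst h.symm
    have hs' := h.symm.surjective_snd hφ.surjective
    refine ⟨_, Mfd.pullback.snd hF.smooth_fst hφ.submersion,
      fun z => q (Mfd.pullback.fst hF.smooth_fst hφ.submersion z), ?_, hs.comp hs', hsub.comp h'⟩
    refine ⟨h.smooth_snd, hF.smooth_snd.comp h.smooth_fst, fun z => ?_, fun x k e => ?_,
      fun Z k h1 h2 => ?_⟩
    · exact (congrArg ψ.obj (h.comm z)).symm.trans (hF.comm _)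
    · obtain ⟨z, ⟨hz, hz'⟩, -⟩ := hF.existsUnique (φ.obj x) k e
      refine ⟨Mfd.pullback.mk _ _ z x hz, ⟨rfl, hz'⟩, fun w hw => h.ext (hF.ext ?_ ?_) hw.1⟩
      · exact (h.comm w).trans ((congrArg φ.obj hw.1).trans hz.symm)
      · exact hw.2.trans hz'.symm
    · refine h.smooth_lift Z k (hF.smooth_lift Z _ ?_ h2) h1
      simp only [h.comm]
      exact φ.smooth_obj.comp h1

end LieFunctor.IsSubmersiveWeakEquivalence

theorem LieGroupoid.inv_inv (𝒢 : LieGroupoid.{u}) (g : 𝒢.Arr) : 𝒢.inv (𝒢.inv g) = g := by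
  have key : ∀ (h : 𝒢.Arr) (e : 𝒢.src h = 𝒢.tgt (𝒢.inv g)) (_ : 𝒢.mul h (𝒢.inv g) e =
      𝒢.unit (𝒢.tgt g)), h = g := by
    intro h e e'
    have e0 : 𝒢.src h = 𝒢.src g := e.trans (𝒢.tgt_inv g)
    have e2 : 𝒢.tgt h = 𝒢.tgt g := by
      rw [← 𝒢.tgt_mul h _ e, e', 𝒢.tgt_unit]
    have h1 := 𝒢.mul_assoc h (𝒢.inv g) g e (𝒢.src_inv g)
    have h2 : 𝒢.mul h (𝒢.unit (𝒢.src g)) (by rw [𝒢.tgt_unit, e0]) = h := by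
      simp only [← e0, 𝒢.mul_unit]
    simp only [𝒢.inv_mul, e', 𝒢.unit_mul] at h1
    rw [h2] at h1
    exact h1.symm
  refine key _ (𝒢.src_inv _) ?_
  rw [𝒢.inv_mul, 𝒢.src_inv]

/-! ### The groupoid induced along a surjective submersion -/

section Induced

variable (ℳ : LieGroupoid.{u}) {Y : Mfd.{u}} {π : Y → ℳ.Obj} (hπ : Submersion π)

/-- The arrows of the induced groupoid. -/
def LieGroupoid.InducedArr : Mfd.{u} :=
  Mfd.pullback (M := ℳ.Arr) (N := Y.prod Y) (B := ℳ.Obj.prod ℳ.Obj)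
    (fun m => (ℳ.src m, ℳ.tgt m)) (fun y => (π y.1, π y.2))
    (ℳ.smooth_src.prodMk ℳ.smooth_tgt) (hπ.prodMap hπ)

namespace Induced

variable {ℳ}

/-- The arrow of the original groupoid underlying an arrow of the induced one. -/
def base (r : ℳ.InducedArr hπ) : ℳ.Arr :=
  Mfd.pullback.fst (ℳ.smooth_src.prodMk ℳ.smooth_tgt) (hπ.prodMap hπ) r

/-- The source of an arrow of the induced groupoid. -/
def source (r : ℳ.InducedArr hπ) : Y :=
  Prod.fst (Mfd.pullback.snd (ℳ.smooth_src.prodMk ℳ.smooth_tgt) (hπ.prodMap hπ) r : Y × Y)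

/-- The target of an arrow of the induced groupoid. -/
def target (r : ℳ.InducedArr hπ) : Y :=
  Prod.snd (Mfd.pullback.snd (ℳ.smooth_src.prodMk ℳ.smooth_tgt) (hπ.prodMap hπ) r : Y × Y)

theorem src_base (r : ℳ.InducedArr hπ) : ℳ.src (base hπ r) = π (source hπ r) :=
  congrArg Prod.fst (Mfd.pullback.comm (ℳ.smooth_src.prodMk ℳ.smooth_tgt) (hπ.prodMap hπ) r)

theorem tgt_base (r : ℳ.InducedArr hπ) : ℳ.tgt (base hπ r) = π (target hπ r) :=
  congrArg Prod.snd (Mfd.pullback.comm (ℳ.smooth_src.prodMk ℳ.smooth_tgt) (hπ.prodMap hπ) r)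

/-- An arrow of the induced groupoid. -/
def mkArr (m : ℳ.Arr) (y y' : Y) (h : ℳ.src m = π y) (h' : ℳ.tgt m = π y') : ℳ.InducedArr hπ :=
  Mfd.pullback.mk (M := ℳ.Arr) (N := Y.prod Y) (B := ℳ.Obj.prod ℳ.Obj)
    (ℳ.smooth_src.prodMk ℳ.smooth_tgt) (hπ.prodMap hπ) m (y, y') (Prod.ext h h')

theorem ext {r r' : ℳ.InducedArr hπ} (h : base hπ r = base hπ r') (h1 : source hπ r = source hπ r')
    (h2 : target hπ r = target hπ r') : r = r' :=
  Mfd.pullback.ext (ℳ.smooth_src.prodMk ℳ.smooth_tgt) (hπ.prodMap hπ) h (Prod.ext h1 h2)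

theorem smooth_base : Smooth (base hπ) :=
  (Mfd.pullback.isFibredProduct (ℳ.smooth_src.prodMk ℳ.smooth_tgt) (hπ.prodMap hπ)).smooth_fst

theorem smooth_source : Smooth (source hπ) := (AnaGpd.smooth_fst Y Y).comp
  (Mfd.pullback.isFibredProduct (ℳ.smooth_src.prodMk ℳ.smooth_tgt) (hπ.prodMap hπ)).smooth_snd

theorem smooth_target : Smooth (target hπ) := (AnaGpd.smooth_snd Y Y).comp
  (Mfd.pullback.isFibredProduct (ℳ.smooth_src.prodMk ℳ.smooth_tgt) (hπ.prodMap hπ)).smooth_snd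

theorem smooth_of {Z : Mfd.{u}} {k : Z → ℳ.InducedArr hπ} (h : Smooth fun z => base hπ (k z))
    (h1 : Smooth fun z => source hπ (k z)) (h2 : Smooth fun z => target hπ (k z)) : Smooth k :=
  (Mfd.pullback.isFibredProduct (ℳ.smooth_src.prodMk ℳ.smooth_tgt)
    (hπ.prodMap hπ)).smooth_lift Z k h (h1.prodMk h2)

/-- Forgetting the target of an arrow is a base change of `π`, and `(source, base) ↦ source` is a
base change of the source map of `ℳ`; the source is the composite of the two. -/
theorem submersion_source : Submersion (source hπ) := by
  have h := Mfd.pullback.isFibredProduct hπ.smooth ℳ.submersion_src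
  let p := Mfd.pullback.fst hπ.smooth ℳ.submersion_src
  let q := Mfd.pullback.snd hπ.smooth ℳ.submersion_src
  let r : ℳ.InducedArr hπ → Mfd.pullback π ℳ.src hπ.smooth ℳ.submersion_src := fun a =>
    Mfd.pullback.mk _ _ (source hπ a) (base hπ a) (src_base hπ a).symm
  have h' : IsFibredProduct π (fun z => ℳ.tgt (q z)) (target hπ) r := by
    refine ⟨smooth_target hπ, h.smooth_lift _ _ (smooth_source hπ) (smooth_base hπ),
      fun a => (tgt_base hπ a).symm,
      fun y z e => ?_, fun Z k h1 h2 => ?_⟩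
    · refine ⟨mkArr hπ (q z) (p z) y (h.comm z).symm e.symm, ⟨rfl, h.ext rfl rfl⟩, fun a ha => ?_⟩
      exact ext hπ (congrArg q ha.2) (congrArg p ha.2) ha.1
    · exact smooth_of hπ (h.smooth_snd.comp h2) (h.smooth_fst.comp h2) h1
  have h1 : Submersion r := hπ.baseChange (ℳ.smooth_tgt.comp h.smooth_snd) h'
  have h2 : Submersion p := ℳ.submersion_src.baseChange hπ.smooth h.symm
  exact h2.comp h1

end Induced

open Induced

/-- The groupoid induced by a Lie groupoid along a submersion to its space of objects. -/
def LieGroupoid.induced : LieGroupoid.{u} where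
  Obj := Y
  Arr := ℳ.InducedArr hπ
  src := source hπ
  tgt := target hπ
  unit y := mkArr hπ (ℳ.unit (π y)) y y (ℳ.src_unit _) (ℳ.tgt_unit _)
  inv r := mkArr hπ (ℳ.inv (base hπ r)) (target hπ r) (source hπ r)
    ((ℳ.src_inv _).trans (tgt_base hπ r))
    ((ℳ.tgt_inv _).trans (src_base hπ r))
  mul r r' e := mkArr hπ (ℳ.mul (base hπ r) (base hπ r')
      (by rw [src_base hπ, tgt_base hπ]; exact congrArg π e)) (source hπ r') (target hπ r)
    ((ℳ.src_mul _ _ _).trans (src_base hπ r')) ((ℳ.tgt_mul _ _ _).trans (tgt_base hπ r))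
  src_unit _ := rfl
  tgt_unit _ := rfl
  src_inv _ := rfl
  tgt_inv _ := rfl
  src_mul _ _ _ := rfl
  tgt_mul _ _ _ := rfl
  mul_unit r := Induced.ext hπ (by
    change ℳ.mul (base hπ r) (ℳ.unit (π (source hπ r))) _ = _
    simp only [← src_base hπ, ℳ.mul_unit]) rfl rfl
  unit_mul r := Induced.ext hπ (by
    change ℳ.mul (ℳ.unit (π (target hπ r))) (base hπ r) _ = _
    simp only [← tgt_base hπ, ℳ.unit_mul]) rfl rfl
  mul_inv r := Induced.ext hπ
    ((ℳ.mul_inv (base hπ r)).trans (congrArg ℳ.unit (tgt_base hπ r))) rfl rfl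
  inv_mul r := Induced.ext hπ
    ((ℳ.inv_mul (base hπ r)).trans (congrArg ℳ.unit (src_base hπ r))) rfl rfl
  mul_assoc r r' r'' e e' := Induced.ext hπ
    (ℳ.mul_assoc (base hπ r) (base hπ r') (base hπ r'') _ _) rfl rfl
  smooth_src := (smooth_source hπ)
  smooth_tgt := (smooth_target hπ)
  submersion_src := (submersion_source hπ)
  submersion_tgt := by
    -- The target is the source after inversion, and inversion, being its own inverse, is a
    -- submersion.
    have h1 : Smooth fun r : ℳ.InducedArr hπ =>
        mkArr hπ (ℳ.inv (base hπ r)) (target hπ r) (source hπ r)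
        ((ℳ.src_inv _).trans (tgt_base hπ r)) ((ℳ.tgt_inv _).trans (src_base hπ r)) :=
      smooth_of hπ (ℳ.smooth_inv.comp (smooth_base hπ)) (smooth_target hπ) (smooth_source hπ)
    refine (submersion_source hπ).comp (submersion_iff.2 ⟨h1,
      fun r => ⟨Set.univ, _, isOpen_univ, trivial,
      h1.contMDiffOn, ?_, fun r _ => ?_⟩⟩)
    · exact Induced.ext hπ (ℳ.inv_inv _) rfl rfl
    · exact Induced.ext hπ (ℳ.inv_inv _) rfl rfl
  smooth_unit := smooth_of hπ (ℳ.smooth_unit.comp hπ.smooth) (smooth_id Y) (smooth_id Y)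
  smooth_inv := smooth_of hπ (ℳ.smooth_inv.comp (smooth_base hπ)) (smooth_target hπ)
    (smooth_source hπ)
  smooth_mul Z a b ha hb e := smooth_of hπ
    (ℳ.smooth_mul Z _ _ ((smooth_base hπ).comp ha) ((smooth_base hπ).comp hb) _)
    (show Smooth fun z => source hπ (b z) from (smooth_source hπ).comp hb)
    (show Smooth fun z => target hπ (a z) from (smooth_target hπ).comp ha)

end Induced

open Induced

/-- The projection of the induced groupoid. -/
def LieGroupoid.inducedProj (ℳ : LieGroupoid.{u}) {Y : Mfd.{u}} {π : Y → ℳ.Obj}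
    (hπ : Submersion π) : LieFunctor (ℳ.induced hπ) ℳ where
  obj := π
  arr := base hπ
  smooth_obj := hπ.smooth
  smooth_arr := smooth_base hπ
  src_arr := src_base hπ
  tgt_arr := tgt_base hπ
  map_unit _ := rfl
  map_mul _ _ _ := rfl

theorem LieGroupoid.inducedProj_isSubmersiveWeakEquivalence (ℳ : LieGroupoid.{u}) {Y : Mfd.{u}}
    {π : Y → ℳ.Obj} (hπ : Submersion π) (hs : Function.Surjective π) :
    (ℳ.inducedProj hπ).IsSubmersiveWeakEquivalence := by
  refine .of_fullyFaithful (.mk (fun y y' m h h' => ?_) (fun g g' h1 h2 h => ?_)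
    fun Z k h1 h2 h3 => ?_) hs hπ
  · exact ⟨mkArr hπ m y y' h h', rfl, rfl, rfl⟩
  · exact Induced.ext hπ h h1 h2
  · exact smooth_of hπ h3 h1 h2

/-- Functors between Lie groupoids from maps of objects and arrows, when arrows of the target
groupoid are determined by their ends and their image under a fully faithful functor. -/
def LieFunctor.FullyFaithful.liftFunctor {𝒢 ℋ 𝒦 : LieGroupoid.{u}} {φ : LieFunctor ℋ 𝒦}
    (hφ : φ.FullyFaithful) (ψ : LieFunctor 𝒢 𝒦) (f : 𝒢.Obj → ℋ.Obj) (hf : Smooth f)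
    (hfψ : ∀ x, φ.obj (f x) = ψ.obj x) : LieFunctor 𝒢 ℋ :=
  have key : ∀ g : 𝒢.Arr, ∃ h, ℋ.src h = f (𝒢.src g) ∧ ℋ.tgt h = f (𝒢.tgt g) ∧
      φ.arr h = ψ.arr g := fun g =>
    hφ.exists_lift ((ψ.src_arr g).trans (hfψ _).symm) ((ψ.tgt_arr g).trans (hfψ _).symm)
  have hk : ∀ g, ℋ.src (key g).choose = f (𝒢.src g) ∧ ℋ.tgt (key g).choose = f (𝒢.tgt g) ∧
      φ.arr (key g).choose = ψ.arr g := fun g => (key g).choose_spec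
  { obj := f
    arr := fun g => (key g).choose
    smooth_obj := hf
    smooth_arr := by
      refine hφ.smooth_of ?_ ?_ ?_
      · simp only [hk]; exact hf.comp 𝒢.smooth_src
      · simp only [hk]; exact hf.comp 𝒢.smooth_tgt
      · simp only [hk]; exact ψ.smooth_arr
    src_arr := fun g => (hk g).1
    tgt_arr := fun g => (hk g).2.1
    map_unit := fun x => by
      refine hφ.ext ?_ ?_ ?_
      · rw [(hk _).1, 𝒢.src_unit, ℋ.src_unit]
      · rw [(hk _).2.1, 𝒢.tgt_unit, ℋ.tgt_unit]
      · rw [(hk _).2.2, ψ.map_unit, φ.map_unit, hfψ]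
    map_mul := fun g h e => by
      refine hφ.ext ?_ ?_ ?_
      · rw [(hk _).1, 𝒢.src_mul, ℋ.src_mul, (hk _).1]
      · rw [(hk _).2.1, 𝒢.tgt_mul, ℋ.tgt_mul, (hk _).2.1]
      · rw [(hk _).2.2, ψ.map_mul, φ.map_mul]
        simp only [hk] }

theorem LieFunctor.FullyFaithful.liftFunctor_arr {𝒢 ℋ 𝒦 : LieGroupoid.{u}} {φ : LieFunctor ℋ 𝒦}
    (hφ : φ.FullyFaithful) (ψ : LieFunctor 𝒢 𝒦) (f : 𝒢.Obj → ℋ.Obj) (hf : Smooth f)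
    (hfψ : ∀ x, φ.obj (f x) = ψ.obj x) (g : 𝒢.Arr) :
    φ.arr ((hφ.liftFunctor ψ f hf hfψ).arr g) = ψ.arr g :=
  (hφ.exists_lift ((ψ.src_arr g).trans (hfψ _).symm)
    ((ψ.tgt_arr g).trans (hfψ _).symm)).choose_spec.2.2

/-- A fully faithful functor is detected by its composite with a fully faithful functor. -/
theorem LieFunctor.FullyFaithful.of_comp {𝒢 ℋ 𝒦 : LieGroupoid.{u}} {φ : LieFunctor ℋ 𝒦}
    {ρ : LieFunctor 𝒢 ℋ} (hφ : φ.FullyFaithful) (h : (φ.comp ρ).FullyFaithful) :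
    ρ.FullyFaithful := by
  refine mk (fun x x' k hs ht => ?_) (fun g g' hs ht e => ?_) fun Z k h1 h2 h3 => ?_
  · obtain ⟨g, rfl, rfl, hg⟩ := h.exists_lift (x := x) (x' := x') (h := φ.arr k)
      ((φ.src_arr k).trans (congrArg φ.obj hs)) ((φ.tgt_arr k).trans (congrArg φ.obj ht))
    exact ⟨g, rfl, rfl, hφ.ext ((ρ.src_arr g).trans hs.symm) ((ρ.tgt_arr g).trans ht.symm) hg⟩
  · exact h.ext hs ht (congrArg φ.arr e)
  · exact h.smooth_of h1 h2 (φ.smooth_arr.comp h3)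

theorem LieFunctor.FullyFaithful.congr {𝒢 ℋ : LieGroupoid.{u}} {φ ψ : LieFunctor 𝒢 ℋ}
    (hφ : φ.FullyFaithful) (h : ψ = φ) : ψ.FullyFaithful := h ▸ hφ

/-! ### Morita invariance of the orbifold property -/

section Orbifold

variable {𝒬 𝒦 ℳ : LieGroupoid.{u}} {φ : LieFunctor 𝒬 𝒦} {ν : LieFunctor ℳ 𝒦}

/-- The strict pullback of a weak equivalence along a submersive weak equivalence, as an induced
groupoid, has weak equivalences to both factors. -/
theorem LieFunctor.IsSubmersiveWeakEquivalence.exists_span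
    (hφ : φ.IsSubmersiveWeakEquivalence) (hν : ν.IsWeakEquivalence) :
    ∃ (ℛ : LieGroupoid.{u}) (π : LieFunctor ℛ ℳ) (ρ : LieFunctor ℛ 𝒬),
      π.IsSubmersiveWeakEquivalence ∧ ρ.IsWeakEquivalence := by
  have hY := Mfd.pullback.isFibredProduct ν.smooth_obj hφ.submersion
  set π := Mfd.pullback.fst ν.smooth_obj hφ.submersion
  set x := Mfd.pullback.snd ν.smooth_obj hφ.submersion
  have hπ : Submersion π := hφ.submersion.baseChange ν.smooth_obj hY.symm
  have hπs : Function.Surjective π := hY.symm.surjective_snd hφ.surjective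
  have hπw := ℳ.inducedProj_isSubmersiveWeakEquivalence hπ hπs
  let ρ : LieFunctor (ℳ.induced hπ) 𝒬 := hφ.fullyFaithful.liftFunctor
    (ν.comp (ℳ.inducedProj hπ)) x hY.smooth_snd fun y => (hY.comm y).symm
  have hρ : φ.comp ρ = ν.comp (ℳ.inducedProj hπ) := by
    refine LieFunctor.ext (funext fun y => (hY.comm y).symm) (funext fun r => ?_)
    exact hφ.fullyFaithful.liftFunctor_arr ..
  have hρf : ρ.FullyFaithful := .of_comp hφ.fullyFaithful
    (.congr (.comp hν.fullyFaithful hπw.fullyFaithful) hρ)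
  refine ⟨ℳ.induced hπ, ℳ.inducedProj hπ, ρ, hπw, ?_, hρf⟩
  -- Essential surjectivity of `ρ`. Let `F₁` be the base change along `φ.obj` of the surjective
  -- submersion that `ν` provides. The map `r : (y, q) ↦ (s q, (π y, φ q))` to `F₁` is itself a base
  -- change of `φ.obj`: by full faithfulness `q` is recovered from its ends and `φ q`. So `(y, q) ↦
  -- s q`, which is `x₁ ∘ r`, is a composite of surjective submersions.
  obtain ⟨F₀, p₀, q₀, hF₀, hs₀, hsub₀⟩ := hν.essSurj
  have hF := Mfd.pullback.isFibredProduct ρ.smooth_obj 𝒬.submersion_tgt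
  set y := Mfd.pullback.fst ρ.smooth_obj 𝒬.submersion_tgt
  set q := Mfd.pullback.snd ρ.smooth_obj 𝒬.submersion_tgt
  have hF₁ := Mfd.pullback.isFibredProduct φ.smooth_obj hsub₀
  set x₁ := Mfd.pullback.fst φ.smooth_obj hsub₀
  set z₁ := Mfd.pullback.snd φ.smooth_obj hsub₀
  have hx₁ : Submersion x₁ := hsub₀.baseChange φ.smooth_obj hF₁.symm
  have hx₁s : Function.Surjective x₁ := hF₁.symm.surjective_snd hs₀
  have key : ∀ w, ∃ v, x₁ v = 𝒬.src (q w) ∧ p₀ (z₁ v) = π (y w) ∧ q₀ (z₁ v) = φ.arr (q w) := by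
    intro w
    have e : ν.obj (π (y w)) = 𝒦.tgt (φ.arr (q w)) := by
      rw [φ.tgt_arr]
      exact (hY.comm _).trans (congrArg φ.obj (hF.comm w))
    obtain ⟨z, ⟨hz, hz'⟩, -⟩ := hF₀.existsUnique _ _ e
    have e' : φ.obj (𝒬.src (q w)) = 𝒦.src (q₀ z) := by rw [hz', φ.src_arr]
    obtain ⟨v, ⟨hv, hv'⟩, -⟩ := hF₁.existsUnique _ _ e'
    exact ⟨v, hv, by rw [hv', hz], by rw [hv', hz']⟩
  choose r hr1 hr2 hr3 using key
  have hr : IsFibredProduct φ.obj (fun v => ν.obj (p₀ (z₁ v))) (fun w => x (y w)) r := by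
    refine ⟨hY.smooth_snd.comp hF.smooth_fst, ?_, fun w => ?_, fun m v e => ?_,
      fun Z k h1 h2 => ?_⟩
    · refine hF₁.smooth_lift _ _ ?_ (hF₀.smooth_lift _ _ ?_ ?_)
      · simp only [hr1]; exact 𝒬.smooth_src.comp hF.smooth_snd
      · simp only [hr2]; exact hY.smooth_fst.comp hF.smooth_fst
      · simp only [hr3]; exact φ.smooth_arr.comp hF.smooth_snd
    · rw [hr2]; exact (hY.comm _).symm
    · obtain ⟨y₁, ⟨h1, h2⟩, -⟩ := hY.existsUnique (p₀ (z₁ v)) m e.symm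
      obtain ⟨q₁, hq1, hq2, hq3⟩ := hφ.fullyFaithful.exists_lift (x := x₁ v) (x' := m)
        (h := q₀ (z₁ v)) (hF₁.comm v).symm ((hF₀.comm _).symm.trans e.symm)
      obtain ⟨w, ⟨hw1, hw2⟩, -⟩ := hF.existsUnique y₁ q₁ (h2.trans hq2.symm)
      have hxw : x (y w) = m := by rw [hw1, h2]
      refine ⟨w, ⟨hxw, hF₁.ext (by rw [hr1, hw2, hq1]) (hF₀.ext ?_ ?_)⟩, fun w' hw' => ?_⟩
      · rw [hr2, hw1, h1]
      · rw [hr3, hw2, hq3]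
      · refine hF.ext (hY.ext ?_ (hw'.1.trans hxw.symm)) (hφ.fullyFaithful.ext ?_ ?_ ?_)
        · rw [← hr2 w', hw'.2, hw1, h1]
        · rw [← hr1, hw'.2, hw2, hq1]
        · exact (hF.comm w').symm.trans ((hw'.1.trans hxw.symm).trans (hF.comm w))
        · rw [← hr3, hw'.2, hw2, hq3]
    · have hz : Smooth fun z => z₁ (r (k z)) := hF₁.smooth_snd.comp h2
      refine hF.smooth_lift Z k (hY.smooth_lift Z _ ?_ h1) (hφ.fullyFaithful.smooth_of ?_ ?_ ?_)
      · simp only [← hr2]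
        exact hF₀.smooth_fst.comp hz
      · simp only [← hr1]
        exact hF₁.smooth_fst.comp h2
      · exact h1.congr fun z => (hF.comm (k z)).symm
      · simp only [← hr3]
        exact hF₀.smooth_snd.comp hz
  have hsm : Smooth fun v => ν.obj (p₀ (z₁ v)) :=
    ν.smooth_obj.comp (hF₀.smooth_fst.comp hF₁.smooth_snd)
  have hrs := hφ.submersion.baseChange hsm hr
  have hrsurj := hr.surjective_snd hφ.surjective
  have heq : (fun w => 𝒬.src (q w)) = fun w => x₁ (r w) := funext fun w => (hr1 w).symm
  refine ⟨_, y, q, hF, ?_, ?_⟩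
  · rw [heq]; exact hx₁s.comp hrsurj
  · rw [heq]; exact hx₁.comp hrs

/-- Pulling the span `𝒦 ← ℳ → ℋ` back along `φ` gives a span `𝒬 ← ℛ → ℳ → ℋ` to the same proper
étale groupoid. -/
theorem LieFunctor.IsSubmersiveWeakEquivalence.isOrbifold (hφ : φ.IsSubmersiveWeakEquivalence)
    (h : 𝒦.IsOrbifold) : 𝒬.IsOrbifold := by
  obtain ⟨ℋ, h1, h2, ℳ, ν, τ, hν, hτ⟩ := h
  obtain ⟨ℛ, π, ρ, hπ, hρ⟩ := hφ.exists_span hν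
  exact ⟨ℋ, h1, h2, ℛ, ρ, τ.comp π, hρ, hπ.comp_isWeakEquivalence hτ⟩

end Orbifold

/-! ### Strict pullbacks -/

/-- An arrow of the pullback over `k` is a lift of `φ.arr k` through `ψ`, and full faithfulness of
`ψ` provides exactly one with given ends, smoothly. Both the left leg of a composite and the
orbifold property of its apex depend on this. -/
theorem IsStrictPullback.fst_isSubmersiveWeakEquivalence {𝒢 ℋ 𝒦 𝒬 : LieGroupoid.{u}}
    {φ : LieFunctor 𝒢 𝒦} {ψ : LieFunctor ℋ 𝒦} {p : LieFunctor 𝒬 𝒢} {q : LieFunctor 𝒬 ℋ}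
    (h : IsStrictPullback φ ψ p q) (hψ : ψ.IsSubmersiveWeakEquivalence) :
    p.IsSubmersiveWeakEquivalence := by
  refine .of_fullyFaithful (.mk (fun x x' k hs ht => ?_) (fun g g' hs ht e => ?_)
    fun Z k h1 h2 h3 => ?_) (h.obj.symm.surjective_snd hψ.surjective)
    (hψ.submersion.baseChange φ.smooth_obj h.obj.symm)
  · obtain ⟨l, hl1, hl2, hl3⟩ := hψ.fullyFaithful.exists_lift (x := q.obj x) (x' := q.obj x')
      (h := φ.arr k) (by rw [φ.src_arr, hs, h.obj.comm]) (by rw [φ.tgt_arr, ht, h.obj.comm])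
    obtain ⟨g, ⟨rfl, rfl⟩, -⟩ := h.arr.existsUnique k l hl3.symm
    refine ⟨g, h.obj.ext ?_ ?_, h.obj.ext ?_ ?_, rfl⟩
    · rw [← p.src_arr, hs]
    · rw [← q.src_arr, hl1]
    · rw [← p.tgt_arr, ht]
    · rw [← q.tgt_arr, hl2]
  · refine h.arr.ext e (hψ.fullyFaithful.ext ?_ ?_ ?_)
    · rw [q.src_arr, q.src_arr, hs]
    · rw [q.tgt_arr, q.tgt_arr, ht]
    · rw [← h.arr.comm, ← h.arr.comm, e]
  · refine h.arr.smooth_lift Z k h3 (hψ.fullyFaithful.smooth_of ?_ ?_ ?_)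
    · simp only [q.src_arr]; exact q.smooth_obj.comp h1
    · simp only [q.tgt_arr]; exact q.smooth_obj.comp h2
    · simp only [← h.arr.comm]; exact φ.smooth_arr.comp h3

/-! ### Equivariant functors -/

/-- The map of objects of a functor of action groupoids. -/
abbrev LieFunctor.objX {A B : LieAction.{u}} (φ : LieFunctor A.gpd B.gpd) (x : A.X) : B.X :=
  φ.obj x

theorem LieFunctor.smooth_objX {A B : LieAction.{u}} (φ : LieFunctor A.gpd B.gpd) :
    Smooth φ.objX :=
  φ.smooth_obj

/-- The arrow of an action groupoid given by a group element and a point. -/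
def LieAction.arrow (A : LieAction.{u}) (g : A.G) (x : A.X) : A.gpd.Arr := ((g, x) : A.G × A.X)

/-- The group element of an arrow of an action groupoid. -/
def LieAction.elt (A : LieAction.{u}) (k : A.gpd.Arr) : A.G := Prod.fst (k : A.G × A.X)

/-- The source of an arrow of an action groupoid. -/
def LieAction.source (A : LieAction.{u}) (k : A.gpd.Arr) : A.X := Prod.snd (k : A.G × A.X)

namespace LieAction

variable (A : LieAction.{u})

@[simp] theorem elt_arrow (g : A.G) (x : A.X) : A.elt (A.arrow g x) = g := rfl

theorem src_eq (k : A.gpd.Arr) : A.gpd.src k = A.source k := rfl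

theorem tgt_eq (k : A.gpd.Arr) : A.gpd.tgt k = A.elt k • A.source k := rfl

theorem arr_ext {k l : A.gpd.Arr} (h : A.elt k = A.elt l) (h' : A.source k = A.source l) : k = l :=
  Prod.ext h h'

theorem elt_mul (k l : A.gpd.Arr) (e : A.gpd.src k = A.gpd.tgt l) :
    A.elt (A.gpd.mul k l e) = A.elt k * A.elt l := rfl

theorem source_mul (k l : A.gpd.Arr) (e : A.gpd.src k = A.gpd.tgt l) :
    A.source (A.gpd.mul k l e) = A.source l := rfl

theorem smooth_elt : Smooth A.elt := AnaGpd.smooth_fst A.G A.X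

theorem smooth_source : Smooth A.source := AnaGpd.smooth_snd A.G A.X

theorem smooth_arrow {Z : Mfd.{u}} {g : Z → A.G} {x : Z → A.X} (hg : Smooth g) (hx : Smooth x) :
    Smooth fun z => A.arrow (g z) (x z) :=
  hg.prodMk hx

end LieAction

theorem LieFunctor.source_arr {A B : LieAction.{u}} (φ : LieFunctor A.gpd B.gpd)
    (k : A.gpd.Arr) : B.source (φ.arr k) = φ.objX (A.source k) :=
  φ.src_arr k

namespace IsEquivariant

variable {A B : LieAction.{u}} {φ : LieFunctor A.gpd B.gpd} (hφ : IsEquivariant φ)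

/-- A homomorphism inducing the equivariant functor. -/
def hom : A.G →* B.G := hφ.choose

theorem smooth_hom : Smooth (M := A.G) (N := B.G) hφ.hom := hφ.choose_spec.choose_spec.1

/-- Comparing sources shows that the map `φ₀` of the definition is forced to be the map of objects.
-/
theorem arr_arrow (g : A.G) (x : A.X) :
    φ.arr (A.arrow g x) = B.arrow (hφ.hom g) (φ.objX x) := by
  have h : φ.arr (A.arrow g x) = B.arrow (hφ.hom g) (hφ.choose_spec.choose x) :=
    hφ.choose_spec.choose_spec.2.2 g x
  have h' : φ.objX x = hφ.choose_spec.choose x :=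
    (φ.src_arr (A.arrow g x)).symm.trans (congrArg B.source h)
  rw [h, h']

theorem elt_arr (k : A.gpd.Arr) : B.elt (φ.arr k) = hφ.hom (A.elt k) :=
  congrArg B.elt (hφ.arr_arrow (A.elt k) (A.source k))

theorem map_smul (g : A.G) (x : A.X) : φ.objX (g • x) = hφ.hom g • φ.objX x :=
  (φ.tgt_arr (A.arrow g x)).symm.trans (congrArg B.gpd.tgt (hφ.arr_arrow g x))

/-- The homomorphism of a submersive weak equivalence is a submersion. -/
theorem submersion_hom [Nonempty A.X] (hw : φ.IsSubmersiveWeakEquivalence) :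
    Submersion (M := A.G) (N := B.G) hφ.hom := by
  refine submersion_iff.2 ⟨hφ.smooth_hom, ?_⟩
  -- The group component of `φ.arr` has local sections and factors as `hφ.hom ∘ A.elt`; here `A.elt`
  -- is onto because `A.X` has a point, so `hφ.hom` has local sections too.
  have h1 : HasLocalSections (M := B.G.prod B.X) (N := B.G) Prod.fst := fun p =>
    ⟨Set.univ, fun g => ((g, p.2) : B.G × B.X), isOpen_univ, trivial,
      ((smooth_id _).prodMk (smooth_const _ _ _)).contMDiffOn, rfl, fun _ _ => rfl⟩
  have h2 : HasLocalSections fun k => B.elt (φ.arr k) :=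
    h1.comp hw.submersion_arr.hasLocalSections
  simp only [hφ.elt_arr] at h2
  exact h2.of_comp A.smooth_elt fun g => ⟨A.arrow g (Classical.arbitrary _), rfl⟩

end IsEquivariant

/-! ### Fibred products of actions -/

section PullbackGroup

variable {G H K : Mfd.{u}} [Group G] [Group H] [Group K] [LieGroup G.I ∞ G] [LieGroup H.I ∞ H]
  {f : G →* K} {g : H →* K} (hf : Smooth (M := G) (N := K) f) (hg : Submersion (M := H) (N := K) g)

/-- The group structure on a fibred product of groups. -/
@[reducible] def pullbackGroup : Group (Mfd.pullback f g hf hg) :=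
  inferInstanceAs (Group ((f.comp (MonoidHom.fst G H)).eqLocus (g.comp (MonoidHom.snd G H))))

theorem pullback_lieGroup :
    let _ := pullbackGroup hf hg
    LieGroup (Mfd.pullback f g hf hg).I ∞ (Mfd.pullback f g hf hg) := by
  have h := Mfd.pullback.isFibredProduct hf hg
  let P := Mfd.pullback f g hf hg
  let _ := pullbackGroup hf hg
  refine { contMDiff_mul := ?_, contMDiff_inv := ?_ }
  · refine h.smooth_lift (P.prod P) (fun p => (p.1 * p.2 : P)) ?_ ?_
    · exact ContMDiff.mul (I := G.I) (h.smooth_fst.comp (smooth_fst P P))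
        (h.smooth_fst.comp (smooth_snd P P))
    · exact ContMDiff.mul (I := H.I) (h.smooth_snd.comp (smooth_fst P P))
        (h.smooth_snd.comp (smooth_snd P P))
  · refine h.smooth_lift P (fun p => (p⁻¹ : P)) ?_ ?_
    · exact ContMDiff.inv (I := G.I) h.smooth_fst
    · exact ContMDiff.inv (I := H.I) h.smooth_snd

end PullbackGroup

section PullbackAction

variable {K L H : LieAction.{u}} {ψ : LieFunctor K.gpd H.gpd} {χ : LieFunctor L.gpd H.gpd}
  (hψ : IsEquivariant ψ) (hχ : IsEquivariant χ)
  (hG : Submersion (M := L.G) (N := H.G) hχ.hom) (hX : Submersion χ.objX)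

/-- The componentwise action on a fibred product. -/
@[reducible] def pullbackMulAction :
    letI := pullbackGroup hψ.smooth_hom hG
    MulAction (Mfd.pullback hψ.hom hχ.hom hψ.smooth_hom hG)
      (Mfd.pullback ψ.objX χ.objX ψ.smooth_objX hX) :=
  letI := pullbackGroup hψ.smooth_hom hG
  { smul := fun g x => Mfd.pullback.mk ψ.smooth_objX hX
        (Mfd.pullback.fst hψ.smooth_hom hG g • Mfd.pullback.fst ψ.smooth_objX hX x : K.X)
        (Mfd.pullback.snd hψ.smooth_hom hG g • Mfd.pullback.snd ψ.smooth_objX hX x : L.X) (by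
          rw [hψ.map_smul, hχ.map_smul, Mfd.pullback.comm hψ.smooth_hom hG g,
            Mfd.pullback.comm ψ.smooth_objX hX x])
    one_smul := fun x => Mfd.pullback.ext _ _ (one_smul K.G (_ : K.X)) (one_smul L.G (_ : L.X))
    mul_smul := fun g g' x => Mfd.pullback.ext _ _ (mul_smul (_ : K.G) _ (_ : K.X))
        (mul_smul (_ : L.G) _ (_ : L.X)) }

/-- The fibred product of two actions. -/
def pullbackAction : LieAction.{u} where
  G := Mfd.pullback hψ.hom hχ.hom hψ.smooth_hom hG
  X := Mfd.pullback ψ.objX χ.objX ψ.smooth_objX hX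
  group := pullbackGroup hψ.smooth_hom hG
  lieGroup := pullback_lieGroup hψ.smooth_hom hG
  action := pullbackMulAction hψ hχ hG hX
  smoothAction := by
    have h := Mfd.pullback.isFibredProduct hψ.smooth_hom hG
    have h' := Mfd.pullback.isFibredProduct ψ.smooth_objX hX
    let G := Mfd.pullback hψ.hom hχ.hom hψ.smooth_hom hG
    let X := Mfd.pullback ψ.objX χ.objX ψ.smooth_objX hX
    let _ := pullbackGroup hψ.smooth_hom hG
    let _ := pullbackMulAction hψ hχ hG hX
    refine ⟨h'.smooth_lift (G.prod X) (fun p => (p.1 : G) • (p.2 : X)) ?_ ?_⟩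
    · exact (contMDiff_smul (G := K.G) (M := K.X)).comp ((h.smooth_fst.comp (smooth_fst G X)).prodMk
        (h'.smooth_fst.comp (smooth_snd G X)))
    · exact (contMDiff_smul (G := L.G) (M := L.X)).comp ((h.smooth_snd.comp (smooth_fst G X)).prodMk
        (h'.smooth_snd.comp (smooth_snd G X)))

namespace pullbackAction

/-- The first projection of groups. -/
def fstHom : (pullbackAction hψ hχ hG hX).G →* K.G where
  toFun := Mfd.pullback.fst hψ.smooth_hom hG
  map_one' := rfl
  map_mul' _ _ := rfl

/-- The second projection of groups. -/
def sndHom : (pullbackAction hψ hχ hG hX).G →* L.G where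
  toFun := Mfd.pullback.snd hψ.smooth_hom hG
  map_one' := rfl
  map_mul' _ _ := rfl

/-- The first projection of spaces. -/
def fstX : (pullbackAction hψ hχ hG hX).X → K.X := Mfd.pullback.fst ψ.smooth_objX hX

/-- The second projection of spaces. -/
def sndX : (pullbackAction hψ hχ hG hX).X → L.X := Mfd.pullback.snd ψ.smooth_objX hX

theorem isFibredProduct_G : IsFibredProduct hψ.hom hχ.hom (fstHom hψ hχ hG hX)
    (sndHom hψ hχ hG hX) :=
  Mfd.pullback.isFibredProduct hψ.smooth_hom hG

theorem isFibredProduct_X : IsFibredProduct ψ.objX χ.objX (fstX hψ hχ hG hX) (sndX hψ hχ hG hX) :=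
  Mfd.pullback.isFibredProduct ψ.smooth_objX hX

theorem fstX_smul (g : (pullbackAction hψ hχ hG hX).G) (x : (pullbackAction hψ hχ hG hX).X) :
    fstX hψ hχ hG hX (g • x) = fstHom hψ hχ hG hX g • fstX hψ hχ hG hX x :=
  rfl

theorem sndX_smul (g : (pullbackAction hψ hχ hG hX).G) (x : (pullbackAction hψ hχ hG hX).X) :
    sndX hψ hχ hG hX (g • x) = sndHom hψ hχ hG hX g • sndX hψ hχ hG hX x :=
  rfl

theorem isEmbedding_G : Topology.IsEmbedding (Y := K.G × L.G)
    fun g => (fstHom hψ hχ hG hX g, sndHom hψ hχ hG hX g) :=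
  Mfd.pullback.isEmbedding hψ.smooth_hom hG

theorem isEmbedding_X : Topology.IsEmbedding (Y := K.X × L.X)
    fun x => (fstX hψ hχ hG hX x, sndX hψ hχ hG hX x) :=
  Mfd.pullback.isEmbedding ψ.smooth_objX hX

end pullbackAction

end PullbackAction

/-- The functor of action groupoids given by an equivariant map. -/
def equivariantFunctor {A B : LieAction.{u}} (θ : A.G →* B.G) (f : A.X → B.X)
    (hθ : Smooth (M := A.G) (N := B.G) θ) (hf : Smooth f) (h : ∀ g x, f (g • x) = θ g • f x) :
    LieFunctor A.gpd B.gpd where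
  obj := f
  arr k := B.arrow (θ (A.elt k)) (f (A.source k))
  smooth_obj := hf
  smooth_arr := LieAction.smooth_arrow B (hθ.comp A.smooth_elt) (hf.comp A.smooth_source)
  src_arr _ := rfl
  tgt_arr k := (h (A.elt k) (A.source k)).symm
  map_unit _ := B.arr_ext (map_one θ) rfl
  map_mul k l _ := B.arr_ext (map_mul θ (A.elt k) (A.elt l)) rfl

theorem equivariantFunctor_isEquivariant {A B : LieAction.{u}} {θ : A.G →* B.G} {f : A.X → B.X}
    {hθ : Smooth (M := A.G) (N := B.G) θ} {hf : Smooth f} {h : ∀ g x, f (g • x) = θ g • f x} :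
    IsEquivariant (equivariantFunctor θ f hθ hf h) :=
  ⟨θ, f, hθ, hf, fun _ _ => rfl⟩

theorem IsEquivariant.comp {A B C : LieAction.{u}} {ψ : LieFunctor B.gpd C.gpd}
    {φ : LieFunctor A.gpd B.gpd} (hψ : IsEquivariant ψ) (hφ : IsEquivariant φ) :
    IsEquivariant (ψ.comp φ) :=
  ⟨hψ.hom.comp hφ.hom, fun x => ψ.objX (φ.objX x), hψ.smooth_hom.comp hφ.smooth_hom,
    ψ.smooth_objX.comp φ.smooth_objX, fun g x =>
      (congrArg ψ.arr (hφ.arr_arrow g x)).trans (hψ.arr_arrow _ _)⟩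

section PullbackAction

variable {K L H : LieAction.{u}} {ψ : LieFunctor K.gpd H.gpd} {χ : LieFunctor L.gpd H.gpd}
  (hψ : IsEquivariant ψ) (hχ : IsEquivariant χ)
  (hG : Submersion (M := L.G) (N := H.G) hχ.hom) (hX : Submersion χ.objX)

namespace pullbackAction

/-- The first projection of a fibred product of actions. -/
def fst : LieFunctor (pullbackAction hψ hχ hG hX).gpd K.gpd :=
  equivariantFunctor (fstHom hψ hχ hG hX) (fstX hψ hχ hG hX)
    (isFibredProduct_G hψ hχ hG hX).smooth_fst (isFibredProduct_X hψ hχ hG hX).smooth_fst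
    (fstX_smul hψ hχ hG hX)

/-- The second projection of a fibred product of actions. -/
def snd : LieFunctor (pullbackAction hψ hχ hG hX).gpd L.gpd :=
  equivariantFunctor (sndHom hψ hχ hG hX) (sndX hψ hχ hG hX)
    (isFibredProduct_G hψ hχ hG hX).smooth_snd (isFibredProduct_X hψ hχ hG hX).smooth_snd
    (sndX_smul hψ hχ hG hX)

/-- Equivariant functors act separately on group elements and on points, so the fibred product of
the arrow spaces is the product of the two fibred products. -/
theorem isStrictPullback : IsStrictPullback ψ χ (fst hψ hχ hG hX) (snd hψ hχ hG hX) where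
  obj := isFibredProduct_X hψ hχ hG hX
  arr := by
    have h := isFibredProduct_G hψ hχ hG hX
    have h' := isFibredProduct_X hψ hχ hG hX
    refine ⟨(fst hψ hχ hG hX).smooth_arr, (snd hψ hχ hG hX).smooth_arr, fun q => ?_,
      fun k l e => ?_, fun Z q h1 h2 => ?_⟩
    · refine H.arr_ext ?_ ?_
      · rw [hψ.elt_arr, hχ.elt_arr]
        exact h.comm _
      · rw [ψ.source_arr, χ.source_arr]
        exact h'.comm _
    · have e1 := congrArg H.elt e
      have e2 := congrArg H.source e
      rw [hψ.elt_arr, hχ.elt_arr] at e1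
      rw [ψ.source_arr, χ.source_arr] at e2
      obtain ⟨g, ⟨hg1, hg2⟩, -⟩ := h.existsUnique _ _ e1
      obtain ⟨x, ⟨hx1, hx2⟩, -⟩ := h'.existsUnique _ _ e2
      refine ⟨(pullbackAction hψ hχ hG hX).arrow g x, ⟨K.arr_ext hg1 hx1, L.arr_ext hg2 hx2⟩,
        fun q hq => LieAction.arr_ext _ (h.ext ?_ ?_) (h'.ext ?_ ?_)⟩
      · exact (congrArg K.elt hq.1).trans hg1.symm
      · exact (congrArg L.elt hq.2).trans hg2.symm
      · exact (congrArg K.source hq.1).trans hx1.symm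
      · exact (congrArg L.source hq.2).trans hx2.symm
    · exact LieAction.smooth_arrow (pullbackAction hψ hχ hG hX)
        (g := fun z => LieAction.elt _ (q z)) (x := fun z => LieAction.source _ (q z))
        (h.smooth_lift Z _ (K.smooth_elt.comp h1) (L.smooth_elt.comp h2))
        (h'.smooth_lift Z _ (K.smooth_source.comp h1) (L.smooth_source.comp h2))

end pullbackAction

end PullbackAction

/-- The image is the locus `f m = g n`, which is closed because `B` is Hausdorff. -/
theorem IsFibredProduct.isClosedEmbedding {M N B Q : Mfd.{u}} {f : M → B} {g : N → B} {p : Q → M}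
    {q : Q → N} (h : IsFibredProduct f g p q) (hf : Smooth f) (hg : Smooth g)
    (he : Topology.IsEmbedding fun z => (p z, q z)) :
    Topology.IsClosedEmbedding fun z => (p z, q z) := by
  refine ⟨he, ?_⟩
  have : Set.range (fun z => (p z, q z)) = {z : M × N | f z.1 = g z.2} := by
    ext ⟨m, n⟩
    constructor
    · rintro ⟨z, hz⟩
      obtain ⟨rfl, rfl⟩ := Prod.mk.inj hz
      exact h.comm z
    · intro e
      obtain ⟨z, ⟨h1, h2⟩, -⟩ := h.existsUnique m n e
      exact ⟨z, Prod.ext h1 h2⟩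
  rw [this]
  exact isClosed_eq (hf.continuous.comp continuous_fst) (hg.continuous.comp continuous_snd)

/-- A groupoid that embeds in the product of two proper ones as a closed subspace, compatibly with
a pair of functors, is proper. -/
theorem LieGroupoid.IsProper.of_isClosedEmbedding {𝒬 𝒦 ℒ : LieGroupoid.{u}} (h𝒦 : 𝒦.IsProper)
    (hℒ : ℒ.IsProper) (p : LieFunctor 𝒬 𝒦) (q : LieFunctor 𝒬 ℒ)
    (h : Topology.IsClosedEmbedding fun a => (p.arr a, q.arr a)) : 𝒬.IsProper := by
  refine isProperMap_iff_ultrafilter_of_t2.2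
    ⟨𝒬.smooth_src.continuous.prodMk 𝒬.smooth_tgt.continuous, ?_⟩
  rintro 𝒰 ⟨x, x'⟩ hx
  have hs : Filter.Tendsto 𝒬.src 𝒰 (𝓝 x) := (continuous_fst.tendsto (x, x')).comp hx
  have ht : Filter.Tendsto 𝒬.tgt 𝒰 (𝓝 x') := (continuous_snd.tendsto (x, x')).comp hx
  -- Properness of the two factors makes the images of the ultrafilter converge. The pair of limits
  -- lies in the closed image, and convergence is pulled back along the embedding.
  have key : ∀ (ℳ : LieGroupoid.{u}) (_ : ℳ.IsProper) (r : LieFunctor 𝒬 ℳ),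
      ∃ k, Filter.Tendsto r.arr 𝒰 (𝓝 k) := by
    intro ℳ hℳ r
    have h1 : Filter.Tendsto (fun g => (ℳ.src g, ℳ.tgt g)) (𝒰.map r.arr)
        (𝓝 (r.obj x, r.obj x')) := by
      rw [Ultrafilter.coe_map, Filter.tendsto_map'_iff]
      have h2 := ((r.smooth_obj.continuous.tendsto x).comp hs).prodMk_nhds
        ((r.smooth_obj.continuous.tendsto x').comp ht)
      refine h2.congr fun g => ?_
      simp only [Function.comp_apply, r.src_arr, r.tgt_arr]
    obtain ⟨k, -, hk⟩ := hℳ.ultrafilter_le_nhds_of_tendsto h1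
    exact ⟨k, hk⟩
  obtain ⟨k, hk⟩ := key _ h𝒦 p
  obtain ⟨l, hl⟩ := key _ hℒ q
  have hkl := hk.prodMk_nhds hl
  obtain ⟨a, ha⟩ : (k, l) ∈ Set.range fun a => (p.arr a, q.arr a) :=
    h.isClosed_range.mem_of_tendsto hkl (Filter.Eventually.of_forall fun a => ⟨a, rfl⟩)
  refine ⟨a, ?_⟩
  rw [← ha] at hkl
  rw [h.isEmbedding.nhds_eq_comap]
  exact hkl.le_comap

/-! ### Inheritance of the prescribed properties -/

section

variable {K L H : LieAction.{u}} {ψ : LieFunctor K.gpd H.gpd} {χ : LieFunctor L.gpd H.gpd}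
  (hψ : IsEquivariant ψ) (hχ : IsEquivariant χ)
  (hG : Submersion (M := L.G) (N := H.G) hχ.hom)

/-- Together with `IsEquivariant.smul_unique`, this is full faithfulness read on group elements:
existence here, uniqueness there. -/
theorem IsEquivariant.exists_smul (hw : χ.FullyFaithful) {y y' : L.X} {a : H.G}
    (h : a • χ.objX y = χ.objX y') : ∃ g : L.G, g • y = y' ∧ hχ.hom g = a := by
  obtain ⟨l, hl, hl', hl''⟩ := hw.exists_lift (x := y) (x' := y') (h := H.arrow a (χ.objX y)) rfl h
  refine ⟨L.elt l, ?_, ?_⟩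
  · rw [← hl', L.tgt_eq, ← L.src_eq, hl]
  · rw [← hχ.elt_arr, hl'', H.elt_arrow]

theorem IsEquivariant.smul_unique (hw : χ.FullyFaithful) {y : L.X} {g g' : L.G}
    (h : g • y = g' • y) (h' : hχ.hom g = hχ.hom g') : g = g' := by
  have : L.arrow g y = L.arrow g' y := by
    refine hw.ext rfl h ?_
    rw [hχ.arr_arrow, hχ.arr_arrow, h']
  exact congrArg L.elt this

/-- The fibred product of two actions along a submersive weak equivalence inherits the properties
that both actions have. -/
theorem pullbackAction.has [Nonempty K.X] (hw : χ.IsSubmersiveWeakEquivalence)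
    (hX : Submersion χ.objX) (p : ActionProperty)
    (hK : K.Has p) (hL : L.Has p) : (pullbackAction hψ hχ hG hX).Has p := by
  have hGp := isFibredProduct_G hψ hχ hG hX
  have hXp := isFibredProduct_X hψ hχ hG hX
  have hsurj := hXp.symm.surjective_snd hw.surjective
  cases p with
  | free =>
    intro g x e
    refine hGp.ext ((hK _ _ (congrArg (fstX hψ hχ hG hX) e)).trans (map_one _).symm)
      ((hL _ _ (congrArg (sndX hψ hχ hG hX) e)).trans (map_one _).symm)
  | locallyFree =>
    obtain ⟨U, hU, hU'⟩ := hK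
    obtain ⟨V, hV, hV'⟩ := hL
    refine ⟨fstHom hψ hχ hG hX ⁻¹' U ∩ sndHom hψ hχ hG hX ⁻¹' V,
      Filter.inter_mem (hGp.smooth_fst.continuous.continuousAt.preimage_mem_nhds ?_)
        (hGp.smooth_snd.continuous.continuousAt.preimage_mem_nhds ?_), fun g hg x e => ?_⟩
    · rwa [map_one]
    · rwa [map_one]
    · refine hGp.ext ((hU' _ hg.1 _ (congrArg (fstX hψ hχ hG hX) e)).trans (map_one _).symm)
        ((hV' _ hg.2 _ (congrArg (sndX hψ hχ hG hX) e)).trans (map_one _).symm)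
  | transitive =>
    intro x x'
    obtain ⟨k, hk⟩ := hK (fstX hψ hχ hG hX x) (fstX hψ hχ hG hX x')
    -- Once `k` moves the first component, `hψ.hom k` moves the image of the second, and full
    -- faithfulness of `χ` lifts this motion to `L`.
    have e : hψ.hom k • χ.objX (sndX hψ hχ hG hX x) =
        χ.objX (sndX hψ hχ hG hX x') := by
      rw [← hXp.comm, ← hXp.comm, ← hψ.map_smul, hk]
    obtain ⟨l, hl, hl'⟩ := hχ.exists_smul hw.fullyFaithful e
    obtain ⟨g, ⟨hg, hg'⟩, -⟩ := hGp.existsUnique k l hl'.symm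
    refine ⟨g, hXp.ext ?_ ?_⟩
    · rw [fstX_smul, hg, hk]
    · rw [sndX_smul, hg', hl]
  | effective =>
    intro g hg
    by_contra! hfix
    -- The pullback maps onto `K.X`, so the first component fixes all of `K.X` and is `1`. The
    -- second then lies over `1` and fixes a point, so it is `1` by full faithfulness.
    have h1 : fstHom hψ hχ hG hX g = 1 := by
      by_contra h
      obtain ⟨x, hx⟩ := hK _ h
      obtain ⟨z, rfl⟩ := hsurj x
      exact hx (congrArg (fstX hψ hχ hG hX) (hfix z))
    obtain ⟨z, -⟩ := hsurj (Classical.arbitrary _)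
    refine hg (hGp.ext (h1.trans (map_one _).symm) ?_)
    rw [map_one]
    refine hχ.smul_unique hw.fullyFaithful (y := sndX hψ hχ hG hX z) ?_ ?_
    · rw [one_smul, ← sndX_smul, hfix]
    · rw [← hGp.comm, h1, map_one, map_one]
  | compact =>
    have : CompactSpace K.G := hK
    have : CompactSpace L.G := hL
    exact (hGp.isClosedEmbedding hψ.smooth_hom hχ.smooth_hom
      (isEmbedding_G hψ hχ hG hX)).compactSpace
  | discrete =>
    have : DiscreteTopology K.G := hK
    have : DiscreteTopology L.G := hL
    exact (isEmbedding_G hψ hχ hG hX).discreteTopology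
  | proper =>
    refine LieGroupoid.IsProper.of_isClosedEmbedding hK hL (fst hψ hχ hG hX)
      (snd hψ hχ hG hX) ((isStrictPullback hψ hχ hG hX).arr.isClosedEmbedding
        ψ.smooth_arr χ.smooth_arr ?_)
    exact (Homeomorph.prodProdProdComm K.G L.G K.X L.X).isEmbedding.comp
      ((isEmbedding_G hψ hχ hG hX).prodMap (isEmbedding_X hψ hχ hG hX))
  | orbifold =>
    exact ((isStrictPullback hψ hχ hG hX).fst_isSubmersiveWeakEquivalence hw).isOrbifold
      hK

end

/-! ### The action of the trivial group on the empty space -/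

/-- The point. -/
def Mfd.point : Mfd.{u} :=
  letI : ChartedSpace PUnit.{1} PUnit.{u + 1} := ChartedSpace.ofDiscreteTopology
  { carrier := PUnit.{u + 1}
    E := PUnit
    H := PUnit
    I := 𝓘(ℝ, PUnit)
    manifold := IsManifold.of_discreteTopology _ }

/-- The empty manifold. -/
def Mfd.empty : Mfd.{u} :=
  letI : ChartedSpace PUnit.{1} PEmpty.{u + 1} := ChartedSpace.ofDiscreteTopology
  { carrier := PEmpty.{u + 1}
    E := PUnit
    H := PUnit
    I := 𝓘(ℝ, PUnit)
    manifold := IsManifold.of_discreteTopology _ }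

theorem smooth_of_isEmpty {M N : Mfd.{u}} [IsEmpty M] (f : M → N) : Smooth f :=
  fun x => isEmptyElim x

/-- The action of the trivial group on the empty space. -/
def emptyAction : LieAction.{u} where
  G := Mfd.point
  X := Mfd.empty
  group := inferInstanceAs (Group PUnit)
  lieGroup :=
    let _ : Group Mfd.point.{u} := inferInstanceAs (Group PUnit)
    { contMDiff_mul := smooth_const (Mfd.point.prod Mfd.point) Mfd.point PUnit.unit
      contMDiff_inv := smooth_const Mfd.point Mfd.point PUnit.unit }
  action :=
    letI : Group Mfd.point.{u} := inferInstanceAs (Group PUnit)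
    { smul := fun _ x => x
      one_smul := fun _ => rfl
      mul_smul := fun _ _ _ => rfl }
  smoothAction :=
    let _ : Group Mfd.point.{u} := inferInstanceAs (Group PUnit)
    let _ : SMul Mfd.point.{u} Mfd.empty.{u} := ⟨fun _ x => x⟩
    ⟨smooth_snd Mfd.point Mfd.empty⟩

instance : IsEmpty emptyAction.{u}.X := inferInstanceAs (IsEmpty PEmpty)

instance : IsEmpty emptyAction.{u}.gpd.Obj := inferInstanceAs (IsEmpty PEmpty)

instance : IsEmpty emptyAction.{u}.gpd.Arr := ⟨fun k => isEmptyElim (emptyAction.source k)⟩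

instance : Subsingleton emptyAction.{u}.G := inferInstanceAs (Subsingleton PUnit)

theorem LieAction.isEmpty_arr (A : LieAction.{u}) [IsEmpty A.X] : IsEmpty A.gpd.Arr :=
  ⟨fun k => isEmptyElim (A.source k)⟩

/-- The group is a point and the space has none, so all conditions are trivial; the groupoid is
itself proper and étale. This lets one action serve as empty apex for every `P`. -/
theorem emptyAction_has (p : ActionProperty) : emptyAction.{u}.Has p := by
  have hproper : emptyAction.{u}.gpd.IsProper := isProperMap_iff_ultrafilter_of_t2.2
    ⟨(smooth_of_isEmpty (N := emptyAction.gpd.Obj.prod emptyAction.gpd.Obj) _).continuous,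
      fun _ y _ => isEmptyElim y.1⟩
  cases p with
  | free => exact fun g _ _ => Subsingleton.elim g 1
  | locallyFree => exact ⟨_, Filter.univ_mem, fun g _ _ _ => Subsingleton.elim g 1⟩
  | transitive => exact fun x => isEmptyElim x
  | effective => exact fun g hg => absurd (Subsingleton.elim g 1) hg
  | compact => exact inferInstanceAs (CompactSpace PUnit)
  | discrete => exact inferInstanceAs (DiscreteTopology PUnit)
  | proper => exact hproper
  | orbifold =>
    refine ⟨emptyAction.gpd, hproper, fun k => isEmptyElim k, emptyAction.gpd, .id _, .id _, ?_, ?_⟩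
    · exact (LieFunctor.id_isSubmersiveWeakEquivalence _).weakEquivalence
    · exact (LieFunctor.id_isSubmersiveWeakEquivalence _).weakEquivalence

/-- The unique functor on the empty groupoid. -/
def emptyFunctor (A : LieAction.{u}) : LieFunctor emptyAction.gpd A.gpd :=
  equivariantFunctor 1 (fun x => isEmptyElim x) (smooth_const _ _ 1) (smooth_of_isEmpty _)
    (fun _ x => isEmptyElim x)

theorem emptyFunctor_isSubmersiveWeakEquivalence (A : LieAction.{u}) [IsEmpty A.X] :
    (emptyFunctor A).IsSubmersiveWeakEquivalence := by
  refine .of_fullyFaithful (.mk (fun x => isEmptyElim x) (fun k => isEmptyElim k)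
    fun Z k _ _ _ z => isEmptyElim (k z)) (fun x => isEmptyElim (show A.X from x)) ?_
  exact submersion_iff.2 ⟨smooth_of_isEmpty _, fun x => isEmptyElim x⟩

theorem empty_isFibredProduct {M N B Q : Mfd.{u}} [IsEmpty M] [IsEmpty Q] (f : M → B) (g : N → B)
    (p : Q → M) (q : Q → N) : IsFibredProduct f g p q where
  smooth_fst := smooth_of_isEmpty _
  smooth_snd := smooth_of_isEmpty _
  comm z := isEmptyElim z
  existsUnique m := isEmptyElim m
  smooth_lift _ k _ _ z := isEmptyElim (k z)

/-! ### Composition of anafunctors -/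

/-- When the apex of `S` is empty, `pullbackAction` may be unavailable: the homomorphism of `T.left`
need not be a submersion, and effectiveness may be lost, since only the trivial group acts
effectively on the empty space. But then the strict pullback is the empty groupoid, presented by
`emptyAction`. -/
theorem PAnafunctor.exists_isComposite {A B C : ActGpd.{u} P} (S : PAnafunctor A B)
    (T : PAnafunctor B C) : ∃ (R : PAnafunctor A C) (fst : LieFunctor R.apex.gpd S.apex.gpd)
      (snd : LieFunctor R.apex.gpd T.apex.gpd), IsComposite S T R fst snd := by
  rcases isEmpty_or_nonempty S.apex.action.X with hS | hS
  · have hA : IsEmpty A.action.X := by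
      refine ⟨fun x => ?_⟩
      obtain ⟨y, -⟩ := S.left_weakEquivalence.surjective x
      exact hS.elim y
    let E : ActGpd.{u} P := ⟨emptyAction, fun p _ => emptyAction_has p⟩
    let p : LieFunctor E.gpd S.apex.gpd := emptyFunctor S.apex.action
    let q : LieFunctor E.gpd T.apex.gpd := emptyFunctor T.apex.action
    have hp : IsEquivariant p := equivariantFunctor_isEquivariant
    have hq : IsEquivariant q := equivariantFunctor_isEquivariant
    have hw : (S.left.comp p).IsSubmersiveWeakEquivalence :=
      S.left_weakEquivalence.comp (emptyFunctor_isSubmersiveWeakEquivalence _)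
    have : IsEmpty S.apex.gpd.Obj := hS
    have : IsEmpty S.apex.gpd.Arr := S.apex.action.isEmpty_arr
    have : IsEmpty E.gpd.Obj := inferInstanceAs (IsEmpty emptyAction.gpd.Obj)
    have : IsEmpty E.gpd.Arr := inferInstanceAs (IsEmpty emptyAction.gpd.Arr)
    exact ⟨⟨E, S.left.comp p, T.right.comp q, S.left_equivariant.comp hp,
      T.right_equivariant.comp hq, hw⟩, p, q, hp, hq,
      ⟨empty_isFibredProduct _ _ _ _, empty_isFibredProduct _ _ _ _⟩, rfl, rfl⟩
  · have hψ := S.right_equivariant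
    have hχ := T.left_equivariant
    have hw := T.left_weakEquivalence
    have : Nonempty T.apex.action.X := by
      obtain ⟨y, -⟩ := hw.surjective (S.right.objX hS.some)
      exact ⟨y⟩
    have hG := hχ.submersion_hom hw
    let Q : ActGpd.{u} P := ⟨pullbackAction hψ hχ hG hw.submersion, fun p hp =>
      pullbackAction.has hψ hχ hG hw hw.submersion p (S.apex.has p hp) (T.apex.has p hp)⟩
    let p : LieFunctor Q.gpd S.apex.gpd := pullbackAction.fst hψ hχ hG hw.submersion
    let q : LieFunctor Q.gpd T.apex.gpd := pullbackAction.snd hψ hχ hG hw.submersion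
    have hp : IsEquivariant p := equivariantFunctor_isEquivariant
    have hq : IsEquivariant q := equivariantFunctor_isEquivariant
    have hpb : IsStrictPullback S.right T.left p q :=
      pullbackAction.isStrictPullback hψ hχ hG hw.submersion
    exact ⟨⟨Q, S.left.comp p, T.right.comp q, S.left_equivariant.comp hp,
      T.right_equivariant.comp hq,
      S.left_weakEquivalence.comp (hpb.fst_isSubmersiveWeakEquivalence hw)⟩, p, q, hp, hq, hpb,
      rfl, rfl⟩

/-! ### Anafunctors in terms of group elements -/

namespace PAnafunctor

variable {A B C D E : ActGpd.{u} P} (S : PAnafunctor A B)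

/-- The space of the apex. -/
abbrev X : Mfd.{u} := S.apex.action.X

/-- The group of the apex. -/
abbrev G : Mfd.{u} := S.apex.action.G

/-- The left leg on points. -/
def lX (y : S.X) : A.action.X := S.left.objX y

/-- The right leg on points. -/
def rX (y : S.X) : B.action.X := S.right.objX y

/-- The left leg on group elements. -/
def lG : S.G →* A.action.G := S.left_equivariant.hom

/-- The right leg on group elements. -/
def rG : S.G →* B.action.G := S.right_equivariant.hom

theorem lX_smul (g : S.G) (y : S.X) : S.lX (g • y) = S.lG g • S.lX y :=
  S.left_equivariant.map_smul g y

theorem rX_smul (g : S.G) (y : S.X) : S.rX (g • y) = S.rG g • S.rX y :=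
  S.right_equivariant.map_smul g y

theorem smooth_lX : Smooth S.lX := S.left.smooth_objX

theorem smooth_rX : Smooth S.rX := S.right.smooth_objX

theorem smooth_rG : Smooth (M := S.G) (N := B.action.G) S.rG := S.right_equivariant.smooth_hom

theorem lX_surjective : Function.Surjective S.lX := S.left_weakEquivalence.surjective

theorem submersion_lX : Submersion S.lX := S.left_weakEquivalence.submersion

variable {S}

theorem exists_smul {y y' : S.X} {a : A.action.G} (h : a • S.lX y = S.lX y') :
    ∃ g : S.G, g • y = y' ∧ S.lG g = a :=
  S.left_equivariant.exists_smul S.left_weakEquivalence.fullyFaithful h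

theorem smul_unique {y : S.X} {g g' : S.G} (h : g • y = g' • y) (h' : S.lG g = S.lG g') :
    g = g' :=
  S.left_equivariant.smul_unique S.left_weakEquivalence.fullyFaithful h h'

/-- Surjectivity of the left leg on points supplies a target for an arrow over `a` starting at `y`.
Without a point the homomorphism need not be onto. -/
theorem exists_lG (y : S.X) (a : A.action.G) : ∃ g : S.G, S.lG g = a := by
  obtain ⟨y', hy'⟩ := S.lX_surjective (a • S.lX y)
  obtain ⟨g, -, hg⟩ := exists_smul hy'.symm
  exact ⟨g, hg⟩

/-- The arrows `g z : y z ⟶ y' z` have smooth ends and smooth image, so they vary smoothly by full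
faithfulness. This is why elements picked by choice, as in `lift`, are smooth. -/
theorem smooth_of_smul {Z : Mfd.{u}} {g : Z → S.G} {y y' : Z → S.X} (hy : Smooth y)
    (hy' : Smooth y') (h : ∀ z, g z • y z = y' z) (hg : Smooth fun z => S.lG (g z)) :
    Smooth g := by
  have h1 : Smooth fun z => S.apex.action.arrow (g z) (y z) := by
    refine S.left_weakEquivalence.fullyFaithful.smooth_of hy ?_ ?_
    · have : (fun z => S.apex.gpd.tgt (S.apex.action.arrow (g z) (y z))) = y' := funext h
      rw [this]
      exact hy'
    · have : (fun z => S.left.arr (S.apex.action.arrow (g z) (y z))) = fun z =>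
          A.action.arrow (S.lG (g z)) (S.lX (y z)) :=
        funext fun z => S.left_equivariant.arr_arrow _ _
      rw [this]
      exact A.action.smooth_arrow hg (S.smooth_lX.comp hy)
  exact S.apex.action.smooth_elt.comp h1

variable (S)

/-- The group element over `a` that moves `y` to `y'`. -/
def lift (y y' : S.X) (a : A.action.G) (h : a • S.lX y = S.lX y') : S.G := (exists_smul h).choose

theorem lift_smul (y y' : S.X) (a : A.action.G) (h : a • S.lX y = S.lX y') :
    S.lift y y' a h • y = y' :=
  (exists_smul h).choose_spec.1

theorem lG_lift (y y' : S.X) (a : A.action.G) (h : a • S.lX y = S.lX y') :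
    S.lG (S.lift y y' a h) = a :=
  (exists_smul h).choose_spec.2

variable {S}

theorem eq_lift {y y' : S.X} {a : A.action.G} (h : a • S.lX y = S.lX y') {g : S.G} (hg : g • y = y')
    (hg' : S.lG g = a) : S.lift y y' a h = g :=
  smul_unique (y := y) (by rw [lift_smul, hg]) (by rw [lG_lift, hg'])

theorem smooth_lift {Z : Mfd.{u}} {y y' : Z → S.X} {a : Z → A.action.G} (hy : Smooth y)
    (hy' : Smooth y') (ha : Smooth a) (h : ∀ z, a z • S.lX (y z) = S.lX (y' z)) :
    Smooth fun z => S.lift (y z) (y' z) (a z) (h z) :=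
  smooth_of_smul hy hy' (fun z => S.lift_smul _ _ _ _) (by simpa only [lG_lift] using ha)

/-! ### Composition -/

variable (T : PAnafunctor B C) (U : PAnafunctor C D)

variable (S) in
/-- The composite of anafunctors. -/
def comp : PAnafunctor A C := (S.exists_isComposite T).choose

variable (S) in
/-- The first projection of the composite. -/
def fst : LieFunctor (S.comp T).apex.gpd S.apex.gpd := (S.exists_isComposite T).choose_spec.choose

variable (S) in
/-- The second projection of the composite. -/
def snd : LieFunctor (S.comp T).apex.gpd T.apex.gpd :=
  (S.exists_isComposite T).choose_spec.choose_spec.choose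

theorem isComposite_comp : IsComposite S T (S.comp T) (S.fst T) (S.snd T) :=
  (S.exists_isComposite T).choose_spec.choose_spec.choose_spec

variable (S) in
/-- The first projection of the composite on points. -/
def fstX (q : (S.comp T).X) : S.X := (S.fst T).objX q

variable (S) in
/-- The second projection of the composite on points. -/
def sndX (q : (S.comp T).X) : T.X := (S.snd T).objX q

variable (S) in
/-- The first projection of the composite on group elements. -/
def fstG : (S.comp T).G →* S.G := (isComposite_comp (S := S) T).fst_equivariant.hom

variable (S) in
/-- The second projection of the composite on group elements. -/
def sndG : (S.comp T).G →* T.G := (isComposite_comp (S := S) T).snd_equivariant.hom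

variable {T}

theorem fstX_smul (g : (S.comp T).G) (q : (S.comp T).X) :
    S.fstX T (g • q) = S.fstG T g • S.fstX T q :=
  (isComposite_comp T).fst_equivariant.map_smul g q

theorem sndX_smul (g : (S.comp T).G) (q : (S.comp T).X) :
    S.sndX T (g • q) = S.sndG T g • S.sndX T q :=
  (isComposite_comp T).snd_equivariant.map_smul g q

theorem smooth_fstX : Smooth (S.fstX T) := (S.fst T).smooth_objX

theorem smooth_sndX : Smooth (S.sndX T) := (S.snd T).smooth_objX

theorem comp_lX (q : (S.comp T).X) : (S.comp T).lX q = S.lX (S.fstX T q) :=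
  congrFun (congrArg LieFunctor.obj (isComposite_comp T).left_eq) q

theorem comp_rX (q : (S.comp T).X) : (S.comp T).rX q = T.rX (S.sndX T q) :=
  congrFun (congrArg LieFunctor.obj (isComposite_comp T).right_eq) q

theorem rX_fstX (q : (S.comp T).X) : S.rX (S.fstX T q) = T.lX (S.sndX T q) :=
  (isComposite_comp T).isStrictPullback.obj.comm q

/-- The homomorphism of an equivariant functor is a chosen one, and equal functors determine it only
through actual arrows; hence the point `q`. -/
theorem comp_lG (q : (S.comp T).X) (g : (S.comp T).G) : (S.comp T).lG g = S.lG (S.fstG T g) := by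
  have h := congrArg A.action.elt (congrFun (congrArg LieFunctor.arr
    (isComposite_comp T).left_eq) ((S.comp T).apex.action.arrow g q))
  rw [(S.comp T).left_equivariant.elt_arr] at h
  refine h.trans ((S.left_equivariant.elt_arr _).trans (congrArg _ ?_))
  exact (isComposite_comp T).fst_equivariant.elt_arr _

theorem comp_rG (q : (S.comp T).X) (g : (S.comp T).G) : (S.comp T).rG g = T.rG (S.sndG T g) := by
  have h := congrArg C.action.elt (congrFun (congrArg LieFunctor.arr
    (isComposite_comp T).right_eq) ((S.comp T).apex.action.arrow g q))
  rw [(S.comp T).right_equivariant.elt_arr] at h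
  refine h.trans ((T.right_equivariant.elt_arr _).trans (congrArg _ ?_))
  exact (isComposite_comp T).snd_equivariant.elt_arr _

theorem rG_fstG (q : (S.comp T).X) (g : (S.comp T).G) : S.rG (S.fstG T g) = T.lG (S.sndG T g) := by
  have h := congrArg B.action.elt ((isComposite_comp (S := S) T).isStrictPullback.arr.comm
    ((S.comp T).apex.action.arrow g q))
  rw [S.right_equivariant.elt_arr, T.left_equivariant.elt_arr,
    (isComposite_comp T).fst_equivariant.elt_arr, (isComposite_comp T).snd_equivariant.elt_arr] at h
  exact h

theorem comp_ext {q q' : (S.comp T).X} (h : S.fstX T q = S.fstX T q')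
    (h' : S.sndX T q = S.sndX T q') : q = q' :=
  (isComposite_comp T).isStrictPullback.obj.ext h h'

theorem exists_comp_smul (q : (S.comp T).X) {k : S.G} {l : T.G} (h : S.rG k = T.lG l) :
    ∃ g : (S.comp T).G, S.fstG T g = k ∧ S.sndG T g = l := by
  have hc := isComposite_comp (S := S) T
  have e : S.right.arr (S.apex.action.arrow k (S.fstX T q)) =
      T.left.arr (T.apex.action.arrow l (S.sndX T q)) := by
    rw [S.right_equivariant.arr_arrow, T.left_equivariant.arr_arrow]
    exact B.action.arr_ext h (rX_fstX q)
  obtain ⟨g, ⟨h1, h2⟩, -⟩ := hc.isStrictPullback.arr.existsUnique _ _ e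
  exact ⟨_, (hc.fst_equivariant.elt_arr g).symm.trans (congrArg _ h1),
    (hc.snd_equivariant.elt_arr g).symm.trans (congrArg _ h2)⟩

/-- A point of the composite. -/
def pair (y : S.X) (t : T.X) (h : S.rX y = T.lX t) : (S.comp T).X :=
  ((isComposite_comp (S := S) T).isStrictPullback.obj.existsUnique y t h).choose

@[simp] theorem fstX_pair (y : S.X) (t : T.X) (h : S.rX y = T.lX t) : S.fstX T (pair y t h) = y :=
  ((isComposite_comp T).isStrictPullback.obj.existsUnique y t h).choose_spec.1.1

@[simp] theorem sndX_pair (y : S.X) (t : T.X) (h : S.rX y = T.lX t) : S.sndX T (pair y t h) = t :=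
  ((isComposite_comp T).isStrictPullback.obj.existsUnique y t h).choose_spec.1.2

theorem smooth_pair {Z : Mfd.{u}} {y : Z → S.X} {t : Z → T.X} (hy : Smooth y) (ht : Smooth t)
    (h : ∀ z, S.rX (y z) = T.lX (t z)) : Smooth fun z => pair (y z) (t z) (h z) := by
  refine (isComposite_comp (S := S) T).isStrictPullback.obj.smooth_lift Z _ ?_ ?_
  · have : (fun z => (S.fst T).obj (pair (y z) (t z) (h z))) = y := funext fun z => fstX_pair _ _ _
    rw [this]
    exact hy
  · have : (fun z => (S.snd T).obj (pair (y z) (t z) (h z))) = t := funext fun z => sndX_pair _ _ _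
    rw [this]
    exact ht

end PAnafunctor

/-! ### Two-cells in terms of group elements -/

namespace TwoCell

open PAnafunctor

variable {A B C D E : ActGpd.{u} P} {S T U V : PAnafunctor A B}

/-- The value of a `2`-cell as a group element. -/
def val (η : TwoCell S T) (y : S.X) (z : T.X) (h : S.lX y = T.lX z) : B.action.G :=
  B.action.elt (η.app y z h)

theorem app_eq (η : TwoCell S T) (y : S.X) (z : T.X) (h : S.lX y = T.lX z) :
    η.app y z h = B.action.arrow (η.val y z h) (S.rX y) :=
  B.action.arr_ext rfl (η.src_app y z h)

theorem val_smul (η : TwoCell S T) (y : S.X) (z : T.X) (h : S.lX y = T.lX z) :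
    η.val y z h • S.rX y = T.rX z := by
  have h1 := η.tgt_app y z h
  rw [app_eq] at h1
  exact h1

theorem val_congr (η : TwoCell S T) {y y' : S.X} {z z' : T.X} (h : S.lX y = T.lX z) (hy : y = y')
    (hz : z = z') : η.val y z h = η.val y' z' (by rw [← hy, ← hz, h]) := by
  subst hy hz
  rfl

theorem smooth_val (η : TwoCell S T) : SmoothOnFibredProduct S.lX T.lX η.val :=
  fun Z a b ha hb h => B.action.smooth_elt.comp (η.smooth Z a b ha hb h)

theorem val_naturality (η : TwoCell S T) {y : S.X} {z : T.X} (h : S.lX y = T.lX z) {k : S.G}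
    {l : T.G} (hkl : S.lG k = T.lG l) (h' : S.lX (k • y) = T.lX (l • z)) :
    η.val (k • y) (l • z) h' * S.rG k = T.rG l * η.val y z h := by
  have e : S.left.arr (S.apex.action.arrow k y) = T.left.arr (T.apex.action.arrow l z) := by
    rw [S.left_equivariant.arr_arrow, T.left_equivariant.arr_arrow]
    exact A.action.arr_ext hkl h
  have h1 := congrArg B.action.elt (η.naturality _ _ e)
  rw [B.action.elt_mul, B.action.elt_mul, T.right_equivariant.elt_arr,
    S.right_equivariant.elt_arr] at h1
  exact h1.symm

theorem ext_val {η θ : TwoCell S T} (H : ∀ y z h, η.val y z h = θ.val y z h) : η = θ := by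
  refine TwoCell.ext (funext fun y => funext fun z => funext fun h => ?_)
  exact (η.app_eq y z h).trans ((congrArg (fun g => B.action.arrow g (S.rX y)) (H y z h)).trans
    (θ.app_eq y z h).symm)

/-- Two-cells given by group-valued functions. -/
def ofVal (v : ∀ (y : S.X) (z : T.X), S.lX y = T.lX z → B.action.G)
    (smul : ∀ y z h, v y z h • S.rX y = T.rX z)
    (nat : ∀ (y : S.X) (z : T.X) (h : S.lX y = T.lX z) (k : S.G) (l : T.G) (_ : S.lG k = T.lG l)
      (h' : S.lX (k • y) = T.lX (l • z)), v (k • y) (l • z) h' * S.rG k = T.rG l * v y z h)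
    (smooth : SmoothOnFibredProduct S.lX T.lX v) : TwoCell S T where
  app y z h := B.action.arrow (v y z h) (S.rX y)
  src_app _ _ _ := rfl
  tgt_app := smul
  naturality k l e := by
    have e1 : S.lG (S.apex.action.elt k) = T.lG (T.apex.action.elt l) := by
      have := congrArg A.action.elt e
      rwa [S.left_equivariant.elt_arr, T.left_equivariant.elt_arr] at this
    have e2 : S.lX (S.apex.action.source k) = T.lX (T.apex.action.source l) := by
      have := congrArg A.action.source e
      rwa [S.left.source_arr, T.left.source_arr] at this
    refine B.action.arr_ext ?_ ?_
    · rw [B.action.elt_mul, B.action.elt_mul, T.right_equivariant.elt_arr,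
        S.right_equivariant.elt_arr]
      exact (nat _ _ e2 _ _ e1 _).symm
    · rw [B.action.source_mul, B.action.source_mul]
      exact (S.right.source_arr k).symm
  smooth Z a b ha hb h := B.action.smooth_arrow (smooth Z a b ha hb h) (S.smooth_rX.comp ha)

/-- Moving the target point of a `2`-cell along a vertical arrow. -/
theorem val_smul_right (η : TwoCell S T) {y : S.X} {z : T.X} (h : S.lX y = T.lX z) {l : T.G}
    (hl : T.lG l = 1) (h' : S.lX y = T.lX (l • z)) :
    η.val y (l • z) h' = T.rG l * η.val y z h := by
  have := η.val_naturality h (k := 1) (l := l) (by rw [map_one, hl]) (by rw [one_smul, h'])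
  rw [map_one, mul_one] at this
  rw [← this]
  exact η.val_congr _ (one_smul _ y).symm rfl

/-- Moving the source point of a `2`-cell along a vertical arrow. -/
theorem val_smul_left (η : TwoCell S T) {y : S.X} {z : T.X} (h : S.lX y = T.lX z) {k : S.G}
    (hk : S.lG k = 1) (h' : S.lX (k • y) = T.lX z) :
    η.val (k • y) z h' * S.rG k = η.val y z h := by
  have := η.val_naturality h (k := k) (l := 1) (by rw [map_one, hk]) (by rw [one_smul, h'])
  rw [map_one, one_mul] at this
  rw [← this]
  exact congrArg (· * S.rG k) (η.val_congr _ rfl (one_smul _ z).symm)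

/-- Any two points of `T.X` over the same point differ by an element over `1`, along which
naturality transports the value. Laws may therefore be tested at one convenient `z` for each `y`. -/
theorem ext_exists {η θ : TwoCell S T}
    (H : ∀ y, ∃ (z : T.X) (h : S.lX y = T.lX z), η.val y z h = θ.val y z h) : η = θ := by
  refine ext_val fun y z' h' => ?_
  obtain ⟨z, h, e⟩ := H y
  obtain ⟨l, rfl, hl⟩ := exists_smul (S := T) (y := z) (y' := z') (a := 1)
    (by rw [one_smul, ← h, h'])
  rw [η.val_smul_right h hl, θ.val_smul_right h hl, e]

/-! ### Vertical composition -/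

/-- The two intermediate points differ by some `l` over `1`; replacing `t` by `l • t` multiplies one
factor by `T.rG l` and the other by its inverse. -/
theorem val_mul_val (η : TwoCell S T) (θ : TwoCell T U) {y : S.X} {t t' : T.X} {w : U.X}
    (h1 : S.lX y = T.lX t) (h2 : T.lX t = U.lX w) (h1' : S.lX y = T.lX t')
    (h2' : T.lX t' = U.lX w) :
    θ.val t w h2 * η.val y t h1 = θ.val t' w h2' * η.val y t' h1' := by
  obtain ⟨l, rfl, hl⟩ := exists_smul (S := T) (y := t) (y' := t') (a := 1)
    (by rw [one_smul, ← h1, h1'])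
  rw [η.val_smul_right h1 hl, ← mul_assoc, θ.val_smul_left h2 hl]

/-- Vertical composition of `2`-cells. -/
def comp (η : TwoCell S T) (θ : TwoCell T U) : TwoCell S U :=
  have key : ∀ y, ∃ t, T.lX t = S.lX y := fun y => T.lX_surjective (S.lX y)
  ofVal (fun y w h => θ.val (key y).choose w ((key y).choose_spec.trans h) *
      η.val y (key y).choose (key y).choose_spec.symm)
    (fun y w h => by rw [mul_smul, val_smul, val_smul])
    (fun y w h k m hkm h' => by
      -- The intermediate point chosen over `k • y` may be exchanged for `l •` the one chosen over
      -- `y`, so that naturality of both factors applies.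
      obtain ⟨l, hl⟩ := exists_lG (key y).choose (S.lG k)
      have e1 : S.lX (k • y) = T.lX (l • (key y).choose) := by
        rw [lX_smul, lX_smul, hl, (key y).choose_spec]
      rw [val_mul_val η θ _ _ e1 (e1.symm.trans h'), mul_assoc,
        η.val_naturality (key y).choose_spec.symm hl.symm, ← mul_assoc,
        θ.val_naturality ((key y).choose_spec.trans h) (hl.trans hkm), mul_assoc])
    (fun Z a b ha hb h => by
      -- Intermediate points taken by choice need not vary smoothly; on the cover `Z'` they can be
      -- chosen to do so, without changing the product.
      obtain ⟨Z', π, t, hπ, ht, e, hd⟩ := exists_cover (S.smooth_lX.comp ha) T.submersion_lX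
        T.lX_surjective
      refine hd _ _ ?_
      have h1 := θ.smooth_val Z' t (fun z => b (π z)) ht (hb.comp hπ)
        fun z => (e z).trans (h (π z))
      have h2 := η.smooth_val Z' (fun z => a (π z)) t (ha.comp hπ) ht fun z => (e z).symm
      refine (ContMDiff.mul (I := B.action.G.I) h1 h2).congr fun z => ?_
      exact val_mul_val η θ _ _ _ _)

theorem comp_val (η : TwoCell S T) (θ : TwoCell T U) {y : S.X} (t : T.X) {w : U.X}
    (h : S.lX y = U.lX w) (h1 : S.lX y = T.lX t) (h2 : T.lX t = U.lX w) :
    (η.comp θ).val y w h = θ.val t w h2 * η.val y t h1 :=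
  val_mul_val η θ _ _ _ _

/-! ### Induced two-cells -/

/-- A map between the apices of two anafunctors that underlies a functor compatible with both
legs. -/
structure ApexMap (S T : PAnafunctor A B) where
  toFun : S.X → T.X
  smooth : Smooth toFun
  lX : ∀ y, T.lX (toFun y) = S.lX y
  rX : ∀ y, T.rX (toFun y) = S.rX y
  exists_smul : ∀ (k : S.G) (y : S.X), ∃ l : T.G, toFun (k • y) = l • toFun y ∧
    T.lG l = S.lG k ∧ T.rG l = S.rG k

/-- The `2`-cell induced by a map of apices. -/
def induced (f : ApexMap S T) : TwoCell S T :=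
  ofVal (fun y z h => T.rG (T.lift (f.toFun y) z 1 (by rw [one_smul, f.lX, h])))
    (fun y z h => by rw [← f.rX, ← rX_smul, lift_smul])
    (fun y z h k l hkl h' => by
      obtain ⟨k', h1, h2, h3⟩ := f.exists_smul k y
      rw [← h3, ← map_mul, ← map_mul]
      congr 1
      -- Both sides are elements of `T.G` over the same element of `A.action.G`, moving the same
      -- point to the same point.
      refine smul_unique (y := f.toFun y) ?_ ?_
      · rw [mul_smul, ← h1, lift_smul, mul_smul, lift_smul]
      · rw [map_mul, map_mul, lG_lift, lG_lift, h2, hkl, one_mul, mul_one])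
    (fun Z a b ha hb h => T.smooth_rG.comp (smooth_lift (f.smooth.comp ha) hb
      (smooth_const _ _ 1) _))

theorem induced_val (f : ApexMap S T) {y : S.X} {z : T.X} (h : S.lX y = T.lX z) {l : T.G}
    (h1 : l • f.toFun y = z) (h2 : T.lG l = 1) : (induced f).val y z h = T.rG l :=
  congrArg T.rG (eq_lift _ h1 h2)

/-- Over the graph of `f` the element to be lifted is `1`. The coherence laws are checked there. -/
theorem induced_val_eq_one (f : ApexMap S T) {y : S.X} {z : T.X} (h : S.lX y = T.lX z)
    (h1 : f.toFun y = z) : (induced f).val y z h = 1 :=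
  (induced_val f h (l := 1) (by rw [one_smul, h1]) (map_one _)).trans (map_one _)

/-- The inverse of the `2`-cell induced by a map of apices. -/
def inducedInv (f : ApexMap S T) : TwoCell T S :=
  ofVal (fun z y h => T.rG (T.lift z (f.toFun y) 1 (by rw [one_smul, f.lX, h])))
    (fun y z h => by rw [← f.rX, ← rX_smul, lift_smul])
    (fun z y h l k hkl h' => by
      obtain ⟨k', h1, h2, h3⟩ := f.exists_smul k y
      rw [← h3, ← map_mul, ← map_mul]
      congr 1
      refine smul_unique (y := z) ?_ ?_
      · rw [mul_smul, lift_smul, mul_smul, lift_smul, h1]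
      · rw [map_mul, map_mul, lG_lift, lG_lift, h2, hkl, one_mul, mul_one])
    (fun Z a b ha hb h => T.smooth_rG.comp (smooth_lift ha (f.smooth.comp hb)
      (smooth_const _ _ 1) _))

theorem inducedInv_val_eq_one (f : ApexMap S T) {y : S.X} {z : T.X} (h : T.lX z = S.lX y)
    (h1 : f.toFun y = z) : (inducedInv f).val z y h = 1 := by
  subst h1
  exact (congrArg T.rG (eq_lift _ (one_smul _ _) (map_one _))).trans (map_one _)

variable (S) in
/-- The identity map of the apex. -/
def ApexMap.id : ApexMap S S :=
  ⟨fun y => y, smooth_id _, fun _ => rfl, fun _ => rfl, fun k _ => ⟨k, rfl, rfl, rfl⟩⟩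

variable (S) in
/-- The identity `2`-cell. -/
def id : TwoCell S S := induced (ApexMap.id S)

theorem id_val_self (y : S.X) : (id S).val y y rfl = 1 := induced_val_eq_one _ _ rfl

theorem id_comp (η : TwoCell S T) : (id S).comp η = η := by
  refine ext_val fun y z h => ?_
  rw [comp_val _ _ y h rfl h, id_val_self, mul_one]

theorem comp_id (η : TwoCell S T) : η.comp (id T) = η := by
  refine ext_val fun y z h => ?_
  rw [comp_val _ _ z h h rfl, id_val_self, one_mul]

theorem comp_assoc (η : TwoCell S T) (θ : TwoCell T U) (ι : TwoCell U V) :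
    (η.comp θ).comp ι = η.comp (θ.comp ι) := by
  refine ext_val fun y z h => ?_
  obtain ⟨t, ht⟩ := T.lX_surjective (S.lX y)
  obtain ⟨w, hw⟩ := U.lX_surjective (S.lX y)
  rw [comp_val _ _ w h hw.symm (hw.trans h), comp_val _ _ t hw.symm ht.symm (ht.trans hw.symm),
    comp_val _ _ t h ht.symm (ht.trans h), comp_val _ _ w (ht.trans h) (ht.trans hw.symm)
      (hw.trans h), mul_assoc]

theorem induced_comp_inv (f : ApexMap S T) : (induced f).comp (inducedInv f) = id S := by
  refine ext_exists fun y => ⟨y, rfl, ?_⟩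
  rw [comp_val _ _ (f.toFun y) rfl (f.lX y).symm (f.lX y), id_val_self,
    inducedInv_val_eq_one _ _ rfl, induced_val_eq_one _ _ rfl, mul_one]

theorem inv_comp_induced (f : ApexMap S T) : (inducedInv f).comp (induced f) = id T := by
  refine ext_val fun z z' h => ?_
  obtain ⟨y, hy⟩ := S.lX_surjective (T.lX z)
  have e1 : (1 : A.action.G) • T.lX z = T.lX (f.toFun y) := by rw [one_smul, f.lX, hy]
  have e2 : (1 : A.action.G) • T.lX (f.toFun y) = T.lX z' := by rw [one_smul, f.lX, hy, h]
  rw [comp_val _ _ y h hy.symm (hy.trans h)]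
  change T.rG (T.lift (f.toFun y) z' 1 e2) * T.rG (T.lift z (f.toFun y) 1 e1) = _
  rw [← map_mul]
  refine (induced_val _ h ?_ ?_).symm
  · exact (mul_smul _ _ z).trans (by rw [lift_smul, lift_smul])
  · rw [map_mul, lG_lift, lG_lift, mul_one]

end TwoCell

instance (A B : ActGpd.{u} P) : Category.{u} (PAnafunctor A B) where
  Hom := TwoCell
  id := TwoCell.id
  comp := TwoCell.comp
  id_comp := TwoCell.id_comp
  comp_id := TwoCell.comp_id
  assoc := TwoCell.comp_assoc

/-- The invertible `2`-cell induced by a map of apices. -/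
def TwoCell.inducedIso {A B : ActGpd.{u} P} {S T : PAnafunctor A B} (f : TwoCell.ApexMap S T) :
    S ≅ T where
  hom := TwoCell.induced f
  inv := TwoCell.inducedInv f
  hom_inv_id := TwoCell.induced_comp_inv f
  inv_hom_id := TwoCell.inv_comp_induced f

namespace TwoCell

open PAnafunctor

/-! ### Whiskering -/

section Whisker

variable {A B C D E : ActGpd.{u} P}

theorem lX_fstX_eq {S S' : PAnafunctor A B} {T T' : PAnafunctor B C} {q : (S.comp T).X}
    {q' : (S'.comp T').X} (h : (S.comp T).lX q = (S'.comp T').lX q') :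
    S.lX (S.fstX T q) = S'.lX (S'.fstX T' q') := by
  rw [← comp_lX, h, comp_lX]

section Right

variable {S S' : PAnafunctor A B} (η : TwoCell S S') (T : PAnafunctor B C)

theorem whiskerRight_aux (q : (S.comp T).X) (q' : (S'.comp T).X)
    (h : (S.comp T).lX q = (S'.comp T).lX q') :
    η.val (S.fstX T q) (S'.fstX T q') (lX_fstX_eq h) • T.lX (S.sndX T q) =
      T.lX (S'.sndX T q') := by
  rw [← rX_fstX, val_smul, rX_fstX]

/-- Whiskering of a `2`-cell with an anafunctor on its target. -/
def whiskerRight : TwoCell (S.comp T) (S'.comp T) :=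
  ofVal (fun q q' h => T.rG (T.lift (S.sndX T q) (S'.sndX T q') _ (whiskerRight_aux η T q q' h)))
    (fun q q' h => by rw [comp_rX, comp_rX, ← rX_smul, lift_smul])
    (fun q q' h k l hkl h' => by
      rw [comp_lG q, comp_lG q'] at hkl
      rw [comp_rG q, comp_rG q', ← map_mul, ← map_mul]
      congr 1
      refine smul_unique (y := S.sndX T q) ?_ ?_
      · rw [mul_smul, ← sndX_smul, lift_smul, mul_smul, lift_smul, sndX_smul]
      · rw [map_mul, map_mul, lG_lift, lG_lift, ← rG_fstG q, ← rG_fstG q',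
          ← η.val_naturality (lX_fstX_eq h) hkl
            (by rw [← fstX_smul, ← fstX_smul]; exact lX_fstX_eq h')]
        congr 1
        exact η.val_congr _ (fstX_smul k q) (fstX_smul l q'))
    (fun Z a b ha hb h => T.smooth_rG.comp (smooth_lift (smooth_sndX.comp ha) (smooth_sndX.comp hb)
      (η.smooth_val Z _ _ (smooth_fstX.comp ha) (smooth_fstX.comp hb) _) _))

theorem whiskerRight_val {q : (S.comp T).X} {q' : (S'.comp T).X}
    (h : (S.comp T).lX q = (S'.comp T).lX q') {l : T.G} (h1 : l • S.sndX T q = S'.sndX T q')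
    (h2 : T.lG l = η.val (S.fstX T q) (S'.fstX T q') (lX_fstX_eq h)) :
    (η.whiskerRight T).val q q' h = T.rG l :=
  congrArg T.rG (eq_lift _ h1 h2)

end Right

section Left

variable (S : PAnafunctor A B) {T T' : PAnafunctor B C} (θ : TwoCell T T')

/-- The element `l' * l⁻¹` lies over `1`, so moving the source point by it does not change the
product. Left whiskering is thereby independent of the chosen lift. -/
theorem val_mul_rG {y : T.X} {z : T'.X} {l l' : T.G} (h : T.lX (l • y) = T'.lX z)
    (h' : T.lX (l' • y) = T'.lX z) (hl : T.lG l = T.lG l') :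
    θ.val (l • y) z h * T.rG l = θ.val (l' • y) z h' * T.rG l' := by
  have e : l' * l⁻¹ * l = l' := by group
  have e' : T.lG (l' * l⁻¹) = 1 := by rw [map_mul, map_inv, hl, mul_inv_cancel]
  have e2 : l' • y = (l' * l⁻¹) • l • y := by rw [← mul_smul, e]
  rw [← θ.val_smul_left h e' (by rw [← e2, h']), mul_assoc, ← map_mul, e]
  exact congrArg (· * T.rG l') (θ.val_congr _ e2.symm rfl)

theorem whiskerLeft_aux {q : (S.comp T).X} {q' : (S.comp T').X} {k : S.G} {l : T.G}
    (hk : k • S.fstX T q = S.fstX T' q') (hl : T.lG l = S.rG k) :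
    T.lX (l • S.sndX T q) = T'.lX (S.sndX T' q') := by
  rw [lX_smul, hl, ← rX_fstX, ← rX_smul, hk, rX_fstX]

theorem one_smul_lX_fstX {q : (S.comp T).X} {q' : (S.comp T').X}
    (h : (S.comp T).lX q = (S.comp T').lX q') :
    (1 : A.action.G) • S.lX (S.fstX T q) = S.lX (S.fstX T' q') := by
  rw [one_smul, lX_fstX_eq h]

/-- Whiskering of a `2`-cell with an anafunctor on its source. -/
def whiskerLeft : TwoCell (S.comp T) (S.comp T') :=
  ofVal (fun q q' h =>
      θ.val ((exists_lG (S.sndX T q)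
        (S.rG (S.lift (S.fstX T q) (S.fstX T' q') 1 (one_smul_lX_fstX S h)))).choose • S.sndX T q)
        (S.sndX T' q') (whiskerLeft_aux S (lift_smul ..) (exists_lG (S.sndX T q) _).choose_spec) *
      T.rG (exists_lG (S.sndX T q)
        (S.rG (S.lift (S.fstX T q) (S.fstX T' q') 1 (one_smul_lX_fstX S h)))).choose)
    (fun q q' h => by
      rw [comp_rX, comp_rX, mul_smul, ← rX_smul, val_smul])
    (fun q q' h k k' hkl h' => by
      rw [comp_rG q, comp_rG q']
      set v := S.lift (S.fstX T q) (S.fstX T' q') 1 (one_smul_lX_fstX S h)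
      set v' := S.lift (S.fstX T (k • q)) (S.fstX T' (k' • q')) 1 (one_smul_lX_fstX S h')
      have hl := (exists_lG (S.sndX T q) (S.rG v)).choose_spec
      have hl' := (exists_lG (S.sndX T (k • q)) (S.rG v')).choose_spec
      set l := (exists_lG (S.sndX T q) (S.rG v)).choose
      set l' := (exists_lG (S.sndX T (k • q)) (S.rG v')).choose
      rw [comp_lG q, comp_lG q'] at hkl
      have hvk : v' * S.fstG T k = S.fstG T' k' * v := by
        refine smul_unique (y := S.fstX T q) ?_ ?_
        · rw [mul_smul, ← fstX_smul, lift_smul, mul_smul, lift_smul, fstX_smul]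
        · rw [map_mul, map_mul, lG_lift, lG_lift, hkl, one_mul, mul_one]
      -- The lift `l'` chosen at `k • q` has the same image under `T.lG` as `m * l * (S.sndG T
      -- k)⁻¹`, and `val_mul_rG` allows the exchange. What remains is naturality of `θ` for `m` and
      -- `S.sndG T' k'`.
      obtain ⟨m, hm⟩ := exists_lG (S.sndX T q) (S.rG (S.fstG T' k'))
      have e1 : T.lG l' = T.lG (m * l * (S.sndG T k)⁻¹) := by
        rw [map_mul, map_mul, map_inv, ← rG_fstG q, hm, hl', hl, ← map_mul, ← map_inv, ← map_mul,
          ← hvk, mul_inv_cancel_right]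
      have e2 : (m * l * (S.sndG T k)⁻¹) • S.sndX T (k • q) = m • l • S.sndX T q := by
        rw [sndX_smul, mul_smul, inv_smul_smul, mul_smul]
      have h1 : T.lX (l • S.sndX T q) = T'.lX (S.sndX T' q') :=
        whiskerLeft_aux S (lift_smul ..) hl
      have h2 : T.lX (m • l • S.sndX T q) = T'.lX (S.sndG T' k' • S.sndX T' q') := by
        rw [lX_smul, h1, lX_smul, hm, rG_fstG q']
      rw [θ.val_mul_rG (l' := m * l * (S.sndG T k)⁻¹) _ (by rw [e2, h2, sndX_smul]) e1, mul_assoc,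
        ← map_mul, inv_mul_cancel_right, map_mul, ← mul_assoc, ← mul_assoc,
        ← θ.val_naturality h1 (hm.trans (rG_fstG q' k')) h2]
      exact congrArg (· * T.rG m * T.rG l) (θ.val_congr _ e2 (sndX_smul _ _)))
    (fun Z a b ha hb h => by
      have hv : Smooth fun z => S.lift (S.fstX T (a z)) (S.fstX T' (b z)) 1
          (one_smul_lX_fstX S (h z)) :=
        smooth_lift (smooth_fstX.comp ha) (smooth_fstX.comp hb) (smooth_const _ _ 1) _
      have hb' : Smooth fun z => T'.lX (S.sndX T' (b z)) :=
        T'.smooth_lX.comp (smooth_sndX.comp hb)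
      -- The lift `l` is arbitrary among those over a given element. On a cover its end point is
      -- prescribed by a smooth `t`, which makes it a smooth `lift`.
      obtain ⟨Z', π, t, hπ, ht, e, hd⟩ := exists_cover hb' T.submersion_lX T.lX_surjective
      refine hd _ _ ?_
      have e' : ∀ z, S.rG (S.lift (S.fstX T (a (π z))) (S.fstX T' (b (π z))) 1
          (one_smul_lX_fstX S (h (π z)))) • T.lX (S.sndX T (a (π z))) = T.lX (t z) := fun z => by
        rw [e, ← rX_fstX, ← rX_fstX, ← rX_smul, lift_smul]
      have hl := smooth_lift (smooth_sndX.comp (ha.comp hπ)) ht (S.smooth_rG.comp (hv.comp hπ)) e'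
      have h1 := θ.smooth_val Z' t (fun z => S.sndX T' (b (π z))) ht
        (smooth_sndX.comp (hb.comp hπ)) e
      refine (ContMDiff.mul (I := C.action.G.I) h1 (T.smooth_rG.comp hl)).congr fun z => ?_
      refine (θ.val_mul_rG (l' := T.lift _ _ _ (e' z)) _ (by rw [lift_smul, e])
        ((exists_lG (S.sndX T (a (π z))) _).choose_spec.trans (lG_lift ..).symm)).trans ?_
      exact congrArg (· * T.rG (T.lift _ _ _ (e' z))) (θ.val_congr _ (lift_smul ..) rfl))

theorem whiskerLeft_val {q : (S.comp T).X} {q' : (S.comp T').X}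
    (h : (S.comp T).lX q = (S.comp T').lX q') {k : S.G} {l : T.G}
    (h1 : k • S.fstX T q = S.fstX T' q') (h2 : S.lG k = 1) (h3 : T.lG l = S.rG k)
    (h4 : T.lX (l • S.sndX T q) = T'.lX (S.sndX T' q')) :
    (θ.whiskerLeft S).val q q' h = θ.val (l • S.sndX T q) (S.sndX T' q') h4 * T.rG l := by
  refine θ.val_mul_rG _ _ ((exists_lG (S.sndX T q) _).choose_spec.trans ?_)
  exact (congrArg S.rG (eq_lift _ h1 h2)).trans h3.symm

/-- When the first components agree, both the element over `1` and its lift may be taken to be `1`.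
Most laws on left whiskering are tested at such points. -/
theorem whiskerLeft_val_of_fstX_eq {q : (S.comp T).X} {q' : (S.comp T').X}
    (h : (S.comp T).lX q = (S.comp T').lX q') (h1 : S.fstX T q = S.fstX T' q')
    (h2 : T.lX (S.sndX T q) = T'.lX (S.sndX T' q')) :
    (θ.whiskerLeft S).val q q' h = θ.val (S.sndX T q) (S.sndX T' q') h2 := by
  rw [θ.whiskerLeft_val S h (k := 1) (l := 1) (by rw [one_smul, h1]) (map_one _)
    (by rw [map_one, map_one]) (by rw [one_smul, h2]), map_one, mul_one]
  exact θ.val_congr _ (one_smul _ _) rfl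

end Left

/-! ### Associator and unitors -/

theorem id_lG (x : (PAnafunctor.id A).X) (g : (PAnafunctor.id A).G) :
    (PAnafunctor.id A).lG g = g :=
  ((PAnafunctor.id A).left_equivariant.elt_arr (A.action.arrow g x)).symm

theorem id_rG (x : (PAnafunctor.id A).X) (g : (PAnafunctor.id A).G) :
    (PAnafunctor.id A).rG g = g :=
  ((PAnafunctor.id A).right_equivariant.elt_arr (A.action.arrow g x)).symm

variable (S : PAnafunctor A B) (T : PAnafunctor B C) (U : PAnafunctor C D)

/-- The second projection of a composite with an identity on the left. -/
def leftUnitorMap : ApexMap ((PAnafunctor.id A).comp S) S where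
  toFun := (PAnafunctor.id A).sndX S
  smooth := smooth_sndX
  lX q := (rX_fstX q).symm.trans (comp_lX q).symm
  rX q := (comp_rX q).symm
  exists_smul k q := ⟨_, sndX_smul k q, by
    rw [← rG_fstG q, comp_lG q, id_lG ((PAnafunctor.id A).fstX S q),
      id_rG ((PAnafunctor.id A).fstX S q)], (comp_rG q k).symm⟩

/-- The first projection of a composite with an identity on the right. -/
def rightUnitorMap : ApexMap (S.comp (PAnafunctor.id B)) S where
  toFun := S.fstX (PAnafunctor.id B)
  smooth := smooth_fstX
  lX q := (comp_lX q).symm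
  rX q := (rX_fstX q).trans (comp_rX q).symm
  exists_smul k q := ⟨_, fstX_smul k q, (comp_lG q k).symm, by
    rw [rG_fstG q, comp_rG q, id_lG (S.sndX (PAnafunctor.id B) q),
      id_rG (S.sndX (PAnafunctor.id B) q)]⟩

theorem rX_sndX_fstX {S : PAnafunctor A B} {T : PAnafunctor B C} {U : PAnafunctor C D}
    (q : ((S.comp T).comp U).X) :
    T.rX (S.sndX T ((S.comp T).fstX U q)) = U.lX ((S.comp T).sndX U q) :=
  (comp_rX _).symm.trans (rX_fstX q)

/-- The second component of the reassociation of a point of an iterated strict pullback. -/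
def assocSnd (q : ((S.comp T).comp U).X) : (T.comp U).X :=
  pair (S.sndX T ((S.comp T).fstX U q)) ((S.comp T).sndX U q) (rX_sndX_fstX q)

theorem rX_fstX_fstX (q : ((S.comp T).comp U).X) :
    S.rX (S.fstX T ((S.comp T).fstX U q)) = (T.comp U).lX (assocSnd S T U q) :=
  (rX_fstX _).trans ((comp_lX _).trans (congrArg T.lX (fstX_pair _ _ _))).symm

/-- The reassociation of a point of an iterated strict pullback. -/
def assoc (q : ((S.comp T).comp U).X) : (S.comp (T.comp U)).X :=
  pair (S.fstX T ((S.comp T).fstX U q)) (assocSnd S T U q) (rX_fstX_fstX S T U q)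

variable {S T U} in
theorem fstX_assocSnd (q : ((S.comp T).comp U).X) :
    T.fstX U (assocSnd S T U q) = S.sndX T ((S.comp T).fstX U q) :=
  fstX_pair _ _ _

variable {S T U} in
theorem sndX_assocSnd (q : ((S.comp T).comp U).X) :
    T.sndX U (assocSnd S T U q) = (S.comp T).sndX U q :=
  sndX_pair _ _ _

variable {S T U} in
theorem fstX_assoc (q : ((S.comp T).comp U).X) :
    S.fstX (T.comp U) (assoc S T U q) = S.fstX T ((S.comp T).fstX U q) :=
  fstX_pair _ _ _

variable {S T U} in
theorem sndX_assoc (q : ((S.comp T).comp U).X) :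
    S.sndX (T.comp U) (assoc S T U q) = assocSnd S T U q :=
  sndX_pair _ _ _

/-- Reassociation of iterated strict pullbacks. -/
def associatorMap : ApexMap ((S.comp T).comp U) (S.comp (T.comp U)) where
  toFun := assoc S T U
  smooth := smooth_pair (smooth_fstX.comp smooth_fstX)
    (smooth_pair (smooth_sndX.comp smooth_fstX) smooth_sndX _) _
  lX q := by rw [comp_lX, comp_lX, comp_lX, fstX_assoc]
  rX q := by rw [comp_rX, comp_rX, comp_rX, sndX_assoc, sndX_assocSnd]
  exists_smul k q := by
    have e1 : T.rG (S.sndG T ((S.comp T).fstG U k)) = U.lG ((S.comp T).sndG U k) := by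
      rw [← comp_rG ((S.comp T).fstX U q), rG_fstG q]
    -- The group element is reassociated like the points: its last two components are joined to `m`,
    -- and the first is then joined to `m`.
    obtain ⟨m, hm1, hm2⟩ := exists_comp_smul (assocSnd S T U q) e1
    have e2 : S.rG (S.fstG T ((S.comp T).fstG U k)) = (T.comp U).lG m := by
      rw [comp_lG (assocSnd S T U q), hm1, rG_fstG ((S.comp T).fstX U q)]
    obtain ⟨l, hl1, hl2⟩ := exists_comp_smul (assoc S T U q) e2
    refine ⟨l, comp_ext ?_ (comp_ext ?_ ?_), ?_, ?_⟩
    · rw [fstX_assoc, fstX_smul, fstX_smul, fstX_smul, hl1, fstX_assoc]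
    · rw [sndX_assoc, fstX_assocSnd, sndX_smul, fstX_smul, fstX_smul, sndX_smul, hl2, hm1,
        sndX_assoc, fstX_assocSnd]
    · rw [sndX_assoc, sndX_assocSnd, sndX_smul, sndX_smul, sndX_smul, hl2, hm2, sndX_assoc,
        sndX_assocSnd]
    · rw [comp_lG (assoc S T U q), hl1, comp_lG q, comp_lG ((S.comp T).fstX U q)]
    · rw [comp_rG (assoc S T U q), hl2, comp_rG q, comp_rG (assocSnd S T U q), hm2]

end Whisker
end TwoCell

namespace TwoCell

open PAnafunctor

section Laws

variable {A B C D E : ActGpd.{u} P}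

/-! ### Auxiliary evaluations -/

/-- With intermediate points on the graphs of `f` and `g`, both induced factors are `1`. -/
theorem conj_val {S S' T T' : PAnafunctor A B} (f : ApexMap S T) (g : ApexMap S' T')
    (η : TwoCell T T') {y : S.X} {z : S'.X} (h : S.lX y = S'.lX z)
    (h' : T.lX (f.toFun y) = T'.lX (g.toFun z)) :
    ((induced f).comp (η.comp (inducedInv g))).val y z h =
      η.val (f.toFun y) (g.toFun z) h' := by
  rw [comp_val _ _ (f.toFun y) h (f.lX y).symm ((f.lX y).trans h),
    comp_val _ _ (g.toFun z) _ h' (g.lX z), induced_val_eq_one f _ rfl,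
    inducedInv_val_eq_one g _ rfl, one_mul, mul_one]

/-- Here the second components are variables: `val` depends on a proof about them, which hinders
rewriting in place. -/
theorem whiskerLeft_val_eq (S : PAnafunctor A B) {T T' : PAnafunctor B C} (θ : TwoCell T T')
    {q : (S.comp T).X} {q' : (S.comp T').X} (h : (S.comp T).lX q = (S.comp T').lX q')
    (h1 : S.fstX T q = S.fstX T' q') {t : T.X} {t' : T'.X} (ht : S.sndX T q = t)
    (ht' : S.sndX T' q' = t') (h2 : T.lX t = T'.lX t') :
    (θ.whiskerLeft S).val q q' h = θ.val t t' h2 := by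
  subst ht ht'
  exact θ.whiskerLeft_val_of_fstX_eq S h h1 h2

theorem whiskerRight_val_eq_one {S S' : PAnafunctor A B} (η : TwoCell S S')
    (T : PAnafunctor B C) {q : (S.comp T).X} {q' : (S'.comp T).X}
    (h : (S.comp T).lX q = (S'.comp T).lX q') (h1 : S.sndX T q = S'.sndX T q')
    (h2 : η.val (S.fstX T q) (S'.fstX T q') (lX_fstX_eq h) = 1) :
    (η.whiskerRight T).val q q' h = 1 :=
  (η.whiskerRight_val T h (l := 1) (by rw [one_smul, h1]) (by rw [map_one, h2])).trans (map_one _)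

theorem exists_fstX (S : PAnafunctor A B) (T : PAnafunctor B C) (y : S.X) :
    ∃ q : (S.comp T).X, S.fstX T q = y := by
  obtain ⟨t, ht⟩ := T.lX_surjective (S.rX y)
  exact ⟨pair y t ht.symm, fstX_pair _ _ _⟩

theorem lX_eq_of_fstX_eq {S : PAnafunctor A B} {T T' : PAnafunctor B C} {q : (S.comp T).X}
    {q' : (S.comp T').X} (h : S.fstX T q = S.fstX T' q') :
    (S.comp T).lX q = (S.comp T').lX q' := by
  rw [comp_lX, comp_lX, h]

theorem lX_sndX_eq {S : PAnafunctor A B} {T T' : PAnafunctor B C} {q : (S.comp T).X}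
    {q' : (S.comp T').X} (h : S.fstX T q = S.fstX T' q') :
    T.lX (S.sndX T q) = T'.lX (S.sndX T' q') := by
  rw [← rX_fstX, ← rX_fstX, h]

/-! ### Laws of whiskering -/

theorem whiskerLeft_id (S : PAnafunctor A B) (T : PAnafunctor B C) :
    (id T).whiskerLeft S = id (S.comp T) := by
  refine ext_exists fun q => ⟨q, rfl, ?_⟩
  rw [whiskerLeft_val_of_fstX_eq _ _ _ rfl rfl, id_val_self, id_val_self]

theorem id_whiskerRight (S : PAnafunctor A B) (T : PAnafunctor B C) :
    (id S).whiskerRight T = id (S.comp T) := by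
  refine ext_exists fun q => ⟨q, rfl, ?_⟩
  rw [whiskerRight_val_eq_one _ _ _ rfl (id_val_self _), id_val_self]

theorem whiskerLeft_comp (S : PAnafunctor A B) {T T' T'' : PAnafunctor B C} (η : TwoCell T T')
    (θ : TwoCell T' T'') :
    (η.comp θ).whiskerLeft S = (η.whiskerLeft S).comp (θ.whiskerLeft S) := by
  refine ext_exists fun q => ?_
  obtain ⟨q', h⟩ := exists_fstX S T' (S.fstX T q)
  obtain ⟨q'', h'⟩ := exists_fstX S T'' (S.fstX T q)
  have e := h.trans h'.symm
  refine ⟨q'', lX_eq_of_fstX_eq h'.symm, ?_⟩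
  rw [comp_val _ _ q' _ (lX_eq_of_fstX_eq h.symm) (lX_eq_of_fstX_eq e),
    whiskerLeft_val_of_fstX_eq _ _ _ h'.symm (lX_sndX_eq h'.symm),
    whiskerLeft_val_of_fstX_eq _ _ _ h.symm (lX_sndX_eq h.symm),
    whiskerLeft_val_of_fstX_eq _ _ _ e (lX_sndX_eq e),
    comp_val _ _ _ _ (lX_sndX_eq h.symm) (lX_sndX_eq e)]

/-- The product of a lift of the value of `η` and a lift of the value of `θ` is a lift of the value
of the composite. -/
theorem comp_whiskerRight {S S' S'' : PAnafunctor A B} (η : TwoCell S S') (θ : TwoCell S' S'')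
    (T : PAnafunctor B C) :
    (η.comp θ).whiskerRight T = (η.whiskerRight T).comp (θ.whiskerRight T) := by
  refine ext_val fun q q'' h => ?_
  obtain ⟨q', h1⟩ := (S'.comp T).lX_surjective ((S.comp T).lX q)
  have h2 := h1.trans h
  obtain ⟨l, hl, hl'⟩ := exists_smul (whiskerRight_aux η T q q' h1.symm)
  obtain ⟨m, hm, hm'⟩ := exists_smul (whiskerRight_aux θ T q' q'' h2)
  rw [comp_val _ _ q' _ h1.symm h2, whiskerRight_val _ _ _ hl hl', whiskerRight_val _ _ _ hm hm',
    ← map_mul]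
  refine whiskerRight_val _ _ _ (by rw [mul_smul, hl, hm]) ?_
  rw [map_mul, hl', hm']
  exact (comp_val _ _ _ _ _ _).symm

theorem id_whiskerLeft {T T' : PAnafunctor A B} (θ : TwoCell T T') :
    θ.whiskerLeft (PAnafunctor.id A) =
      (induced (leftUnitorMap T)).comp (θ.comp (inducedInv (leftUnitorMap T'))) := by
  refine ext_val fun q q' h => ?_
  -- The left leg of the identity anafunctor is the identity, so points with equal left image have
  -- equal first components.
  have e : (PAnafunctor.id A).fstX T q = (PAnafunctor.id A).fstX T' q' := lX_fstX_eq h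
  rw [conj_val _ _ _ _ (lX_sndX_eq e)]
  exact whiskerLeft_val_of_fstX_eq _ _ _ e _

theorem whiskerRight_id {S S' : PAnafunctor A B} (η : TwoCell S S') :
    η.whiskerRight (PAnafunctor.id B) =
      (induced (rightUnitorMap S)).comp (η.comp (inducedInv (rightUnitorMap S'))) := by
  refine ext_val fun q q' h => ?_
  rw [conj_val _ _ _ _ (lX_fstX_eq h)]
  refine (whiskerRight_val _ _ _ (l := η.val _ _ (lX_fstX_eq h)) ?_
    (id_lG (S.sndX (PAnafunctor.id B) q) _)).trans (id_rG (S.sndX (PAnafunctor.id B) q) _)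
  exact whiskerRight_aux η _ q q' h

theorem comp_whiskerLeft (S : PAnafunctor A B) (T : PAnafunctor B C) {U U' : PAnafunctor C D}
    (θ : TwoCell U U') :
    θ.whiskerLeft (S.comp T) = (induced (associatorMap S T U)).comp
      (((θ.whiskerLeft T).whiskerLeft S).comp (inducedInv (associatorMap S T U'))) := by
  refine ext_exists fun q => ?_
  obtain ⟨q', h⟩ := exists_fstX (S.comp T) U' ((S.comp T).fstX U q)
  have e1 : S.fstX (T.comp U) (assoc S T U q) = S.fstX (T.comp U') (assoc S T U' q') := by
    rw [fstX_assoc, fstX_assoc, h]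
  have e2 : T.fstX U (assocSnd S T U q) = T.fstX U' (assocSnd S T U' q') := by
    rw [fstX_assocSnd, fstX_assocSnd, h]
  refine ⟨q', lX_eq_of_fstX_eq h.symm, ?_⟩
  rw [conj_val _ _ _ _ (lX_eq_of_fstX_eq e1),
    whiskerLeft_val_of_fstX_eq _ _ _ h.symm (lX_sndX_eq h.symm)]
  refine ((whiskerLeft_val_eq _ _ _ e1 (sndX_assoc q) (sndX_assoc q')
    (lX_eq_of_fstX_eq e2)).trans ?_).symm
  exact whiskerLeft_val_eq _ _ _ e2 (sndX_assocSnd q) (sndX_assocSnd q') _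

/-- A lift `l` of the value of `η` to `T`, and a lift `m` of `T.rG l` to `U`, form one element of
the group of `T.comp U` that lifts the value of `η`; both sides equal `U.rG m`. -/
theorem associator_conj_whiskerRight {S S' : PAnafunctor A B} (η : TwoCell S S')
    (T : PAnafunctor B C) (U : PAnafunctor C D) :
    (induced (associatorMap S T U)).comp
      ((η.whiskerRight (T.comp U)).comp (inducedInv (associatorMap S' T U))) =
        (η.whiskerRight T).whiskerRight U := by
  refine ext_val fun q q' h => ?_
  obtain ⟨l, hl, hl'⟩ := exists_smul (whiskerRight_aux η T _ _ (lX_fstX_eq h))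
  obtain ⟨m, hm, hm'⟩ := exists_smul (whiskerRight_aux (η.whiskerRight T) U q q' h)
  have e : T.rG l = U.lG m := by rw [hm', whiskerRight_val _ _ _ hl hl']
  obtain ⟨g, hg, hg'⟩ := exists_comp_smul (assocSnd S T U q) e
  rw [whiskerRight_val _ _ _ hm hm']
  have h' : (S.comp (T.comp U)).lX (assoc S T U q) = (S'.comp (T.comp U)).lX (assoc S' T U q') :=
    ((associatorMap S T U).lX q).trans (h.trans ((associatorMap S' T U).lX q').symm)
  rw [conj_val _ _ _ _ h', ← hg', ← comp_rG (assocSnd S T U q)]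
  refine whiskerRight_val η (T.comp U) (l := g) h' (comp_ext ?_ ?_) ?_
  · rw [fstX_smul, sndX_assoc, sndX_assoc, fstX_assocSnd, fstX_assocSnd, hg, hl]
  · rw [sndX_smul, sndX_assoc, sndX_assoc, sndX_assocSnd, sndX_assocSnd, hg', hm]
  · rw [comp_lG (assocSnd S T U q), hg, hl']
    exact val_congr _ _ (fstX_assoc q).symm (fstX_assoc q').symm

theorem whisker_assoc (S : PAnafunctor A B) {T T' : PAnafunctor B C} (θ : TwoCell T T')
    (U : PAnafunctor C D) :
    (θ.whiskerLeft S).whiskerRight U = (induced (associatorMap S T U)).comp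
      (((θ.whiskerRight U).whiskerLeft S).comp (inducedInv (associatorMap S T' U))) := by
  refine ext_exists fun q => ?_
  -- The test point shares its `S`-component with `q`, so the left whiskerings reduce to values of
  -- `θ` and of `θ.whiskerRight U`.
  obtain ⟨p, hp⟩ := exists_fstX S T' (S.fstX T ((S.comp T).fstX U q))
  obtain ⟨q', rfl⟩ := exists_fstX (S.comp T') U p
  have h : ((S.comp T).comp U).lX q = ((S.comp T').comp U).lX q' := by
    rw [comp_lX, comp_lX q', lX_eq_of_fstX_eq hp.symm]
  have e : S.fstX (T.comp U) (assoc S T U q) = S.fstX (T'.comp U) (assoc S T' U q') := by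
    rw [fstX_assoc, fstX_assoc, hp]
  have e' : (T.comp U).lX (assocSnd S T U q) = (T'.comp U).lX (assocSnd S T' U q') := by
    rw [← rX_fstX_fstX, ← rX_fstX_fstX, hp]
  obtain ⟨m, hm, hm'⟩ := exists_smul (whiskerRight_aux (θ.whiskerLeft S) U q q' h)
  refine ⟨q', h, ?_⟩
  rw [whiskerRight_val _ _ _ hm hm', conj_val _ _ _ _ (lX_eq_of_fstX_eq e)]
  refine ((whiskerLeft_val_eq _ _ _ e (sndX_assoc q) (sndX_assoc q') e').trans ?_).symm
  refine whiskerRight_val _ _ _ (by rw [sndX_assocSnd, sndX_assocSnd, hm]) (hm'.trans ?_)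
  exact whiskerLeft_val_eq _ _ _ hp.symm (fstX_assocSnd q).symm (fstX_assocSnd q').symm _

/-- Take intermediate points sharing their first component with `q` and with `q'`. The left
whiskerings then give values of `θ`, the right ones give lifts `l` and `m` of one value of `η`
through `T` and `T'`, and the law is naturality of `θ` for `(l, m)`. -/
theorem whisker_exchange {S S' : PAnafunctor A B} {T T' : PAnafunctor B C} (η : TwoCell S S')
    (θ : TwoCell T T') :
    (θ.whiskerLeft S).comp (η.whiskerRight T') = (η.whiskerRight T).comp (θ.whiskerLeft S') := by
  refine ext_val fun q q' h => ?_
  obtain ⟨r, hr⟩ := exists_fstX S T' (S.fstX T q)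
  obtain ⟨r', hr'⟩ := exists_fstX S' T (S'.fstX T' q')
  have e1 := lX_eq_of_fstX_eq hr
  have e2 := lX_eq_of_fstX_eq hr'
  obtain ⟨l, hl, hl'⟩ := exists_smul (whiskerRight_aux η T q r' (h.trans e2.symm))
  obtain ⟨m, hm, hm'⟩ := exists_smul (whiskerRight_aux η T' r q' (e1.trans h))
  rw [comp_val _ _ r h e1.symm (e1.trans h), comp_val _ _ r' h (h.trans e2.symm) e2,
    whiskerLeft_val_of_fstX_eq _ _ _ hr.symm (lX_sndX_eq hr.symm),
    whiskerLeft_val_of_fstX_eq _ _ _ hr' (lX_sndX_eq hr'),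
    whiskerRight_val _ _ _ hl hl', whiskerRight_val _ _ _ hm hm',
    ← θ.val_naturality (lX_sndX_eq hr.symm) (k := l) (l := m)
      (hl'.trans ((η.val_congr _ hr.symm hr').trans hm'.symm))
      (by rw [hl, hm]; exact lX_sndX_eq hr')]
  exact congrArg (· * T.rG l) (θ.val_congr _ hl hm)

/-! ### Coherence -/

theorem lX_assoc {S : PAnafunctor A B} {T : PAnafunctor B C} {U : PAnafunctor C D}
    (q : ((S.comp T).comp U).X) :
    (S.comp (T.comp U)).lX (assoc S T U q) = ((S.comp T).comp U).lX q :=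
  (associatorMap S T U).lX q

theorem associator_val_assoc {S : PAnafunctor A B} {T : PAnafunctor B C} {U : PAnafunctor C D}
    {q : ((S.comp T).comp U).X} {q' : (S.comp (T.comp U)).X}
    (h : ((S.comp T).comp U).lX q = (S.comp (T.comp U)).lX q') (e : assoc S T U q = q') :
    (induced (associatorMap S T U)).val q q' h = 1 :=
  induced_val_eq_one _ h e

/-- Both sides are followed along the reassociation maps, on whose graphs every factor is `1`; the
two routes end at the same point `r` because reassociation of points satisfies the pentagon. -/
theorem pentagon (S : PAnafunctor A B) (T : PAnafunctor B C) (U : PAnafunctor C D)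
    (V : PAnafunctor D E) :
    ((induced (associatorMap S T U)).whiskerRight V).comp
      ((induced (associatorMap S (T.comp U) V)).comp
        ((induced (associatorMap T U V)).whiskerLeft S)) =
      (induced (associatorMap (S.comp T) U V)).comp (induced (associatorMap S T (U.comp V))) := by
  refine ext_exists fun q => ?_
  set r := assoc S T (U.comp V) (assoc (S.comp T) U V q)
  have e0 : (S.comp (T.comp U)).rX (assoc S T U (((S.comp T).comp U).fstX V q)) =
      V.lX (((S.comp T).comp U).sndX V q) :=
    ((associatorMap S T U).rX _).trans (rX_fstX q)
  -- The point `q` with its first three factors reassociated, where the whiskered associator takes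
  -- the value `1`.
  set q₁ : ((S.comp (T.comp U)).comp V).X := pair _ _ e0
  have e1 : ((S.comp (T.comp U)).fstX V q₁) = assoc S T U (((S.comp T).comp U).fstX V q) :=
    fstX_pair _ _ _
  have e2 : ((S.comp (T.comp U)).sndX V q₁) = ((S.comp T).comp U).sndX V q := sndX_pair _ _ _
  have h1 : (((S.comp T).comp U).comp V).lX q = ((S.comp (T.comp U)).comp V).lX q₁ := by
    rw [comp_lX, comp_lX q₁, e1]
    exact ((associatorMap S T U).lX _).symm
  have h2 := lX_assoc q₁
  have h3 := lX_assoc q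
  have h4 := lX_assoc (assoc (S.comp T) U V q)
  have hs : S.fstX _ (assoc S (T.comp U) V q₁) = S.fstX _ r := by
    rw [fstX_assoc, e1, fstX_assoc, fstX_assoc, fstX_assoc]
  have ht : assoc T U V (S.sndX ((T.comp U).comp V) (assoc S (T.comp U) V q₁)) =
      S.sndX (T.comp (U.comp V)) r := by
    rw [sndX_assoc, sndX_assoc]
    refine comp_ext ?_ (comp_ext ?_ ?_)
    · rw [fstX_assoc, fstX_assocSnd, e1, sndX_assoc, fstX_assocSnd, fstX_assocSnd, fstX_assoc]
    · rw [sndX_assoc, fstX_assocSnd, fstX_assocSnd, e1, sndX_assoc, sndX_assocSnd, sndX_assocSnd,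
        sndX_assoc, fstX_assocSnd]
    · rw [sndX_assoc, sndX_assocSnd, sndX_assocSnd, e2, sndX_assocSnd, sndX_assoc, sndX_assocSnd]
  refine ⟨r, h3.symm.trans h4.symm, ?_⟩
  have eL : (((induced (associatorMap S T U)).whiskerRight V).comp
      ((induced (associatorMap S (T.comp U) V)).comp
        ((induced (associatorMap T U V)).whiskerLeft S))).val q r (h3.symm.trans h4.symm) = 1 := by
    rw [comp_val _ _ q₁ _ h1 (h1.symm.trans (h3.symm.trans h4.symm)),
      comp_val _ _ (assoc S (T.comp U) V q₁) _ h2.symm (lX_eq_of_fstX_eq hs),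
      whiskerRight_val_eq_one _ _ _ e2.symm (associator_val_assoc _ e1.symm),
      associator_val_assoc _ rfl, whiskerLeft_val_of_fstX_eq _ _ _ hs (lX_sndX_eq hs),
      associator_val_assoc _ ht, mul_one, mul_one]
  rw [eL, comp_val _ _ (assoc (S.comp T) U V q) _ h3.symm h4.symm, associator_val_assoc _ rfl,
    associator_val_assoc _ rfl, mul_one]

/-- Both sides are `1` at the point `r` obtained from `q` by dropping the middle component. -/
theorem triangle (S : PAnafunctor A B) (T : PAnafunctor B C) :
    (induced (associatorMap S (PAnafunctor.id B) T)).comp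
      ((induced (leftUnitorMap T)).whiskerLeft S) =
      (induced (rightUnitorMap S)).whiskerRight T := by
  refine ext_exists fun q => ?_
  have e : S.rX (S.fstX (PAnafunctor.id B) ((S.comp (PAnafunctor.id B)).fstX T q)) =
      T.lX ((S.comp (PAnafunctor.id B)).sndX T q) :=
    (rX_fstX _).trans (rX_sndX_fstX q)
  set r : (S.comp T).X := pair _ _ e
  have e1 : S.fstX T r = S.fstX _ ((S.comp (PAnafunctor.id B)).fstX T q) := fstX_pair _ _ _
  have e2 : S.sndX T r = (S.comp (PAnafunctor.id B)).sndX T q := sndX_pair _ _ _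
  have h := lX_assoc q
  have hs : S.fstX _ (assoc S (PAnafunctor.id B) T q) = S.fstX T r := by rw [fstX_assoc, e1]
  have ht : (leftUnitorMap T).toFun (S.sndX _ (assoc S (PAnafunctor.id B) T q)) = S.sndX T r := by
    rw [sndX_assoc, e2]
    exact sndX_assocSnd q
  have h' := h.symm.trans (lX_eq_of_fstX_eq hs)
  refine ⟨r, h', ?_⟩
  rw [comp_val _ _ (assoc S (PAnafunctor.id B) T q) _ h.symm (lX_eq_of_fstX_eq hs),
    associator_val_assoc _ rfl, whiskerLeft_val_of_fstX_eq _ _ _ hs (lX_sndX_eq hs),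
    induced_val_eq_one _ _ ht, whiskerRight_val_eq_one _ _ _ e2.symm
      (induced_val_eq_one _ _ e1.symm), mul_one]

end Laws
end TwoCell

/-! ### The bicategory of anafunctors -/

/-- The bicategory of action groupoids, anafunctors and natural transformations. -/
@[reducible]
def anaBicategory (P : Set ActionProperty) : Bicategory.{u, u + 1} (ActGpd.{u} P) where
  Hom := PAnafunctor
  id := PAnafunctor.id
  comp := PAnafunctor.comp
  homCategory := inferInstance
  whiskerLeft S _ _ θ := TwoCell.whiskerLeft S θ
  whiskerRight η T := TwoCell.whiskerRight η T
  associator S T U := TwoCell.inducedIso (TwoCell.associatorMap S T U)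
  leftUnitor S := TwoCell.inducedIso (TwoCell.leftUnitorMap S)
  rightUnitor S := TwoCell.inducedIso (TwoCell.rightUnitorMap S)
  whiskerLeft_id := TwoCell.whiskerLeft_id
  whiskerLeft_comp S _ _ _ η θ := TwoCell.whiskerLeft_comp S η θ
  id_whiskerLeft := TwoCell.id_whiskerLeft
  comp_whiskerLeft S T _ _ θ := TwoCell.comp_whiskerLeft S T θ
  id_whiskerRight := TwoCell.id_whiskerRight
  comp_whiskerRight := TwoCell.comp_whiskerRight
  whiskerRight_id := TwoCell.whiskerRight_id
  whiskerRight_comp {_ _ _ _ S S'} η T U := by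
    -- The bicategory axiom conjugates the other way; it follows by cancelling the associators.
    have h := TwoCell.associator_conj_whiskerRight η T U
    change (TwoCell.inducedIso (TwoCell.associatorMap S T U)).hom ≫
      (show S.comp (T.comp U) ⟶ S'.comp (T.comp U) from η.whiskerRight (T.comp U)) ≫
      (TwoCell.inducedIso (TwoCell.associatorMap S' T U)).inv = _ at h
    rw [← h, Category.assoc, Category.assoc, Iso.inv_hom_id, Category.comp_id,
      Iso.inv_hom_id_assoc]
  whisker_assoc S _ _ θ U := TwoCell.whisker_assoc S θ U
  whisker_exchange := TwoCell.whisker_exchange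
  pentagon := TwoCell.pentagon
  triangle := TwoCell.triangle

/-! ### The prescribed formulas, in terms of arrows -/

namespace PAnafunctor.IsVertical

variable {A B : ActGpd.{u} P} {S : PAnafunctor A B} {k : S.apex.gpd.Arr} {y y' : S.X}

theorem elt_smul (h : S.IsVertical k y y') : S.apex.action.elt k • y = y' := by
  have h1 : S.apex.action.source k = y := h.src_eq
  have h2 : S.apex.action.elt k • S.apex.action.source k = y' := h.tgt_eq
  rw [← h2, h1]

theorem lG_elt (h : S.IsVertical k y y') : S.lG (S.apex.action.elt k) = 1 :=
  (S.left_equivariant.elt_arr k).symm.trans (congrArg A.action.elt h.left_eq)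

end PAnafunctor.IsVertical

namespace TwoCell

open PAnafunctor

variable {A B C D : ActGpd.{u} P}

/-- Translates an evaluation by group elements back into an equality of arrows. -/
theorem app_eq_right_arr {S S' : PAnafunctor A C} {T : PAnafunctor B C} (η : TwoCell S S') {y : S.X}
    {z : S'.X} (h : S.lX y = S'.lX z) {k : T.apex.gpd.Arr}
    (h1 : η.val y z h = T.rG (T.apex.action.elt k)) (h2 : S.rX y = T.rX (T.apex.action.source k)) :
    η.app y z h = T.right.arr k := by
  refine C.action.arr_ext (h1.trans (T.right_equivariant.elt_arr k).symm) ?_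
  exact (η.src_app y z h).trans (h2.trans (T.right.source_arr k).symm)

theorem induced_app {S T : PAnafunctor A B} (f : ApexMap S T) {y : S.X} {z : T.X}
    (h : S.lX y = T.lX z) {k : T.apex.gpd.Arr} (hk : T.IsVertical k (f.toFun y) z) :
    (induced f).app y z h = T.right.arr k := by
  refine app_eq_right_arr _ _ (induced_val f h hk.elt_smul hk.lG_elt) ?_
  exact (f.rX y).symm.trans (congrArg T.rX hk.src_eq.symm)

theorem comp_app {S T U : PAnafunctor A B} (η : TwoCell S T) (θ : TwoCell T U) (y : S.X) (t : T.X)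
    (w : U.X) (h : S.lX y = T.lX t) (h' : T.lX t = U.lX w) :
    (η.comp θ).app y w (h.trans h') = B.gpd.mul (θ.app t w h') (η.app y t h)
      ((θ.src_app t w h').trans (η.tgt_app y t h).symm) :=
  B.action.arr_ext (comp_val η θ t (h.trans h') h h')
    (((η.comp θ).src_app y w (h.trans h')).trans (η.src_app y t h).symm)

theorem whiskerRight_app {S S' : PAnafunctor A B} (η : TwoCell S S') (T : PAnafunctor B C)
    {q : (S.comp T).X} {q' : (S'.comp T).X} (h : (S.comp T).lX q = (S'.comp T).lX q')
    (h' : S.lX (S.fstX T q) = S'.lX (S'.fstX T q')) {l : T.apex.gpd.Arr}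
    (hl : T.apex.gpd.src l = S.sndX T q) (hl' : T.apex.gpd.tgt l = S'.sndX T q')
    (e : T.left.arr l = η.app (S.fstX T q) (S'.fstX T q') h') :
    (η.whiskerRight T).app q q' h = T.right.arr l := by
  refine app_eq_right_arr _ _ (whiskerRight_val η T h ?_ ?_) ?_
  · exact (congrArg (fun x : T.X => T.apex.action.elt l • x) hl.symm).trans hl'
  · exact (T.left_equivariant.elt_arr l).symm.trans (congrArg B.action.elt e)
  · exact (comp_rX q).trans (congrArg T.rX hl.symm)

theorem whiskerLeft_app (S : PAnafunctor A B) {T T' : PAnafunctor B C} (θ : TwoCell T T')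
    {q : (S.comp T).X} {q' : (S.comp T').X} (h : (S.comp T).lX q = (S.comp T').lX q')
    {k : S.apex.gpd.Arr} (hk : S.IsVertical k (S.fstX T q) (S.fstX T' q')) {l : T.apex.gpd.Arr}
    (hl : T.apex.gpd.src l = S.sndX T q) (e : T.left.arr l = S.right.arr k)
    (h' : T.lX (T.apex.gpd.tgt l) = T'.lX (S.sndX T' q')) :
    (θ.whiskerLeft S).app q q' h = C.gpd.mul (θ.app (T.apex.gpd.tgt l) (S.sndX T' q') h')
      (T.right.arr l) ((θ.src_app _ _ h').trans (T.right.tgt_arr l).symm) := by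
  have hl' : T.apex.gpd.tgt l = T.apex.action.elt l • S.sndX T q :=
    congrArg (fun x : T.X => T.apex.action.elt l • x) hl
  refine C.action.arr_ext ?_ ?_
  · refine (whiskerLeft_val S θ h (l := T.apex.action.elt l) hk.elt_smul hk.lG_elt ?_ ?_).trans ?_
    · refine (T.left_equivariant.elt_arr l).symm.trans ((congrArg B.action.elt e).trans ?_)
      exact S.right_equivariant.elt_arr k
    · rw [← hl', h']
    · refine congrArg₂ (· * ·) (θ.val_congr _ hl'.symm rfl) ?_
      exact (T.right_equivariant.elt_arr l).symm
  · refine ((θ.whiskerLeft S).src_app q q' h).trans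
      ((comp_rX q).trans ((congrArg T.rX hl.symm).trans ?_))
    exact (T.right.source_arr l).symm

/-- The group elements of `k`, `l` and `m` assemble to one element `j` of the group of the iterated
composite. It lies over `1` because `k` is vertical, and it moves the reassociated point to `q'`; so
it computes the induced `2`-cell. -/
theorem associator_app (S : PAnafunctor A B) (T : PAnafunctor B C) (U : PAnafunctor C D)
    {q : ((S.comp T).comp U).X} {q' : (S.comp (T.comp U)).X}
    (h : ((S.comp T).comp U).lX q = (S.comp (T.comp U)).lX q')
    {k : S.apex.gpd.Arr} {l : T.apex.gpd.Arr} {m : U.apex.gpd.Arr}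
    (hk : S.IsVertical k (S.fstX T ((S.comp T).fstX U q)) (S.fstX (T.comp U) q'))
    (hl : T.apex.gpd.src l = S.sndX T ((S.comp T).fstX U q))
    (hl' : T.apex.gpd.tgt l = T.fstX U (S.sndX (T.comp U) q'))
    (hm : U.apex.gpd.src m = (S.comp T).sndX U q)
    (hm' : U.apex.gpd.tgt m = T.sndX U (S.sndX (T.comp U) q'))
    (hkl : T.left.arr l = S.right.arr k) (hlm : U.left.arr m = T.right.arr l) :
    (induced (associatorMap S T U)).app q q' h = U.right.arr m := by
  have e1 : T.rG (T.apex.action.elt l) = U.lG (U.apex.action.elt m) :=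
    (T.right_equivariant.elt_arr l).symm.trans ((congrArg C.action.elt hlm.symm).trans
      (U.left_equivariant.elt_arr m))
  obtain ⟨g, hg, hg'⟩ := exists_comp_smul (assocSnd S T U q) e1
  have e2 : S.rG (S.apex.action.elt k) = (T.comp U).lG g := by
    rw [comp_lG (assocSnd S T U q), hg]
    exact (S.right_equivariant.elt_arr k).symm.trans ((congrArg B.action.elt hkl.symm).trans
      (T.left_equivariant.elt_arr l))
  obtain ⟨j, hj, hj'⟩ := exists_comp_smul (assoc S T U q) e2
  refine app_eq_right_arr _ _ ((induced_val (associatorMap S T U) h (l := j) ?_ ?_).trans ?_) ?_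
  · refine comp_ext ?_ (comp_ext ?_ ?_)
    · rw [fstX_smul, hj]
      exact (congrArg (S.apex.action.elt k • ·) (fstX_assoc q)).trans hk.elt_smul
    · rw [sndX_smul, fstX_smul, hj', hg, ← hl']
      refine congrArg (T.apex.action.elt l • ·) (Eq.trans ?_ hl.symm)
      exact (congrArg (T.fstX U) (sndX_assoc q)).trans (fstX_assocSnd q)
    · rw [sndX_smul, sndX_smul, hj', hg', ← hm']
      refine congrArg (U.apex.action.elt m • ·) (Eq.trans ?_ hm.symm)
      exact (congrArg (T.sndX U) (sndX_assoc q)).trans (sndX_assocSnd q)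
  · rw [comp_lG (assoc S T U q), hj, hk.lG_elt]
  · rw [comp_rG (assoc S T U q), hj', comp_rG (assocSnd S T U q), hg']
  · exact (comp_rX q).trans (congrArg U.rX hm.symm)

end TwoCell

/-- The bicategory of anafunctors has the prescribed cells and operations. -/
def anaBicategoryStructure (P : Set ActionProperty) :
    AnaBicategoryStructure (anaBicategory.{u} P) where
  one := Equiv.refl _
  two := Equiv.refl _
  fst := PAnafunctor.fst
  snd := PAnafunctor.snd
  one_id _ := rfl
  one_comp _ _ := PAnafunctor.isComposite_comp _
  two_id _ _ _ e _ hk := TwoCell.induced_app _ e hk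
  two_comp η θ y y' y'' e e' := TwoCell.comp_app η θ y y' y'' e e'
  two_whiskerRight η T _ _ e e' _ hl hl' hη := TwoCell.whiskerRight_app η T e e' hl hl' hη
  two_whiskerLeft S _ _ θ _ _ e _ hk _ hl hkl e' := TwoCell.whiskerLeft_app S θ e hk hl hkl e'
  two_associator S T U _ _ e _ _ _ hk hl hl' hm hm' hkl hlm :=
    TwoCell.associator_app S T U e hk hl hl' hm hm' hkl hlm
  two_leftUnitor _ _ _ e _ hk := TwoCell.induced_app _ e hk
  two_rightUnitor _ _ _ e _ hk := TwoCell.induced_app _ e hk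

end AnaGpd

end

theorem propositionp (P : Set AnaGpd.ActionProperty) :
    ∃ ℬ : Bicategory.{u, u + 1} (AnaGpd.ActGpd.{u} P), Nonempty (AnaGpd.AnaBicategoryStructure ℬ) :=
  ⟨AnaGpd.anaBicategory P, ⟨AnaGpd.anaBicategoryStructure P⟩⟩
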